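/- Let $G=\{G(x),x\in\mathbb R\}$ be a jointly measurable mean zero Gaussian process with stationary increments, let $\sigma^2(h)=E(G(h)-G(0))^2$, so that $E(G(x)-G(y))^2=\sigma^2(x-y)=\sigma^2(|x-y|)$, and assume $\sigma^2\not\equiv 0$. Fix $-\infty<a<b<\infty$. Let $\mu$ be the standard Gaussian measure on $\mathbb R$, let $\eta$ be a standard normal random variable, and set $$\rho_h(x-y)=\frac{1}{\sigma^2(h)}E\big[(G(x+h)-G(x))(G(y+h)-G(y))\big],\qquad I_G(f,h;a,b)=\int_a^b f\Big(\frac{G(x+h)-G(x)}{\sigma(h)}\Big)dx .$$ Assume that for every integer $j\ge 1$ there is a constant $C_j$ such that, for all sufficiently small $h>0$, $$\sup_{a\le x\le b}\int_a^b|\rho_h(x-y)|^j\,dy\le C_j\int_a^b\!\!\int_a^b|\rho_h(x-y)|^j\,dx\,dy ,$$ and that for every integer $j\ge 1$, as $h\downarrow 0$, $$\Big(\int_a^b\!\!\int_a^b|\rho_h(x-y)|^j\,dx\,dy\Big)^{1/j}=o\Big(\Big(\int_a^b\!\!\int_a^b|\rho_h(x-y)|^{j+1}\,dx\,dy\Big)^{1/(j+1)}\Big).$$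 Then for every symmetric $f\in L^2(\mathbb R,d\mu)$ that is not $\mu$-almost everywhere equal to a constant, for all sufficiently small $h>0$ one has $\sigma^2(h)>0$, the integral $I_G(f,h;a,b)$ exists almost surely and is a square integrable random variable with $\mathrm{Var}\,I_G(f,h;a,b)>0$, and $$\frac{I_G(f,h;a,b)-(b-a)Ef(\eta)}{\sqrt{\mathrm{Var}\,I_G(f,h;a,b)}}\longrightarrow N(0,1)\quad\text{in law as } h\downarrow 0 .$$ -/

import Mathlib

open MeasureTheory ProbabilityTheory Filter Asymptotics Topology

namespace GaussModulus

variable {Ω : Type*} [MeasurableSpace Ω]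

/-- The process `G` has stationary increments under `P`: for every shift `t`, the process
`x ↦ G (t + x) - G t` has the same finite dimensional distributions as `x ↦ G x - G 0`. -/
def HasStationaryIncrements (G : ℝ → Ω → ℝ) (P : Measure Ω) : Prop :=
  ∀ (t : ℝ) (I : Finset ℝ),
    IdentDistrib (fun ω (x : I) ↦ G (t + x) ω - G t ω) (fun ω (x : I) ↦ G x ω - G 0 ω) P P

/-- The increments variance `σ²(h) = E (G(h) - G(0))²`. -/
noncomputable def incVar (G : ℝ → Ω → ℝ) (P : Measure Ω) (h : ℝ) : ℝ :=
  ∫ ω, (G h ω - G 0 ω) ^ 2 ∂P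

/-- The increment normalized by its standard deviation, `(G(x+h) - G(x)) / σ(h)`. -/
noncomputable def normInc (G : ℝ → Ω → ℝ) (P : Measure Ω) (h x : ℝ) (ω : Ω) : ℝ :=
  (G (x + h) ω - G x ω) / √(incVar G P h)

/-- The correlation `ρ_h(x, y) = E (G(x+h) - G(x)) (G(y+h) - G(y)) / σ²(h)`. -/
noncomputable def rho (G : ℝ → Ω → ℝ) (P : Measure Ω) (h x y : ℝ) : ℝ :=
  (∫ ω, (G (x + h) ω - G x ω) * (G (y + h) ω - G y ω) ∂P) / incVar G P h

/-- The double integral `∫_a^b ∫_a^b |ρ_h(x, y)|^j dx dy`. -/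
noncomputable def rhoInt (G : ℝ → Ω → ℝ) (P : Measure Ω) (a b : ℝ) (j : ℕ) (h : ℝ) : ℝ :=
  ∫ x in a..b, ∫ y in a..b, |rho G P h x y| ^ j

/-- The functional `I_G(f, h; a, b) = ∫_a^b f ((G(x+h) - G(x)) / σ(h)) dx`. -/
noncomputable def modulus (G : ℝ → Ω → ℝ) (P : Measure Ω) (f : ℝ → ℝ) (a b h : ℝ) (ω : Ω) : ℝ :=
  ∫ x in a..b, f (normInc G P h x ω)

end GaussModulus

/-! Let X be the normalized increment process at scale h, a Gaussian process with unit variances and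
covariance ρ_h, and put A_j = ∫∫|ρ_h|^j. Expand f = Σ a_n He_n. Since E He_m(X_x) He_n(X_y) = δ_{mn}
n! ρ^n, the variance of the functional is Σ_{n≥1} a_n² n! ∫∫ρ^n. Symmetry of f kills the odd n, so
every term is nonnegative and equals a_n² n! A_n. Let k be the least n ≥ 1 with a_n ≠ 0 and e = a_k²
k!. The variance V is at least e A_k (`ContStdGaussian.le_variance`), while |ρ_h| ≤ 1 bounds the
part of degree at least N by the L² tail of f times A_k (`ContStdGaussian.remainder_le`). Truncation
thus costs a fraction of V that tends to 0 with N, uniformly in h, and finite Hermite sums remain.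

For such a sum F, normalized by √V, Gaussian integration by parts gives E[F e^{itF}] = it E[K
e^{itF}], where K integrates ρ(x,y) times the sum with all Hermite degrees lowered by one at X_x
times the derivative of the sum at X_y. In Malliavin terms K = ⟨DF, -DL⁻¹F⟩ with L the
Ornstein-Uhlenbeck generator. This is a perturbed differential equation for the characteristic
function, whose distance at t to that of N(0,s) is therefore at most t² E|K - s|
(`ContStdGaussian.norm_charFun_addFun_sub_le`). With s = E K, which is 1 minus the truncated
fraction of the variance, everything reduces to Var K → 0.

K is a combination of double integrals of ρ He_m(X_x) He_l(X_y) with m+1, l+1 ≥ k. By Wick's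
recursion, the covariance of He_m(X_x) He_l(X_y) at two pairs of points is dominated by monomials in
ρ indexed by multigraphs on the four points with an edge between the pairs (`monoDom_cov_mom4`). The
two factors ρ add an edge inside each pair, so the graph is connected with all degrees at least k.
Integrating out the points one by one, with the supremum hypothesis, bounds each graph by a constant
times A_k A_i A_j with i, j ≥ 1 and i + j ≥ k (`exists_graphInt_le`). The gap hypothesis makes A_i
A_j = o(A_k) (`isLittleO_mul`), so the variance before normalization is o(A_k²), and division by V²
≥ e² A_k² sends it to 0.

Joint measurability does more than justify Fubini: it forces mean-square continuity
(`StationaryGaussian.tendsto_incVar`), whence ρ_h is continuous and σ²(h) > 0 for small h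
(`StationaryGaussian.eventually_incVar_pos`). -/

namespace GaussModulus

/-! ### Hermite polynomials and one-dimensional Gaussian integration by parts. -/

section Hermite

/-- The probabilists' Hermite polynomials with real coefficients. -/
noncomputable def hermiteR (n : ℕ) : Polynomial ℝ :=
  (Polynomial.hermite n).map (Int.castRingHom ℝ)

open Polynomial in
lemma hermiteR_succ (n : ℕ) : hermiteR (n + 1) = X * hermiteR n - derivative (hermiteR n) := by
  simp [hermiteR, Polynomial.hermite_succ, Polynomial.derivative_map]

@[simp] lemma hermiteR_zero : hermiteR 0 = 1 := by simp [hermiteR]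

-- Differentiating the three-term form of `hermiteR_succ` reproduces that recursion one degree
-- lower. This Appell property is what turns integration by parts into a recursion on degrees.
open Polynomial in
lemma derivative_hermiteR_succ (n : ℕ) :
    derivative (hermiteR (n + 1)) = ((n : ℝ) + 1) • hermiteR n := by
  induction n with
  | zero => simp [hermiteR]
  | succ n ih =>
    rw [hermiteR_succ (n + 1), derivative_sub, derivative_mul, ih, derivative_X,
      derivative_smul, hermiteR_succ n]
    simp only [Polynomial.smul_eq_C_mul, map_add, map_natCast, map_one]
    push_cast
    ring

lemma degree_hermiteR (n : ℕ) : (hermiteR n).degree = n := by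
  rw [hermiteR, Polynomial.degree_map_eq_of_injective (RingHom.injective_int _)]
  exact Polynomial.degree_hermite n

/-- The Hermite functions. -/
noncomputable def He (n : ℕ) (x : ℝ) : ℝ := (hermiteR n).eval x

@[simp] lemma He_zero (x : ℝ) : He 0 x = 1 := by simp [He]

lemma continuous_He (n : ℕ) : Continuous (He n) := (hermiteR n).continuous

@[fun_prop]
lemma measurable_He (n : ℕ) : Measurable (He n) := (continuous_He n).measurable

lemma hasDerivAt_pdf (x : ℝ) :
    HasDerivAt (gaussianPDFReal 0 1) (-x * gaussianPDFReal 0 1 x) x := by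
  have h : gaussianPDFReal 0 1 = fun x ↦ (√(2 * Real.pi))⁻¹ * Real.exp (-(x ^ 2) / 2) := by
    ext x; simp [gaussianPDFReal]
  rw [h]
  have h1 : HasDerivAt (fun x : ℝ ↦ -(x ^ 2) / 2) (-x) x := by
    have := ((hasDerivAt_pow 2 x).neg).div_const 2
    convert! this using 1
    simp; ring
  convert! (h1.exp.const_mul (√(2 * Real.pi))⁻¹) using 1
  ring

/-- Rodrigues' formula in differential form: it supplies the antiderivative used when integrating by
parts. -/
lemma hasDerivAt_pdf_mul_He (n : ℕ) (x : ℝ) :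
    HasDerivAt (fun x ↦ gaussianPDFReal 0 1 x * He n x)
      (-(gaussianPDFReal 0 1 x * He (n + 1) x)) x := by
  convert! (hasDerivAt_pdf x).mul ((hermiteR n).hasDerivAt x) using 1
  simp only [He, hermiteR_succ, Polynomial.eval_sub, Polynomial.eval_mul, Polynomial.eval_X]
  ring

variable {E : Type*} [NormedAddCommGroup E] [NormedSpace ℝ E]

lemma integrable_gaussianReal_iff {g : ℝ → E} :
    Integrable g (gaussianReal 0 1) ↔ Integrable (fun x ↦ gaussianPDFReal 0 1 x • g x) := by
  rw [gaussianReal_of_var_ne_zero 0 one_ne_zero, gaussianPDF_def,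
    integrable_withDensity_iff_integrable_smul' (by fun_prop) (by simp)]
  simp [gaussianPDFReal_nonneg]

/-- Gaussian integration by parts against a Hermite polynomial. -/
lemma integral_He_succ_smul [CompleteSpace E] (n : ℕ) {φ φ' : ℝ → E}
    (hφ : ∀ x, HasDerivAt φ (φ' x) x)
    (h1 : Integrable (fun x ↦ He (n + 1) x • φ x) (gaussianReal 0 1))
    (h2 : Integrable (fun x ↦ He n x • φ' x) (gaussianReal 0 1))
    (h3 : Integrable (fun x ↦ He n x • φ x) (gaussianReal 0 1)) :
    ∫ x, He (n + 1) x • φ x ∂gaussianReal 0 1 = ∫ x, He n x • φ' x ∂gaussianReal 0 1 := by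
  rw [integrable_gaussianReal_iff] at h1 h2 h3
  rw [integral_gaussianReal_eq_integral_smul one_ne_zero,
    integral_gaussianReal_eq_integral_smul one_ne_zero]
  have := integral_bilinear_hasDerivAt_right_eq_neg_left_of_integrable
    (L := ContinuousLinearMap.lsmul ℝ ℝ (E := E))
    (u := fun x ↦ gaussianPDFReal 0 1 x * He n x) (v := φ)
    (fun x _ ↦ hasDerivAt_pdf_mul_He n x) (fun x _ ↦ hφ x)
    (by simpa [smul_smul] using h2) (by simpa [smul_smul] using h1)
    (by simpa [smul_smul] using h3)
  simp only [ContinuousLinearMap.lsmul_apply, neg_smul, integral_neg, neg_neg] at this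
  simp only [smul_smul]
  exact this.symm

end Hermite

/-! ### The algebra of random variables with all moments. -/

section Moments

variable {Ω : Type*} [MeasurableSpace Ω] {P : Measure Ω}

/-- A real random variable with finite absolute moments of all orders. -/
def AllMoments (Y : Ω → ℝ) (P : Measure Ω) : Prop := ∀ p : ENNReal, p ≠ ⊤ → MemLp Y p P

lemma AllMoments.add {Y Z : Ω → ℝ} (hY : AllMoments Y P) (hZ : AllMoments Z P) :
    AllMoments (fun ω ↦ Y ω + Z ω) P := fun p hp ↦ (hY p hp).add (hZ p hp)

/-- Hölder with both exponents doubled; requiring all finite exponents at once is what makes the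
class closed under products. -/
lemma AllMoments.mul {Y Z : Ω → ℝ} (hY : AllMoments Y P) (hZ : AllMoments Z P) :
    AllMoments (fun ω ↦ Y ω * Z ω) P := fun p hp ↦ by
  have : ENNReal.HolderTriple (2 * p) (2 * p) p := by
    constructor
    rw [ENNReal.mul_inv (by simp) (by simp), ← add_mul, ENNReal.inv_two_add_inv_two, one_mul]
  have h2 : 2 * p ≠ ⊤ := ENNReal.mul_ne_top (by simp) hp
  exact (hZ _ h2).mul' (hY _ h2)

lemma AllMoments.const_mul {Y : Ω → ℝ} (hY : AllMoments Y P) (c : ℝ) :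
    AllMoments (fun ω ↦ c * Y ω) P := fun p hp ↦ (hY p hp).const_mul c

lemma allMoments_const [IsFiniteMeasure P] (c : ℝ) : AllMoments (fun _ : Ω ↦ c) P :=
  fun _ _ ↦ memLp_const c

lemma AllMoments.sum [IsFiniteMeasure P] {ι : Type*} (s : Finset ι) {Y : ι → Ω → ℝ}
    (hY : ∀ i ∈ s, AllMoments (Y i) P) :
    AllMoments (fun ω ↦ ∑ i ∈ s, Y i ω) P := fun p hp ↦ by
  exact memLp_finsetSum s fun i hi ↦ hY i hi p hp

lemma AllMoments.pow [IsFiniteMeasure P] {Y : Ω → ℝ} (hY : AllMoments Y P) (n : ℕ) :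
    AllMoments (fun ω ↦ Y ω ^ n) P := by
  induction n with
  | zero => simpa using allMoments_const (1 : ℝ)
  | succ n ih => simpa [pow_succ] using ih.mul hY

lemma AllMoments.polynomial [IsFiniteMeasure P] {Y : Ω → ℝ} (hY : AllMoments Y P)
    (p : Polynomial ℝ) : AllMoments (fun ω ↦ p.eval (Y ω)) P := by
  simp_rw [Polynomial.eval_eq_sum_range]
  exact AllMoments.sum _ fun i _ ↦ (hY.pow i).const_mul _

lemma AllMoments.He [IsFiniteMeasure P] {Y : Ω → ℝ} (hY : AllMoments Y P) (n : ℕ) :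
    AllMoments (fun ω ↦ He n (Y ω)) P := hY.polynomial _

lemma AllMoments.memLp_two {Y : Ω → ℝ} (hY : AllMoments Y P) : MemLp Y 2 P := hY 2 (by simp)

lemma AllMoments.integrable {Y : Ω → ℝ} (hY : AllMoments Y P) : Integrable Y P :=
  memLp_one_iff_integrable.1 (hY 1 (by simp))

lemma allMoments_id_gaussianReal : AllMoments (fun x : ℝ ↦ x) (gaussianReal 0 1) :=
  fun p hp ↦ IsGaussian.memLp_id _ p hp

end Moments

/-! ### Gaussian processes with unit variance and integration by parts along them. -/

section StdGaussian

variable {Ω T : Type*} [MeasurableSpace Ω] {P : Measure Ω} {X : T → Ω → ℝ}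

/-- A centred Gaussian process all of whose coordinates are measurable with unit variance. -/
structure StdGaussian (X : T → Ω → ℝ) (P : Measure Ω) : Prop where
  gauss : IsGaussianProcess X P
  meas : ∀ t, Measurable (X t)
  mean : ∀ t, ∫ ω, X t ω ∂P = 0
  sq : ∀ t, ∫ ω, X t ω ^ 2 ∂P = 1

/-- The covariance function of a centred process. -/
noncomputable def cov2 (X : T → Ω → ℝ) (P : Measure Ω) (s t : T) : ℝ := ∫ ω, X s ω * X t ω ∂P

lemma cov2_comm (s t : T) : cov2 X P s t = cov2 X P t s := by
  simp [cov2, mul_comm]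

namespace StdGaussian

variable (hX : StdGaussian X P)
include hX

lemma isProb : IsProbabilityMeasure P := hX.gauss.isProbabilityMeasure

lemma comp {S : Type*} (g : S → T) : StdGaussian (fun s ↦ X (g s)) P :=
  ⟨hX.gauss.comp_right g, fun _ ↦ hX.meas _, fun _ ↦ hX.mean _, fun _ ↦ hX.sq _⟩

lemma allMoments (t : T) : AllMoments (X t) P := fun _ hp ↦ (hX.gauss.hasGaussianLaw_eval t).memLp hp

lemma cov2_self (t : T) : cov2 X P t t = 1 := by
  rw [← hX.sq t]; simp [cov2, pow_two]

lemma covariance_eq (s t : T) : cov[X s, X t; P] = cov2 X P s t := by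
  have := hX.isProb
  rw [covariance_eq_sub (hX.allMoments s).memLp_two (hX.allMoments t).memLp_two, hX.mean, hX.mean]
  simp [cov2]

lemma map_eq (t : T) : P.map (X t) = gaussianReal 0 1 := by
  have := hX.isProb
  rw [(hX.gauss.hasGaussianLaw_eval t).map_eq_gaussianReal, hX.mean,
    variance_eq_sub (hX.allMoments t).memLp_two, hX.mean]
  simp [hX.sq]

lemma abs_cov2_le (s t : T) : |cov2 X P s t| ≤ 1 := by
  have := hX.isProb
  have h1 : ∀ ε : ℝ, 0 ≤ ∫ ω, (X s ω + ε * X t ω) ^ 2 ∂P := fun ε ↦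
    integral_nonneg fun ω ↦ sq_nonneg _
  have h2 : ∀ ε : ℝ, ∫ ω, (X s ω + ε * X t ω) ^ 2 ∂P = 1 + 2 * ε * cov2 X P s t + ε ^ 2 := by
    intro ε
    have : ∀ ω, (X s ω + ε * X t ω) ^ 2 =
        X s ω ^ 2 + (2 * ε) * (X s ω * X t ω) + ε ^ 2 * X t ω ^ 2 := fun ω ↦ by ring
    simp_rw [this]
    rw [integral_add, integral_add, integral_const_mul, integral_const_mul, hX.sq, hX.sq]
    · simp [cov2]
    · exact ((hX.allMoments s).pow 2).integrable
    · exact (((hX.allMoments s).mul (hX.allMoments t)).const_mul _).integrable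
    · exact (((hX.allMoments s).pow 2).add
        (((hX.allMoments s).mul (hX.allMoments t)).const_mul _)).integrable
    · exact (((hX.allMoments t).pow 2).const_mul _).integrable
  rw [abs_le]
  constructor
  · have := h1 1; rw [h2] at this; linarith
  · have := h1 (-1); rw [h2] at this; linarith

/-- Gaussian regression: `X t₀` and the residual process are jointly Gaussian and uncorrelated, and
for jointly Gaussian families this is independence. -/
lemma indepFun_residual (t₀ : T) :
    IndepFun (X t₀) (fun ω t ↦ X t ω - cov2 X P t₀ t * X t₀ ω) P := by
  classical
  have := hX.isProb
  have hG : IsGaussianProcess (Sum.elim (fun _ : Unit ↦ X t₀)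
      (fun t ω ↦ X t ω - cov2 X P t₀ t * X t₀ ω)) P := by
    refine hX.gauss.of_isGaussianProcess ?_
    rintro (_ | t)
    · exact ⟨{t₀}, .proj ⟨t₀, by simp⟩, fun ω ↦ rfl⟩
    · exact ⟨{t₀, t}, .proj ⟨t, by simp⟩ - cov2 X P t₀ t • .proj ⟨t₀, by simp⟩, fun ω ↦ rfl⟩
  have h := hG.indepFun_of_covariance_eq_zero (fun _ ↦ (hX.meas _).aemeasurable)
    (fun t ↦ ((hX.meas t).sub ((hX.meas t₀).const_mul _)).aemeasurable) (fun _ t ↦ by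
      rw [covariance_fun_sub_right (hX.allMoments _).memLp_two (hX.allMoments _).memLp_two
        ((hX.allMoments _).const_mul _).memLp_two, covariance_const_mul_right,
        hX.covariance_eq, hX.covariance_eq, hX.cov2_self]
      ring)
  exact h.comp (φ := fun x : Unit → ℝ ↦ x ()) (ψ := id) (measurable_pi_apply _) measurable_id

variable {E : Type*} [NormedAddCommGroup E] [NormedSpace ℝ E] [CompleteSpace E]

/-- Gaussian integration by parts for a functional of a Gaussian process. -/
lemma integral_He_succ_smul (t₀ : T) (n : ℕ) {Ψ Ψ' : (T → ℝ) → E}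
    (hΨm : StronglyMeasurable Ψ) (hΨm' : StronglyMeasurable Ψ')
    (hd : ∀ (r : T → ℝ) (u : ℝ), HasDerivAt (fun u ↦ Ψ (fun t ↦ r t + u * cov2 X P t₀ t))
      (Ψ' (fun t ↦ r t + u * cov2 X P t₀ t)) u)
    (h1 : Integrable (fun ω ↦ GaussModulus.He (n + 1) (X t₀ ω) • Ψ (fun t ↦ X t ω)) P)
    (h2 : Integrable (fun ω ↦ GaussModulus.He n (X t₀ ω) • Ψ' (fun t ↦ X t ω)) P)
    (h3 : Integrable (fun ω ↦ GaussModulus.He n (X t₀ ω) • Ψ (fun t ↦ X t ω)) P) :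
    ∫ ω, GaussModulus.He (n + 1) (X t₀ ω) • Ψ (fun t ↦ X t ω) ∂P =
      ∫ ω, GaussModulus.He n (X t₀ ω) • Ψ' (fun t ↦ X t ω) ∂P := by
  have := hX.isProb
  -- Conditionally on the residual `r`, the whole process is `r + u * cov2 X P t₀ ·` with `u`
  -- standard normal, so the claim becomes the one-dimensional formula along the covariance
  -- direction.
  set R : Ω → T → ℝ := fun ω t ↦ X t ω - cov2 X P t₀ t * X t₀ ω with hR
  have hRm : Measurable R := measurable_pi_lambda _ fun t ↦
    (hX.meas t).sub ((hX.meas t₀).const_mul _)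
  have hlaw : P.map (fun ω ↦ (X t₀ ω, R ω)) = (gaussianReal 0 1).prod (P.map R) := by
    rw [(indepFun_iff_map_prod_eq_prod_map_map (hX.meas t₀).aemeasurable
      hRm.aemeasurable).1 (hX.indepFun_residual t₀), hX.map_eq]
  have hpm : Measurable (fun ω ↦ (X t₀ ω, R ω)) := (hX.meas t₀).prodMk hRm
  have : IsProbabilityMeasure (P.map R) := Measure.isProbabilityMeasure_map hRm.aemeasurable
  have hS : Measurable (fun p : ℝ × (T → ℝ) ↦ fun t ↦ p.2 t + p.1 * cov2 X P t₀ t) := by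
    fun_prop
  have key : ∀ (m : ℕ) (Φ : (T → ℝ) → E), StronglyMeasurable Φ →
      Integrable (fun ω ↦ GaussModulus.He m (X t₀ ω) • Φ (fun t ↦ X t ω)) P →
      Integrable (fun p : ℝ × (T → ℝ) ↦ GaussModulus.He m p.1 •
        Φ (fun t ↦ p.2 t + p.1 * cov2 X P t₀ t)) ((gaussianReal 0 1).prod (P.map R)) ∧
      ∫ ω, GaussModulus.He m (X t₀ ω) • Φ (fun t ↦ X t ω) ∂P =
        ∫ r, ∫ u, GaussModulus.He m u • Φ (fun t ↦ r t + u * cov2 X P t₀ t)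
          ∂gaussianReal 0 1 ∂(P.map R) := by
    intro m Φ hΦ hint
    have hmeas : StronglyMeasurable (fun p : ℝ × (T → ℝ) ↦ GaussModulus.He m p.1 •
        Φ (fun t ↦ p.2 t + p.1 * cov2 X P t₀ t)) :=
      ((measurable_He m).comp measurable_fst).stronglyMeasurable.smul
        (hΦ.comp_measurable hS)
    have he : ∀ ω, (fun t ↦ R ω t + X t₀ ω * cov2 X P t₀ t) = fun t ↦ X t ω := by
      intro ω; ext t; simp [hR]; ring
    have hI : Integrable (fun p : ℝ × (T → ℝ) ↦ GaussModulus.He m p.1 •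
        Φ (fun t ↦ p.2 t + p.1 * cov2 X P t₀ t)) ((gaussianReal 0 1).prod (P.map R)) := by
      rw [← hlaw, integrable_map_measure hmeas.aestronglyMeasurable hpm.aemeasurable]
      simpa [Function.comp_def, he] using hint
    refine ⟨hI, ?_⟩
    rw [← integral_prod_symm _ hI, ← hlaw,
      integral_map hpm.aemeasurable hmeas.aestronglyMeasurable]
    simp [he]
  obtain ⟨i1, e1⟩ := key _ _ hΨm h1
  obtain ⟨i2, e2⟩ := key _ _ hΨm' h2
  obtain ⟨i3, -⟩ := key _ _ hΨm h3
  rw [e1, e2]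
  refine integral_congr_ae ?_
  filter_upwards [i1.prod_left_ae, i2.prod_left_ae, i3.prod_left_ae] with r j1 j2 j3
  exact GaussModulus.integral_He_succ_smul n (fun u ↦ hd r u) j1 j2 j3

end StdGaussian

end StdGaussian

/-! ### Mixed moments of Hermite polynomials and Wick's recursion. -/

section HermiteMoments

variable {Ω T : Type*} [MeasurableSpace Ω] {P : Measure Ω} {X : T → Ω → ℝ}

namespace StdGaussian

-- Integration by parts for a product functional: the product rule distributes the derivative over
-- the three factors. The points may coincide, so the same formula serves for two, three or four
-- points.
open Polynomial in
lemma integral_He_succ_mul_eval (hX : StdGaussian X P) (t₀ t₁ t₂ t₃ : T) (n : ℕ) (p q s : ℝ[X]) :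
    ∫ ω, GaussModulus.He (n + 1) (X t₀ ω) *
        (p.eval (X t₁ ω) * q.eval (X t₂ ω) * s.eval (X t₃ ω)) ∂P =
      cov2 X P t₀ t₁ * ∫ ω, GaussModulus.He n (X t₀ ω) *
        ((derivative p).eval (X t₁ ω) * q.eval (X t₂ ω) * s.eval (X t₃ ω)) ∂P +
      cov2 X P t₀ t₂ * ∫ ω, GaussModulus.He n (X t₀ ω) *
        (p.eval (X t₁ ω) * (derivative q).eval (X t₂ ω) * s.eval (X t₃ ω)) ∂P +
      cov2 X P t₀ t₃ * ∫ ω, GaussModulus.He n (X t₀ ω) *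
        (p.eval (X t₁ ω) * q.eval (X t₂ ω) * (derivative s).eval (X t₃ ω)) ∂P := by
  have := hX.isProb
  have hm : ∀ (m : ℕ) (p q s : ℝ[X]), AllMoments (fun ω ↦ GaussModulus.He m (X t₀ ω) *
      (p.eval (X t₁ ω) * q.eval (X t₂ ω) * s.eval (X t₃ ω))) P := fun m p q s ↦
    ((hX.allMoments t₀).He m).mul ((((hX.allMoments t₁).polynomial p).mul
      ((hX.allMoments t₂).polynomial q)).mul ((hX.allMoments t₃).polynomial s))
  have hc : ∀ (p : ℝ[X]) (t : T), StronglyMeasurable fun x : T → ℝ ↦ p.eval (x t) := fun p t ↦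
    (p.continuous.measurable.comp (measurable_pi_apply t)).stronglyMeasurable
  have hsplit : ∀ ω, GaussModulus.He n (X t₀ ω) *
      (cov2 X P t₀ t₁ * ((derivative p).eval (X t₁ ω) * q.eval (X t₂ ω) * s.eval (X t₃ ω)) +
       cov2 X P t₀ t₂ * (p.eval (X t₁ ω) * (derivative q).eval (X t₂ ω) * s.eval (X t₃ ω)) +
       cov2 X P t₀ t₃ * (p.eval (X t₁ ω) * q.eval (X t₂ ω) * (derivative s).eval (X t₃ ω))) =
      cov2 X P t₀ t₁ * (GaussModulus.He n (X t₀ ω) *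
        ((derivative p).eval (X t₁ ω) * q.eval (X t₂ ω) * s.eval (X t₃ ω))) +
      cov2 X P t₀ t₂ * (GaussModulus.He n (X t₀ ω) *
        (p.eval (X t₁ ω) * (derivative q).eval (X t₂ ω) * s.eval (X t₃ ω))) +
      cov2 X P t₀ t₃ * (GaussModulus.He n (X t₀ ω) *
        (p.eval (X t₁ ω) * q.eval (X t₂ ω) * (derivative s).eval (X t₃ ω))) := fun ω ↦ by ring
  have h2 := fun p q s ↦ ((hm n p q s)).integrable
  have key := hX.integral_He_succ_smul t₀ n
    (Ψ := fun x ↦ p.eval (x t₁) * q.eval (x t₂) * s.eval (x t₃))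
    (Ψ' := fun x ↦
      cov2 X P t₀ t₁ * ((derivative p).eval (x t₁) * q.eval (x t₂) * s.eval (x t₃)) +
      cov2 X P t₀ t₂ * (p.eval (x t₁) * (derivative q).eval (x t₂) * s.eval (x t₃)) +
      cov2 X P t₀ t₃ * (p.eval (x t₁) * q.eval (x t₂) * (derivative s).eval (x t₃)))
    (((hc _ _).mul (hc _ _)).mul (hc _ _))
    (((((((hc _ _).mul (hc _ _)).mul (hc _ _)).const_mul _)).add
      ((((hc _ _).mul (hc _ _)).mul (hc _ _)).const_mul _)).add
      ((((hc _ _).mul (hc _ _)).mul (hc _ _)).const_mul _))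
    (fun r u ↦ by
      have hl : ∀ (p : ℝ[X]) (t : T), HasDerivAt (fun u ↦ p.eval (r t + u * cov2 X P t₀ t))
          ((derivative p).eval (r t + u * cov2 X P t₀ t) * cov2 X P t₀ t) u := by
        intro p t
        have h1 : HasDerivAt (fun u ↦ r t + u * cov2 X P t₀ t) (cov2 X P t₀ t) u := by
          simpa using ((hasDerivAt_id u).mul_const (cov2 X P t₀ t)).const_add (r t)
        exact (p.hasDerivAt _).comp u h1
      convert! ((hl p t₁).mul (hl q t₂)).mul (hl s t₃) using 1
      simp only [Pi.mul_apply]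
      ring)
    (by simpa using (hm (n + 1) p q s).integrable)
    (by
      simp only [smul_eq_mul, hsplit]
      exact (((h2 _ _ _).const_mul _).add ((h2 _ _ _).const_mul _)).add ((h2 _ _ _).const_mul _))
    (by simpa using (hm n p q s).integrable)
  simp only [smul_eq_mul, hsplit] at key
  rw [key, integral_add, integral_add, integral_const_mul, integral_const_mul, integral_const_mul]
  · exact (h2 _ _ _).const_mul _
  · exact (h2 _ _ _).const_mul _
  · exact ((h2 _ _ _).const_mul _).add ((h2 _ _ _).const_mul _)
  · exact (h2 _ _ _).const_mul _

lemma integral_He_succ (hX : StdGaussian X P) (t : T) (n : ℕ) :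
    ∫ ω, GaussModulus.He (n + 1) (X t ω) ∂P = 0 := by
  simpa using hX.integral_He_succ_mul_eval t t t t n 1 1 1

/-- Orthogonality relation for Hermite functions of correlated standard normal variables. -/
lemma integral_He_mul_He (hX : StdGaussian X P) (s t : T) (m n : ℕ) :
    ∫ ω, GaussModulus.He m (X s ω) * GaussModulus.He n (X t ω) ∂P =
      if m = n then (m.factorial : ℝ) * cov2 X P s t ^ m else 0 := by
  have := hX.isProb
  induction m generalizing n with
  | zero =>
    cases n with
    | zero => simp
    | succ n => simpa using hX.integral_He_succ t n
  | succ m ih =>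
    have h := hX.integral_He_succ_mul_eval s t t t m (hermiteR n) 1 1
    simp only [Polynomial.eval_one, mul_one, Polynomial.derivative_one, Polynomial.eval_zero,
      mul_zero, integral_zero, add_zero] at h
    change ∫ ω, _ * GaussModulus.He n (X t ω) ∂P = _ at h
    rw [h]
    cases n with
    | zero => simp
    | succ n =>
      simp only [derivative_hermiteR_succ, Polynomial.eval_smul, smul_eq_mul]
      have : ∀ ω, GaussModulus.He m (X s ω) *
          (((n : ℝ) + 1) * (hermiteR n).eval (X t ω)) =
          ((n : ℝ) + 1) * (GaussModulus.He m (X s ω) * GaussModulus.He n (X t ω)) := fun ω ↦ by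
        simp only [GaussModulus.He]; ring
      simp_rw [this]
      rw [integral_const_mul, ih]
      by_cases hmn : m = n
      · subst hmn
        simp [Nat.factorial_succ]
        ring
      · simp [hmn]

end StdGaussian

/-- The mixed moment of four Hermite functions of a Gaussian family. -/
noncomputable def mom4 (X : T → Ω → ℝ) (P : Measure Ω) (t₁ t₂ t₃ t₄ : T) (a b c d : ℕ) : ℝ :=
  ∫ ω, He a (X t₁ ω) * (He b (X t₂ ω) * He c (X t₃ ω) * He d (X t₄ ω)) ∂P

lemma eval_derivative_hermiteR (n : ℕ) (x : ℝ) :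
    (Polynomial.derivative (hermiteR n)).eval x = n * He (n - 1) x := by
  cases n with
  | zero => simp
  | succ n => simp [derivative_hermiteR_succ, He]

/-- Wick's recursion: one half-edge at `t₁` is paired with one of the half-edges at another vertex.
No loop at `t₁` arises because the Hermite factor there has absorbed it. Truncated subtraction is
harmless, as the factor in front vanishes at degree zero. -/
lemma StdGaussian.mom4_succ (hX : StdGaussian X P) (t₁ t₂ t₃ t₄ : T) (a b c d : ℕ) :
    mom4 X P t₁ t₂ t₃ t₄ (a + 1) b c d =
      cov2 X P t₁ t₂ * (b * mom4 X P t₁ t₂ t₃ t₄ a (b - 1) c d) +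
      cov2 X P t₁ t₃ * (c * mom4 X P t₁ t₂ t₃ t₄ a b (c - 1) d) +
      cov2 X P t₁ t₄ * (d * mom4 X P t₁ t₂ t₃ t₄ a b c (d - 1)) := by
  have h := hX.integral_He_succ_mul_eval t₁ t₂ t₃ t₄ a (hermiteR b) (hermiteR c) (hermiteR d)
  simp only [eval_derivative_hermiteR] at h
  have e₂ : b * mom4 X P t₁ t₂ t₃ t₄ a (b - 1) c d = ∫ ω, GaussModulus.He a (X t₁ ω) *
      (b * GaussModulus.He (b - 1) (X t₂ ω) * (hermiteR c).eval (X t₃ ω) *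
        (hermiteR d).eval (X t₄ ω)) ∂P := by
    rw [mom4, ← integral_const_mul]
    congr 1; funext ω; simp only [GaussModulus.He]; ring
  have e₃ : c * mom4 X P t₁ t₂ t₃ t₄ a b (c - 1) d = ∫ ω, GaussModulus.He a (X t₁ ω) *
      ((hermiteR b).eval (X t₂ ω) * (c * GaussModulus.He (c - 1) (X t₃ ω)) *
        (hermiteR d).eval (X t₄ ω)) ∂P := by
    rw [mom4, ← integral_const_mul]
    congr 1; funext ω; simp only [GaussModulus.He]; ring
  have e₄ : d * mom4 X P t₁ t₂ t₃ t₄ a b c (d - 1) = ∫ ω, GaussModulus.He a (X t₁ ω) *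
      ((hermiteR b).eval (X t₂ ω) * (hermiteR c).eval (X t₃ ω) *
        (d * GaussModulus.He (d - 1) (X t₄ ω))) ∂P := by
    rw [mom4, ← integral_const_mul]
    congr 1; funext ω; simp only [GaussModulus.He]; ring
  rw [e₂, e₃, e₄]
  exact h

/-- Relabelling vertices lets the recursion, stated at the first vertex, be run at any vertex of
positive degree. -/
lemma mom4_swap (t₁ t₂ t₃ t₄ : T) (a b c d : ℕ) :
    mom4 X P t₁ t₂ t₃ t₄ a b c d = mom4 X P t₂ t₁ t₃ t₄ b a c d := by
  unfold mom4; congr 1; ext ω; ring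

lemma mom4_swap' (t₁ t₂ t₃ t₄ : T) (a b c d : ℕ) :
    mom4 X P t₁ t₂ t₃ t₄ a b c d = mom4 X P t₃ t₂ t₁ t₄ c b a d := by
  unfold mom4; congr 1; ext ω; ring

end HermiteMoments

/-! ### Domination by monomials in the six pairwise correlations. -/

section EdgeMonomials

/-- The monomial with exponents `n` in the absolute values of the six edge variables `r`; the edges
of the complete graph on `{1, 2, 3, 4}` are listed as `12, 34, 13, 14, 23, 24`. -/
def edgeMono (n : Fin 6 → ℕ) (r : Fin 6 → ℝ) : ℝ := ∏ i, |r i| ^ n i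

lemma edgeMono_nonneg (n : Fin 6 → ℕ) (r : Fin 6 → ℝ) : 0 ≤ edgeMono n r :=
  Finset.prod_nonneg fun _ _ ↦ by positivity

lemma edgeMono_add_single (n : Fin 6 → ℕ) (r : Fin 6 → ℝ) (e : Fin 6) :
    edgeMono (n + Pi.single e 1) r = |r e| * edgeMono n r := by
  unfold edgeMono
  simp only [Pi.add_apply, pow_add, Finset.prod_mul_distrib]
  rw [mul_comm]
  congr 1
  rw [Finset.prod_eq_single e]
  · simp
  · intro b _ hb; simp [Pi.single_eq_of_ne hb]
  · simp

variable {I : Type*}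

/-- `G` is bounded by a nonnegative combination of monomials with exponents in `S`, evaluated
at `r`. -/
def MonoDom (r : I → Fin 6 → ℝ) (S : Set (Fin 6 → ℕ)) (G : I → ℝ) : Prop :=
  ∃ (C : ℝ) (L : List (Fin 6 → ℕ)), 0 ≤ C ∧ (∀ n ∈ L, n ∈ S) ∧
    ∀ i, |G i| ≤ C * (L.map fun n ↦ edgeMono n (r i)).sum

variable {r : I → Fin 6 → ℝ} {S S' : Set (Fin 6 → ℕ)} {G G' : I → ℝ}

lemma sum_edgeMono_nonneg (L : List (Fin 6 → ℕ)) (r : Fin 6 → ℝ) :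
    0 ≤ (L.map fun n ↦ edgeMono n r).sum :=
  List.sum_nonneg fun x hx ↦ by
    obtain ⟨n, -, rfl⟩ := List.mem_map.1 hx
    exact edgeMono_nonneg _ _

lemma MonoDom.zero : MonoDom r S (fun _ ↦ 0) := ⟨0, [], le_rfl, by simp, by simp⟩

lemma MonoDom.add (h : MonoDom r S G) (h' : MonoDom r S G') :
    MonoDom r S (fun i ↦ G i + G' i) := by
  obtain ⟨C, L, hC, hL, h⟩ := h
  obtain ⟨C', L', hC', hL', h'⟩ := h'
  refine ⟨C + C', L ++ L', by positivity, fun n hn ↦ ?_, fun i ↦ ?_⟩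
  · rcases List.mem_append.1 hn with hn | hn
    exacts [hL n hn, hL' n hn]
  · refine (abs_add_le _ _).trans ((add_le_add (h i) (h' i)).trans ?_)
    rw [List.map_append, List.sum_append]
    have := sum_edgeMono_nonneg L (r i)
    have := sum_edgeMono_nonneg L' (r i)
    nlinarith [mul_nonneg hC (sum_edgeMono_nonneg L' (r i)),
      mul_nonneg hC' (sum_edgeMono_nonneg L (r i))]

lemma MonoDom.const_mul (h : MonoDom r S G) (c : ℝ) : MonoDom r S (fun i ↦ c * G i) := by
  obtain ⟨C, L, hC, hL, h⟩ := h
  refine ⟨|c| * C, L, by positivity, hL, fun i ↦ ?_⟩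
  rw [abs_mul, mul_assoc]
  exact mul_le_mul_of_nonneg_left (h i) (abs_nonneg c)

lemma MonoDom.edge_mul (h : MonoDom r S G) (e : Fin 6)
    (hS : ∀ n ∈ S, n + Pi.single e 1 ∈ S') : MonoDom r S' (fun i ↦ r i e * G i) := by
  obtain ⟨C, L, hC, hL, h⟩ := h
  refine ⟨C, L.map (· + Pi.single e 1), hC, fun n hn ↦ ?_, fun i ↦ ?_⟩
  · obtain ⟨m, hm, rfl⟩ := List.mem_map.1 hn
    exact hS m (hL m hm)
  · rw [abs_mul, List.map_map]
    have : ((fun n ↦ edgeMono n (r i)) ∘ fun n ↦ n + Pi.single e 1) =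
        fun n ↦ |r i e| * edgeMono n (r i) := by
      ext n; exact edgeMono_add_single _ _ _
    rw [this, List.sum_map_mul_left]
    calc |r i e| * |G i| ≤ |r i e| * (C * (L.map fun n ↦ edgeMono n (r i)).sum) :=
          mul_le_mul_of_nonneg_left (h i) (abs_nonneg _)
      _ = _ := by ring

lemma MonoDom.congr (h : MonoDom r S G) (hG : ∀ i, G' i = G i) : MonoDom r S G' := by
  rwa [show G' = G from funext hG]

/-- One term of Wick's recursion: a new edge `e` multiplies a moment of lower degree. The factor `b`
disposes of `b = 0`, so the hypothesis is only needed when `b - 1` is a true predecessor. -/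
lemma MonoDom.nat_edge_mul {F : ℕ → I → ℝ} (b : ℕ) (e : Fin 6)
    (h : ∀ m, b = m + 1 → MonoDom r S (F m) ∧ ∀ n ∈ S, n + Pi.single e 1 ∈ S') :
    MonoDom r S' (fun i ↦ r i e * (b * F (b - 1) i)) := by
  cases b with
  | zero => exact MonoDom.zero.congr fun i ↦ by simp
  | succ m => exact ((h m rfl).1.const_mul _).edge_mul e (h m rfl).2

end EdgeMonomials

/-! ### Multigraph bounds for four-point Hermite moments. -/

section MomentBounds

variable {Ω T : Type*} [MeasurableSpace Ω] {P : Measure Ω}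

/-- The multigraphs on four vertices with prescribed degrees. -/
def degSet (a b c d : ℕ) : Set (Fin 6 → ℕ) :=
  {n | n 0 + n 2 + n 3 = a ∧ n 0 + n 4 + n 5 = b ∧ n 1 + n 2 + n 4 = c ∧ n 1 + n 3 + n 5 = d}

/-- The multigraphs with prescribed degrees and some edge between `{1, 2}` and `{3, 4}`. -/
def crossDegSet (a b c d : ℕ) : Set (Fin 6 → ℕ) :=
  {n | n ∈ degSet a b c d ∧ 1 ≤ n 2 + n 3 + n 4 + n 5}

/-- The six correlations of four random variables. -/
noncomputable def edgeCov (X : T → Ω → ℝ) (P : Measure Ω) (t₁ t₂ t₃ t₄ : T) : Fin 6 → ℝ :=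
  ![cov2 X P t₁ t₂, cov2 X P t₃ t₄, cov2 X P t₁ t₃, cov2 X P t₁ t₄, cov2 X P t₂ t₃, cov2 X P t₂ t₄]

/-- Families of four jointly Gaussian standard normal variables. -/
abbrev GaussQuad (P : Measure Ω) := {X : Fin 4 → Ω → ℝ // StdGaussian X P}

/-- Wick's recursion at the first vertex of positive degree, by induction on the total degree. Its
numerical coefficients depend on the degrees alone, so indexing the domination by all Gaussian
quadruples makes the constants uniform. -/
lemma monoDom_mom4 (a b c d : ℕ) :
    MonoDom (fun X : GaussQuad P ↦ edgeCov X.1 P 0 1 2 3) (degSet a b c d)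
      (fun X ↦ mom4 X.1 P 0 1 2 3 a b c d) := by
  induction hN : a + b + c + d using Nat.strong_induction_on generalizing a b c d with
  | _ N ih =>
  subst hN
  rcases a with _ | a
  · rcases b with _ | b
    · rcases c with _ | c
      · rcases d with _ | d
        · refine ⟨1, [0], zero_le_one, by simp [degSet], fun X ↦ ?_⟩
          have := X.2.isProb
          simp [mom4, edgeMono]
        -- A lone half-edge bundle has nothing to pair with: a Hermite polynomial of positive degree
        -- has mean zero.
        · refine MonoDom.zero.congr fun X ↦ ?_
          simpa [mom4] using X.2.integral_He_succ 3 d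
      · refine (MonoDom.nat_edge_mul (F := fun m X ↦ mom4 X.1 P 0 1 2 3 0 0 c m)
          (S := degSet 0 0 c (d - 1)) d 1 ?_).congr fun X ↦ ?_
        · rintro m rfl
          refine ⟨ih _ (by omega) 0 0 c m rfl, fun n hn ↦ ?_⟩
          simp [degSet] at hn ⊢; omega
        · rw [mom4_swap', X.2.mom4_succ]
          rw [mom4_swap' _ _ _ _ c 0 0 (d - 1)]
          simp [edgeCov]
    · refine ((MonoDom.nat_edge_mul (F := fun m X ↦ mom4 X.1 P 0 1 2 3 0 b m d)
          (S := degSet 0 b (c - 1) d) c 4 ?_).add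
        (MonoDom.nat_edge_mul (F := fun m X ↦ mom4 X.1 P 0 1 2 3 0 b c m)
          (S := degSet 0 b c (d - 1)) d 5 ?_)).congr fun X ↦ ?_
      · rintro m rfl
        refine ⟨ih _ (by omega) 0 b m d rfl, fun n hn ↦ ?_⟩
        simp [degSet] at hn ⊢; omega
      · rintro m rfl
        refine ⟨ih _ (by omega) 0 b c m rfl, fun n hn ↦ ?_⟩
        simp [degSet] at hn ⊢; omega
      · rw [mom4_swap, X.2.mom4_succ]
        rw [mom4_swap _ _ _ _ b 0 (c - 1) d, mom4_swap _ _ _ _ b 0 c (d - 1)]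
        simp [edgeCov]
  · refine (((MonoDom.nat_edge_mul (F := fun m X ↦ mom4 X.1 P 0 1 2 3 a m c d)
          (S := degSet a (b - 1) c d) b 0 ?_).add
        (MonoDom.nat_edge_mul (F := fun m X ↦ mom4 X.1 P 0 1 2 3 a b m d)
          (S := degSet a b (c - 1) d) c 2 ?_)).add
        (MonoDom.nat_edge_mul (F := fun m X ↦ mom4 X.1 P 0 1 2 3 a b c m)
          (S := degSet a b c (d - 1)) d 3 ?_)).congr fun X ↦ ?_
    · rintro m rfl
      refine ⟨ih _ (by omega) a m c d rfl, fun n hn ↦ ?_⟩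
      simp [degSet] at hn ⊢; omega
    · rintro m rfl
      refine ⟨ih _ (by omega) a b m d rfl, fun n hn ↦ ?_⟩
      simp [degSet] at hn ⊢; omega
    · rintro m rfl
      refine ⟨ih _ (by omega) a b c m rfl, fun n hn ↦ ?_⟩
      simp [degSet] at hn ⊢; omega
    · rw [X.2.mom4_succ]
      simp [edgeCov]

/-- The covariance of `He a (X 0) * He b (X 1)` and `He c (X 2) * He d (X 3)` is bounded by
multigraphs having an edge between the two pairs. -/
lemma monoDom_cov_mom4 (a b c d : ℕ) :
    MonoDom (fun X : GaussQuad P ↦ edgeCov X.1 P 0 1 2 3) (crossDegSet a b c d)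
      (fun X ↦ mom4 X.1 P 0 1 2 3 a b c d -
        mom4 X.1 P 0 1 2 3 a b 0 0 * mom4 X.1 P 0 1 2 3 0 0 c d) := by
  induction a generalizing b with
  | zero =>
    rcases b with _ | b
    · refine MonoDom.zero.congr fun X ↦ ?_
      have := X.2.isProb
      simp [mom4]
    -- With vertex 1 exhausted, vertex 2 can only be joined across, so the graphs have a cross edge
    -- at once; the subtracted product is zero because its first factor is a mean of `He (b + 1)`.
    · refine ((MonoDom.nat_edge_mul (F := fun m X ↦ mom4 X.1 P 0 1 2 3 0 b m d)
          (S := degSet 0 b (c - 1) d) c 4 ?_).add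
        (MonoDom.nat_edge_mul (F := fun m X ↦ mom4 X.1 P 0 1 2 3 0 b c m)
          (S := degSet 0 b c (d - 1)) d 5 ?_)).congr fun X ↦ ?_
      · rintro m rfl
        refine ⟨monoDom_mom4 0 b m d, fun n hn ↦ ?_⟩
        simp [crossDegSet, degSet] at hn ⊢; omega
      · rintro m rfl
        refine ⟨monoDom_mom4 0 b c m, fun n hn ↦ ?_⟩
        simp [crossDegSet, degSet] at hn ⊢; omega
      · rw [mom4_swap, X.2.mom4_succ, mom4_swap _ _ _ _ 0 (b + 1), X.2.mom4_succ]
        rw [mom4_swap _ _ _ _ b 0 (c - 1) d, mom4_swap _ _ _ _ b 0 c (d - 1)]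
        simp [edgeCov]
  | succ a ih =>
    -- Pairing 1 with 2 occurs identically in the moment and in the subtracted product, leaving the
    -- same difference at lower degree. Pairing 1 with 3 or 4 creates the cross edge, after which
    -- the plain moment bound suffices.
    refine (((MonoDom.nat_edge_mul (F := fun m X ↦ mom4 X.1 P 0 1 2 3 a m c d -
        mom4 X.1 P 0 1 2 3 a m 0 0 * mom4 X.1 P 0 1 2 3 0 0 c d)
          (S := crossDegSet a (b - 1) c d) b 0 ?_).add
        (MonoDom.nat_edge_mul (F := fun m X ↦ mom4 X.1 P 0 1 2 3 a b m d)
          (S := degSet a b (c - 1) d) c 2 ?_)).add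
        (MonoDom.nat_edge_mul (F := fun m X ↦ mom4 X.1 P 0 1 2 3 a b c m)
          (S := degSet a b c (d - 1)) d 3 ?_)).congr fun X ↦ ?_
    · rintro m rfl
      refine ⟨ih m, fun n hn ↦ ?_⟩
      simp [crossDegSet, degSet] at hn ⊢; omega
    · rintro m rfl
      refine ⟨monoDom_mom4 a b m d, fun n hn ↦ ?_⟩
      simp [crossDegSet, degSet] at hn ⊢; omega
    · rintro m rfl
      refine ⟨monoDom_mom4 a b c m, fun n hn ↦ ?_⟩
      simp [crossDegSet, degSet] at hn ⊢; omega
    · rw [X.2.mom4_succ, X.2.mom4_succ]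
      simp [edgeCov]
      ring

/-- The same bound for any four points of a Gaussian process, with uniform constants. -/
lemma exists_cov_mom4_bound (P : Measure Ω) (a b c d : ℕ) :
    ∃ (C : ℝ) (L : List (Fin 6 → ℕ)), 0 ≤ C ∧ (∀ n ∈ L, n ∈ crossDegSet a b c d) ∧
      ∀ (X : T → Ω → ℝ), StdGaussian X P → ∀ t₁ t₂ t₃ t₄,
        |mom4 X P t₁ t₂ t₃ t₄ a b c d -
          mom4 X P t₁ t₂ t₃ t₄ a b 0 0 * mom4 X P t₁ t₂ t₃ t₄ 0 0 c d| ≤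
        C * (L.map fun n ↦ edgeMono n (edgeCov X P t₁ t₂ t₃ t₄)).sum := by
  obtain ⟨C, L, hC, hL, h⟩ := monoDom_cov_mom4 (P := P) a b c d
  refine ⟨C, L, hC, hL, fun X hX t₁ t₂ t₃ t₄ ↦ ?_⟩
  exact h ⟨_, hX.comp ![t₁, t₂, t₃, t₄]⟩

end MomentBounds

/-! ### Inner products and convergence in L², in terms of integrals. -/

section LTwo

variable {α : Type*} [MeasurableSpace α] {μ : Measure α} {u v : α → ℝ}

lemma inner_toLp_eq (hu : MemLp u 2 μ) (hv : MemLp v 2 μ) :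
    inner ℝ (hu.toLp u) (hv.toLp v) = ∫ x, u x * v x ∂μ := by
  rw [L2.inner_def]
  refine integral_congr_ae ?_
  filter_upwards [hu.coeFn_toLp, hv.coeFn_toLp] with x h1 h2
  rw [h1, h2]
  simp [mul_comm]

lemma norm_toLp_sq (hu : MemLp u 2 μ) : ‖hu.toLp u‖ ^ 2 = ∫ x, u x ^ 2 ∂μ := by
  rw [← real_inner_self_eq_norm_sq, inner_toLp_eq]
  simp [pow_two]

lemma norm_toLp_eq_sqrt (hu : MemLp u 2 μ) : ‖hu.toLp u‖ = √(∫ x, u x ^ 2 ∂μ) := by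
  rw [← norm_toLp_sq, Real.sqrt_sq (norm_nonneg _)]

lemma abs_integral_mul_le (hu : MemLp u 2 μ) (hv : MemLp v 2 μ) :
    |∫ x, u x * v x ∂μ| ≤ √(∫ x, u x ^ 2 ∂μ) * √(∫ x, v x ^ 2 ∂μ) := by
  rw [← inner_toLp_eq hu hv, ← norm_toLp_eq_sqrt hu, ← norm_toLp_eq_sqrt hv]
  exact abs_real_inner_le_norm _ _

lemma integral_abs_le_sqrt [IsProbabilityMeasure μ] (hu : MemLp u 2 μ) :
    ∫ x, |u x| ∂μ ≤ √(∫ x, u x ^ 2 ∂μ) := by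
  have := abs_integral_mul_le hu.abs (memLp_const (μ := μ) (p := 2) (1 : ℝ))
  simpa using (le_abs_self _).trans this

lemma tendsto_toLp {ι : Type*} {l : Filter ι} {w : ι → α → ℝ} (hw : ∀ i, MemLp (w i) 2 μ)
    (hu : MemLp u 2 μ) (h : Tendsto (fun i ↦ ∫ x, (w i x - u x) ^ 2 ∂μ) l (𝓝 0)) :
    Tendsto (fun i ↦ (hw i).toLp (w i)) l (𝓝 (hu.toLp u)) := by
  rw [tendsto_iff_norm_sub_tendsto_zero]
  have : ∀ i, ‖(hw i).toLp (w i) - hu.toLp u‖ = √(∫ x, (w i x - u x) ^ 2 ∂μ) := fun i ↦ by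
    rw [← MemLp.toLp_sub, norm_toLp_eq_sqrt]
    simp
  simp_rw [this]
  simpa using h.sqrt

lemma tendsto_integral_mul {ι : Type*} {l : Filter ι} {w z : ι → α → ℝ}
    (hw : ∀ i, MemLp (w i) 2 μ) (hz : ∀ i, MemLp (z i) 2 μ)
    (hu : MemLp u 2 μ) (hv : MemLp v 2 μ)
    (h : Tendsto (fun i ↦ ∫ x, (w i x - u x) ^ 2 ∂μ) l (𝓝 0))
    (h' : Tendsto (fun i ↦ ∫ x, (z i x - v x) ^ 2 ∂μ) l (𝓝 0)) :
    Tendsto (fun i ↦ ∫ x, w i x * z i x ∂μ) l (𝓝 (∫ x, u x * v x ∂μ)) := by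
  have := (tendsto_toLp hw hu h).inner (𝕜 := ℝ) (tendsto_toLp hz hv h')
  simpa only [inner_toLp_eq] using this

end LTwo

/-! ### Completeness of the Hermite polynomials in Gaussian L². -/

section Completeness

/-- Cauchy-Schwarz against the exponential moments of the Gaussian; this is the dominating function
for the power series of the Fourier kernel. -/
lemma integrable_mul_exp_abs {g : ℝ → ℝ} (hg : MemLp g 2 (gaussianReal 0 1)) (t : ℝ) :
    Integrable (fun x ↦ |g x| * Real.exp (|t| * |x|)) (gaussianReal 0 1) := by
  have h2 : MemLp (fun x : ℝ ↦ Real.exp (|t| * |x|)) 2 (gaussianReal 0 1) := by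
    rw [memLp_two_iff_integrable_sq (by fun_prop)]
    refine Integrable.mono' ((integrable_exp_mul_gaussianReal (μ := 0) (v := 1) (2 * |t|)).add
      (integrable_exp_mul_gaussianReal (μ := 0) (v := 1) (-(2 * |t|)))) (by fun_prop) ?_
    refine Eventually.of_forall fun x ↦ ?_
    rw [Real.norm_of_nonneg (by positivity), ← Real.exp_nat_mul]
    simp only [Pi.add_apply]
    rcases abs_cases x with ⟨h, -⟩ | ⟨h, -⟩ <;> rw [h]
    · have := Real.exp_pos (-(2 * |t|) * x)
      have : Real.exp (((2 : ℕ) : ℝ) * (|t| * x)) = Real.exp (2 * |t| * x) := by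
        congr 1; push_cast; ring
      linarith
    · have := Real.exp_pos ((2 * |t|) * x)
      have : Real.exp (((2 : ℕ) : ℝ) * (|t| * -x)) = Real.exp (-(2 * |t|) * x) := by
        congr 1; push_cast; ring
      linarith
  exact hg.abs.integrable_mul h2

/-- Expand the exponential and integrate term by term: each term is a multiple of a vanishing
moment. -/
lemma integral_mul_cexp_eq_zero {g : ℝ → ℝ} (hg : MemLp g 2 (gaussianReal 0 1))
    (h : ∀ n : ℕ, ∫ x, g x * x ^ n ∂gaussianReal 0 1 = 0) (t : ℝ) :
    ∫ x, (g x : ℂ) * Complex.exp (t * x * Complex.I) ∂gaussianReal 0 1 = 0 := by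
  have hs : ∀ x : ℝ, HasSum (fun n : ℕ ↦ |g x| * ((|t| * |x|) ^ n / n.factorial))
      (|g x| * Real.exp (|t| * |x|)) := fun x ↦ by
    rw [Real.exp_eq_exp_ℝ]
    exact (NormedSpace.expSeries_div_hasSum_exp (|t| * |x|)).mul_left _
  have hgm := hg.aestronglyMeasurable
  have := hasSum_integral_of_dominated_convergence (μ := gaussianReal 0 1)
    (F := fun (n : ℕ) (x : ℝ) ↦ (g x : ℂ) * ((t * x * Complex.I) ^ n / n.factorial))
    (f := fun x : ℝ ↦ (g x : ℂ) * Complex.exp (t * x * Complex.I))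
    (fun n x ↦ |g x| * ((|t| * |x|) ^ n / n.factorial))
    (fun n ↦ (Complex.continuous_ofReal.comp_aestronglyMeasurable hgm).mul
      (by fun_prop))
    (fun n ↦ Eventually.of_forall fun x ↦ by simp)
    (Eventually.of_forall fun x ↦ (hs x).summable)
    (by simpa only [(hs _).tsum_eq] using integrable_mul_exp_abs hg t)
    (Eventually.of_forall fun x ↦ by
      rw [Complex.exp_eq_exp_ℂ]
      exact (NormedSpace.expSeries_div_hasSum_exp (t * x * Complex.I)).mul_left _)
  have h0 : ∀ n : ℕ, ∫ x : ℝ, (g x : ℂ) * ((t * x * Complex.I) ^ n / n.factorial)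
      ∂gaussianReal 0 1 = 0 := fun n ↦ by
    have : ∀ x : ℝ, (g x : ℂ) * ((t * x * Complex.I) ^ n / n.factorial) =
        ((t * Complex.I) ^ n / n.factorial) * ((g x * x ^ n : ℝ) : ℂ) := fun x ↦ by
      push_cast; ring
    simp_rw [this]
    rw [integral_const_mul, integral_complex_ofReal, h]
    simp
  simp_rw [h0] at this
  exact this.unique hasSum_zero

/-- A square integrable function orthogonal to all monomials vanishes. -/
lemma ae_eq_zero_of_integral_mul_pow {g : ℝ → ℝ} (hg : MemLp g 2 (gaussianReal 0 1))
    (h : ∀ n : ℕ, ∫ x, g x * x ^ n ∂gaussianReal 0 1 = 0) :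
    g =ᵐ[gaussianReal 0 1] 0 := by
  have hgi : Integrable g (gaussianReal 0 1) := hg.integrable (by norm_num)
  have hm := hg.aestronglyMeasurable.aemeasurable
  have hfin : ∀ w : ℝ → ℝ, Integrable w (gaussianReal 0 1) →
      IsFiniteMeasure ((gaussianReal 0 1).withDensity fun x ↦ ENNReal.ofReal (w x)) := fun w hw ↦
    isFiniteMeasure_withDensity_ofReal hw.2
  have := hfin _ hgi
  have := hfin _ hgi.neg
  have hchar : ∀ w : ℝ → ℝ, Integrable w (gaussianReal 0 1) → ∀ t : ℝ,
      charFun ((gaussianReal 0 1).withDensity fun x ↦ ENNReal.ofReal (w x)) t =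
        ∫ x : ℝ, ((max (w x) 0 : ℝ) : ℂ) * Complex.exp (t * x * Complex.I) ∂gaussianReal 0 1 := by
    intro w hw t
    rw [charFun_apply_real, integral_withDensity_eq_integral_toReal_smul₀
      hw.aestronglyMeasurable.aemeasurable.ennreal_ofReal (by simp)]
    simp [ENNReal.toReal_ofReal', Complex.real_smul]
  have hint : ∀ w : ℝ → ℝ, Integrable w (gaussianReal 0 1) → ∀ t : ℝ,
      Integrable (fun x : ℝ ↦ ((max (w x) 0 : ℝ) : ℂ) * Complex.exp (t * x * Complex.I))
        (gaussianReal 0 1) := by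
    intro w hw t
    refine hw.pos_part.ofReal.mul_bdd (c := 1) (by fun_prop) (Eventually.of_forall fun x ↦ ?_)
    rw [← Complex.ofReal_mul, Complex.norm_exp_ofReal_mul_I]
  -- The positive and negative parts of `g` are densities of finite measures whose characteristic
  -- functions differ by the transform just shown to vanish; equal measures force equal densities.
  have heq : (gaussianReal 0 1).withDensity (fun x ↦ ENNReal.ofReal (g x)) =
      (gaussianReal 0 1).withDensity (fun x ↦ ENNReal.ofReal (-g x)) := by
    refine Measure.ext_of_charFun (funext fun t ↦ ?_)
    rw [hchar g hgi, hchar (fun x ↦ -g x) hgi.neg, ← sub_eq_zero,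
      ← integral_sub (hint g hgi t) (hint (fun x ↦ -g x) hgi.neg t),
      ← integral_mul_cexp_eq_zero hg h t]
    congr 1; ext x
    rw [← sub_mul, ← Complex.ofReal_sub]
    congr 2
    rcases le_total 0 (g x) with h0 | h0 <;> simp [h0]
  filter_upwards [(withDensity_eq_iff_of_sigmaFinite hm.ennreal_ofReal
    hm.neg.ennreal_ofReal).1 heq] with x hx
  have := congrArg ENNReal.toReal hx
  simp only [ENNReal.toReal_ofReal', Pi.zero_apply, Pi.neg_apply] at this ⊢
  rcases le_total 0 (g x) with h0 | h0
  · simpa [h0] using this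
  · simpa [h0] using this.symm

/-- A process with a single time, through which facts about `StdGaussian` specialize to the Gaussian
measure on the line. -/
lemma stdGaussian_id : StdGaussian (fun (_ : Unit) (x : ℝ) ↦ x) (gaussianReal 0 1) where
  gauss := by
    constructor
    intro I
    have h := (IsGaussian.hasGaussianLaw_id (μ := gaussianReal 0 1)).map
      (ContinuousLinearMap.pi fun _ : I ↦ ContinuousLinearMap.id ℝ ℝ)
    exact h
  meas _ := measurable_id
  mean _ := by simp
  sq _ := by
    have h := variance_id_gaussianReal (μ := 0) (v := 1)
    rw [variance_eq_sub (IsGaussian.memLp_id _ 2 (by simp))] at h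
    simpa using h

lemma integral_He_mul_He_gaussianReal (m n : ℕ) :
    ∫ x, He m x * He n x ∂gaussianReal 0 1 = if m = n then (m.factorial : ℝ) else 0 := by
  have := stdGaussian_id.integral_He_mul_He () () m n
  rw [stdGaussian_id.cov2_self] at this
  simpa using this

lemma allMoments_He_gaussianReal (n : ℕ) : AllMoments (He n) (gaussianReal 0 1) :=
  allMoments_id_gaussianReal.He n

/-- The Hermite coefficients of a function on the line. -/
noncomputable def hCoef (f : ℝ → ℝ) (n : ℕ) : ℝ :=
  (∫ x, f x * He n x ∂gaussianReal 0 1) / n.factorial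

/-- The partial sums of the Hermite expansion. -/
noncomputable def hSum (f : ℝ → ℝ) (N : ℕ) (x : ℝ) : ℝ :=
  ∑ n ∈ Finset.range N, hCoef f n * He n x

lemma allMoments_hSum (f : ℝ → ℝ) (N : ℕ) : AllMoments (hSum f N) (gaussianReal 0 1) :=
  AllMoments.sum _ fun n _ ↦ (allMoments_He_gaussianReal n).const_mul _

lemma span_hermiteR : Submodule.span ℝ (Set.range hermiteR) = ⊤ := by
  let S : Polynomial.Sequence ℝ := ⟨hermiteR, degree_hermiteR⟩
  exact S.span fun i ↦ isUnit_iff_ne_zero.2 (Polynomial.leadingCoeff_ne_zero.2 (S.ne_zero i))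

lemma ae_eq_zero_of_integral_mul_He {g : ℝ → ℝ} (hg : MemLp g 2 (gaussianReal 0 1))
    (h : ∀ n : ℕ, ∫ x, g x * He n x ∂gaussianReal 0 1 = 0) :
    g =ᵐ[gaussianReal 0 1] 0 := by
  have hint : ∀ p : Polynomial ℝ, Integrable (fun x ↦ g x * p.eval x) (gaussianReal 0 1) :=
    fun p ↦ hg.integrable_mul (allMoments_id_gaussianReal.polynomial p).memLp_two
  have hall : ∀ p : Polynomial ℝ, ∫ x, g x * p.eval x ∂gaussianReal 0 1 = 0 := by
    intro p
    have hp : p ∈ Submodule.span ℝ (Set.range hermiteR) := span_hermiteR ▸ Submodule.mem_top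
    induction hp using Submodule.span_induction with
    | mem p hp => obtain ⟨n, rfl⟩ := hp; exact h n
    | zero => simp
    | add p q _ _ hp hq =>
      simp only [Polynomial.eval_add, mul_add]
      rw [integral_add (hint p) (hint q), hp, hq, add_zero]
    | smul c p _ hp =>
      simp only [Polynomial.eval_smul, smul_eq_mul, mul_left_comm _ c]
      rw [integral_const_mul, hp, mul_zero]
  refine ae_eq_zero_of_integral_mul_pow hg fun n ↦ ?_
  simpa using hall (Polynomial.X ^ n)

/-- The Hermite expansion of a square integrable function converges in mean square. -/
theorem tendsto_hSum {f : ℝ → ℝ} (hf : MemLp f 2 (gaussianReal 0 1)) :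
    Tendsto (fun N ↦ ∫ x, (hSum f N x - f x) ^ 2 ∂gaussianReal 0 1) atTop (𝓝 0) := by
  have hm : ∀ n, MemLp (fun x ↦ (√(n.factorial : ℝ))⁻¹ * He n x) 2 (gaussianReal 0 1) := fun n ↦
    ((allMoments_He_gaussianReal n).const_mul _).memLp_two
  have hfac : ∀ n : ℕ, (0 : ℝ) < n.factorial := fun n ↦ by positivity
  have hv : Orthonormal ℝ (fun n ↦ (hm n).toLp _) := by
    rw [orthonormal_iff_ite]
    intro m n
    rw [inner_toLp_eq]
    have : ∀ x, (√(m.factorial : ℝ))⁻¹ * He m x * ((√(n.factorial : ℝ))⁻¹ * He n x) =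
        ((√(m.factorial : ℝ))⁻¹ * (√(n.factorial : ℝ))⁻¹) * (He m x * He n x) := fun x ↦ by ring
    simp_rw [this]
    rw [integral_const_mul, integral_He_mul_He_gaussianReal]
    split_ifs with hmn
    · subst hmn
      rw [← mul_inv, Real.mul_self_sqrt (hfac m).le, inv_mul_cancel₀ (hfac m).ne']
    · simp
  -- Completeness of the normalized system: anything orthogonal to it is orthogonal to every `He n`,
  -- hence zero.
  have hbot : (Submodule.span ℝ (Set.range fun n ↦ (hm n).toLp _))ᗮ = ⊥ := by
    rw [Submodule.eq_bot_iff]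
    intro g hg
    have hg' : ∀ n, ∫ x, g x * He n x ∂gaussianReal 0 1 = 0 := by
      intro n
      have h1 := (Submodule.mem_orthogonal _ _).1 hg _ (Submodule.subset_span ⟨n, rfl⟩)
      have h2 : inner ℝ ((hm n).toLp _) ((Lp.memLp g).toLp g) = 0 := by
        rw [Lp.toLp_coeFn]; exact h1
      rw [inner_toLp_eq] at h2
      simp_rw [mul_assoc] at h2
      rw [integral_const_mul] at h2
      have := (mul_eq_zero.1 h2).resolve_left (by positivity)
      simpa [mul_comm] using this
    have := ae_eq_zero_of_integral_mul_He (Lp.memLp g) hg'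
    exact (Lp.eq_zero_iff_ae_eq_zero).2 this
  let b := HilbertBasis.mkOfOrthogonalEqBot hv hbot
  have hb : ∀ n, b n = (hm n).toLp _ := fun n ↦ by
    simp only [b, HilbertBasis.coe_mkOfOrthogonalEqBot]
  have hsum := (b.hasSum_repr (hf.toLp f)).tendsto_sum_nat
  have hpart : ∀ N, ∑ i ∈ Finset.range N, b.repr (hf.toLp f) i • b i =
      ((allMoments_hSum f N).memLp_two).toLp (hSum f N) := by
    intro N
    have hterm : ∀ n, b.repr (hf.toLp f) n • b n =
        ((((allMoments_He_gaussianReal n).const_mul (hCoef f n)).memLp_two).toLp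
          (fun x ↦ hCoef f n * He n x)) := by
      intro n
      rw [b.repr_apply_apply, hb, inner_toLp_eq, ← MemLp.toLp_const_smul]
      refine MemLp.toLp_congr _ _ (Eventually.of_forall fun x ↦ ?_)
      simp only [Pi.smul_apply, smul_eq_mul, mul_assoc]
      rw [integral_const_mul, ← mul_assoc]
      congr 1
      rw [hCoef, mul_right_comm, ← mul_inv, Real.mul_self_sqrt (hfac n).le]
      simp_rw [mul_comm (He n _)]
      rw [div_eq_mul_inv, mul_comm]
    simp_rw [hterm]
    refine Lp.ext ?_
    refine (Lp.coeFn_finsetSum _ _).trans ?_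
    refine EventuallyEq.trans ?_ (MemLp.coeFn_toLp _).symm
    have : ∀ᵐ x ∂gaussianReal 0 1, ∀ n, (((((allMoments_He_gaussianReal n).const_mul
        (hCoef f n)).memLp_two).toLp (fun x ↦ hCoef f n * He n x)) : ℝ → ℝ) x =
          hCoef f n * He n x := ae_all_iff.2 fun n ↦ MemLp.coeFn_toLp _
    filter_upwards [this] with x hx
    simp [hSum, hx]
  simp_rw [hpart] at hsum
  rw [tendsto_iff_norm_sub_tendsto_zero] at hsum
  have h2 := hsum.pow 2
  simp only [← MemLp.toLp_sub, norm_toLp_sq] at h2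
  simpa using h2

end Completeness

/-! ### Hermite coefficients: truncation, parity and nonconstancy. -/

section Coefficients

variable {f : ℝ → ℝ}

lemma integral_mul_He_eq (f : ℝ → ℝ) (n : ℕ) :
    ∫ x, f x * He n x ∂gaussianReal 0 1 = n.factorial * hCoef f n := by
  rw [hCoef, mul_div_cancel₀ _ (by positivity)]

lemma hCoef_hSum (f : ℝ → ℝ) (N n : ℕ) :
    hCoef (hSum f N) n = if n < N then hCoef f n else 0 := by
  have hi : ∀ m ∈ Finset.range N, Integrable (fun x ↦ hCoef f m * He m x * He n x)
      (gaussianReal 0 1) := fun m _ ↦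
    (((allMoments_He_gaussianReal m).const_mul _).mul (allMoments_He_gaussianReal n)).integrable
  rw [hCoef]
  simp only [hSum, Finset.sum_mul]
  rw [integral_finsetSum _ hi]
  simp only [mul_assoc, integral_const_mul, integral_He_mul_He_gaussianReal, mul_ite, mul_zero]
  rw [Finset.sum_ite_eq' ]
  simp only [Finset.mem_range]
  split_ifs
  · rw [mul_div_cancel_right₀ _ (by positivity)]
  · simp

lemma hCoef_sub {g : ℝ → ℝ} (hf : MemLp f 2 (gaussianReal 0 1)) (hg : MemLp g 2 (gaussianReal 0 1))
    (n : ℕ) : hCoef (fun x ↦ f x - g x) n = hCoef f n - hCoef g n := by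
  simp only [hCoef, sub_mul]
  have h1 : Integrable (fun x ↦ f x * He n x) (gaussianReal 0 1) :=
    hf.integrable_mul (allMoments_He_gaussianReal n).memLp_two
  have h2 : Integrable (fun x ↦ g x * He n x) (gaussianReal 0 1) :=
    hg.integrable_mul (allMoments_He_gaussianReal n).memLp_two
  rw [integral_sub h1 h2, sub_div]

lemma hCoef_sub_hSum (hf : MemLp f 2 (gaussianReal 0 1)) (N n : ℕ) :
    hCoef (fun x ↦ f x - hSum f N x) n = if n < N then 0 else hCoef f n := by
  rw [hCoef_sub hf (allMoments_hSum f N).memLp_two, hCoef_hSum]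
  split_ifs <;> simp

lemma He_neg (n : ℕ) (x : ℝ) : He n (-x) = (-1) ^ n * He n x := by
  have hcomp : (hermiteR n).comp (-Polynomial.X) = Polynomial.C ((-1) ^ n) * hermiteR n := by
    induction n with
    | zero => simp
    | succ n ih =>
      have hd := congrArg Polynomial.derivative ih
      rw [Polynomial.derivative_comp, Polynomial.derivative_C_mul] at hd
      simp only [Polynomial.derivative_neg, Polynomial.derivative_X, neg_one_mul] at hd
      rw [hermiteR_succ, Polynomial.sub_comp, Polynomial.mul_comp, ih, Polynomial.X_comp,
        ← neg_neg ((Polynomial.derivative (hermiteR n)).comp (-Polynomial.X)), hd]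
      simp only [pow_succ, map_mul, map_neg, map_one]
      ring
  have := congrArg (Polynomial.eval x) hcomp
  simpa [He, Polynomial.eval_comp] using this

/-- The Gaussian measure is invariant under reflection while `He n` changes sign. This is where the
symmetry of `f` enters; without odd degrees all terms of the variance series are nonnegative. -/
lemma hCoef_eq_zero_of_odd (hsymm : ∀ᵐ x ∂gaussianReal 0 1, f (-x) = f x) {n : ℕ} (hn : Odd n) :
    hCoef f n = 0 := by
  have hneg : MeasurePreserving (fun x : ℝ ↦ -x) (gaussianReal 0 1) (gaussianReal 0 1) :=
    ⟨measurable_neg, by rw [gaussianReal_map_neg]; simp⟩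
  have h1 : ∫ x, f x * He n x ∂gaussianReal 0 1 = ∫ x, f (-x) * He n (-x) ∂gaussianReal 0 1 :=
    (hneg.integral_comp (MeasurableEquiv.neg ℝ).measurableEmbedding
      (fun x ↦ f x * He n x)).symm
  have h2 : ∫ x, f (-x) * He n (-x) ∂gaussianReal 0 1 = -∫ x, f x * He n x ∂gaussianReal 0 1 := by
    rw [← integral_neg]
    refine integral_congr_ae ?_
    filter_upwards [hsymm] with x hx
    rw [hx, He_neg, hn.neg_one_pow]; ring
  rw [hCoef, show ∫ x, f x * He n x ∂gaussianReal 0 1 = 0 by linarith, zero_div]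

lemma hCoef_zero (f : ℝ → ℝ) : hCoef f 0 = ∫ x, f x ∂gaussianReal 0 1 := by simp [hCoef]

/-- Were all coefficients of positive degree zero, `f - hCoef f 0` would be orthogonal to every
Hermite polynomial. -/
lemma exists_hCoef_ne_zero (hf : MemLp f 2 (gaussianReal 0 1))
    (hnc : ¬ ∃ c : ℝ, ∀ᵐ x ∂gaussianReal 0 1, f x = c) : ∃ n, 1 ≤ n ∧ hCoef f n ≠ 0 := by
  by_contra! h
  refine hnc ⟨hCoef f 0, ?_⟩
  have h1 : ∀ n, ∫ x, (f x - hSum f 1 x) * He n x ∂gaussianReal 0 1 = 0 := fun n ↦ by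
    rw [integral_mul_He_eq (fun x ↦ f x - hSum f 1 x), hCoef_sub_hSum hf]
    split_ifs with hn
    · simp
    · rw [h n (by omega), mul_zero]
  filter_upwards [ae_eq_zero_of_integral_mul_He
    (hf.sub (allMoments_hSum f 1).memLp_two) h1] with x hx
  simp [hSum] at hx
  linarith

end Coefficients

/-! ### Covariance of f at two correlated Gaussian variables. -/

section Correlated

variable {Ω T : Type*} [MeasurableSpace Ω] {P : Measure Ω} {X : T → Ω → ℝ} {f : ℝ → ℝ}

namespace StdGaussian

lemma measurePreserving (hX : StdGaussian X P) (t : T) :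
    MeasurePreserving (X t) P (gaussianReal 0 1) := ⟨hX.meas t, hX.map_eq t⟩

lemma memLp_comp (hX : StdGaussian X P) (hf : MemLp f 2 (gaussianReal 0 1)) (t : T) :
    MemLp (fun ω ↦ f (X t ω)) 2 P := hf.comp_measurePreserving (hX.measurePreserving t)

lemma integral_comp_eq (hX : StdGaussian X P) {g : ℝ → ℝ}
    (hg : AEStronglyMeasurable g (gaussianReal 0 1)) (t : T) :
    ∫ ω, g (X t ω) ∂P = ∫ x, g x ∂gaussianReal 0 1 := by
  rw [← hX.map_eq t] at hg ⊢
  rw [integral_map (hX.meas t).aemeasurable hg]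

lemma integral_hSum_mul_hSum (hX : StdGaussian X P) (f : ℝ → ℝ) (s t : T) (N : ℕ) :
    ∫ ω, hSum f N (X s ω) * hSum f N (X t ω) ∂P =
      ∑ n ∈ Finset.range N, hCoef f n ^ 2 * n.factorial * cov2 X P s t ^ n := by
  have := hX.isProb
  have hm : ∀ m n, Integrable (fun ω ↦ hCoef f m * GaussModulus.He m (X s ω) *
      (hCoef f n * GaussModulus.He n (X t ω))) P := fun m n ↦
    ((((hX.allMoments s).He m).const_mul _).mul (((hX.allMoments t).He n).const_mul _)).integrable
  simp only [hSum, Finset.sum_mul_sum]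
  rw [integral_finsetSum _ fun m _ ↦ integrable_finsetSum _ fun n _ ↦ hm m n]
  refine Finset.sum_congr rfl fun m hmN ↦ ?_
  rw [integral_finsetSum _ fun n _ ↦ hm m n]
  have : ∀ n, ∫ ω, hCoef f m * GaussModulus.He m (X s ω) *
      (hCoef f n * GaussModulus.He n (X t ω)) ∂P =
      if m = n then hCoef f m ^ 2 * m.factorial * cov2 X P s t ^ m else 0 := fun n ↦ by
    have : ∀ ω, hCoef f m * GaussModulus.He m (X s ω) * (hCoef f n * GaussModulus.He n (X t ω)) =
      (hCoef f m * hCoef f n) * (GaussModulus.He m (X s ω) * GaussModulus.He n (X t ω)) :=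
      fun ω ↦ by ring
    simp_rw [this]
    rw [integral_const_mul, hX.integral_He_mul_He]
    split_ifs with h
    · subst h; ring
    · simp
  simp_rw [this]
  rw [Finset.sum_ite_eq, if_pos hmN]

lemma tendsto_integral_hSum_sub (hX : StdGaussian X P) (hf : MemLp f 2 (gaussianReal 0 1)) (t : T) :
    Tendsto (fun N ↦ ∫ ω, (hSum f N (X t ω) - f (X t ω)) ^ 2 ∂P) atTop (𝓝 0) := by
  refine (tendsto_hSum hf).congr fun N ↦ ?_
  exact (hX.integral_comp_eq (g := fun x ↦ (hSum f N x - f x) ^ 2)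
    (((allMoments_hSum f N).memLp_two.aestronglyMeasurable.sub hf.aestronglyMeasurable).pow 2)
    t).symm

lemma tendsto_sum_hCoef (hX : StdGaussian X P) (hf : MemLp f 2 (gaussianReal 0 1)) (s t : T) :
    Tendsto (fun N ↦ ∑ n ∈ Finset.range N, hCoef f n ^ 2 * n.factorial * cov2 X P s t ^ n) atTop
      (𝓝 (∫ ω, f (X s ω) * f (X t ω) ∂P)) := by
  simp_rw [← hX.integral_hSum_mul_hSum]
  exact tendsto_integral_mul (fun N ↦ hX.memLp_comp (allMoments_hSum f N).memLp_two s)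
    (fun N ↦ hX.memLp_comp (allMoments_hSum f N).memLp_two t) (hX.memLp_comp hf s)
    (hX.memLp_comp hf t) (hX.tendsto_integral_hSum_sub hf s) (hX.tendsto_integral_hSum_sub hf t)

end StdGaussian

/-- Parseval's identity for the Hermite expansion. -/
lemma hasSum_sq_hCoef (hf : MemLp f 2 (gaussianReal 0 1)) :
    HasSum (fun n ↦ hCoef f n ^ 2 * n.factorial) (∫ x, f x ^ 2 ∂gaussianReal 0 1) := by
  rw [hasSum_iff_tendsto_nat_of_nonneg fun n ↦ by positivity]
  have := stdGaussian_id.tendsto_sum_hCoef hf () ()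
  simpa [stdGaussian_id.cov2_self, ← pow_two] using this

/-- Parseval and `|cov2| ≤ 1` give absolute convergence, and the sum is identified by the L²
convergence of the truncated expansions at both points. -/
lemma StdGaussian.hasSum_integral_mul (hX : StdGaussian X P) (hf : MemLp f 2 (gaussianReal 0 1))
    (s t : T) :
    HasSum (fun n ↦ hCoef f n ^ 2 * n.factorial * cov2 X P s t ^ n)
      (∫ ω, f (X s ω) * f (X t ω) ∂P) := by
  have hs : Summable fun n ↦ hCoef f n ^ 2 * n.factorial * cov2 X P s t ^ n := by
    refine Summable.of_norm_bounded (hasSum_sq_hCoef hf).summable fun n ↦ ?_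
    rw [Real.norm_eq_abs, abs_mul, abs_pow, abs_of_nonneg (by positivity : 0 ≤ hCoef f n ^ 2 *
      (n.factorial : ℝ))]
    exact mul_le_of_le_one_right (by positivity)
      (pow_le_one₀ (abs_nonneg _) (hX.abs_cov2_le s t))
  have h1 := hs.hasSum.tendsto_sum_nat
  rw [← tendsto_nhds_unique h1 (hX.tendsto_sum_hCoef hf s t)]
  exact hs.hasSum

end Correlated

/-! ### Second moments of integrals of random fields. -/

section Functionals

variable {Ω I : Type*} [MeasurableSpace Ω] [MeasurableSpace I] {P : Measure Ω}
  [IsProbabilityMeasure P] {ν : Measure I} [IsFiniteMeasure ν] {Y Z : I → Ω → ℝ}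

lemma ae_integrable_of_memLp_prod (hY : MemLp (fun p : Ω × I ↦ Y p.2 p.1) 2 (P.prod ν)) :
    ∀ᵐ ω ∂P, Integrable (fun x ↦ Y x ω) ν :=
  (hY.integrable (by norm_num)).prod_right_ae

lemma sq_integral_le {g : I → ℝ} (hg : Integrable g ν) (hg2 : Integrable (fun x ↦ g x ^ 2) ν) :
    (∫ x, g x ∂ν) ^ 2 ≤ ν.real Set.univ * ∫ x, g x ^ 2 ∂ν := by
  have h := abs_integral_mul_le ((memLp_two_iff_integrable_sq hg.aestronglyMeasurable).2 hg2)
    (memLp_const (μ := ν) (p := 2) (1 : ℝ))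
  simp only [mul_one, one_pow, integral_const, smul_eq_mul] at h
  have h2 := pow_le_pow_left₀ (abs_nonneg _) h 2
  rw [sq_abs, mul_pow, Real.sq_sqrt (integral_nonneg fun x ↦ sq_nonneg _),
    Real.sq_sqrt measureReal_nonneg, mul_comm] at h2
  exact h2

lemma ae_sq_integral_le (hY : MemLp (fun p : Ω × I ↦ Y p.2 p.1) 2 (P.prod ν)) :
    ∀ᵐ ω ∂P, (∫ x, Y x ω ∂ν) ^ 2 ≤ ν.real Set.univ * ∫ x, Y x ω ^ 2 ∂ν := by
  filter_upwards [ae_integrable_of_memLp_prod hY, hY.integrable_sq.prod_right_ae] with ω h1 h2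
  exact sq_integral_le h1 h2

lemma memLp_integral (hY : MemLp (fun p : Ω × I ↦ Y p.2 p.1) 2 (P.prod ν)) :
    MemLp (fun ω ↦ ∫ x, Y x ω ∂ν) 2 P := by
  have hm : AEStronglyMeasurable (fun ω ↦ ∫ x, Y x ω ∂ν) P :=
    hY.aestronglyMeasurable.integral_prod_right'
  rw [memLp_two_iff_integrable_sq hm]
  refine Integrable.mono' (hY.integrable_sq.integral_prod_left.const_mul (ν.real Set.univ))
    (hm.pow 2) ?_
  filter_upwards [ae_sq_integral_le hY] with ω h
  rwa [Real.norm_of_nonneg (sq_nonneg _)]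

lemma integral_sq_integral_le (hY : MemLp (fun p : Ω × I ↦ Y p.2 p.1) 2 (P.prod ν)) :
    ∫ ω, (∫ x, Y x ω ∂ν) ^ 2 ∂P ≤ ν.real Set.univ * ∫ x, ∫ ω, Y x ω ^ 2 ∂P ∂ν := by
  rw [← integral_integral_swap hY.integrable_sq, ← integral_const_mul]
  exact integral_mono_ae (memLp_integral hY).integrable_sq
    (hY.integrable_sq.integral_prod_left.const_mul _) (ae_sq_integral_le hY)

lemma integral_mul_integral {W : Ω → ℝ} (hW : MemLp W 2 P)
    (hY : MemLp (fun p : Ω × I ↦ Y p.2 p.1) 2 (P.prod ν)) :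
    ∫ ω, W ω * ∫ x, Y x ω ∂ν ∂P = ∫ x, ∫ ω, W ω * Y x ω ∂P ∂ν := by
  have h : Integrable (fun p : Ω × I ↦ W p.1 * Y p.2 p.1) (P.prod ν) :=
    (hW.comp_fst ν).integrable_mul hY
  simp_rw [← integral_const_mul]
  exact integral_integral_swap h

lemma integral_integral_eq (hY : MemLp (fun p : Ω × I ↦ Y p.2 p.1) 2 (P.prod ν)) :
    ∫ ω, ∫ x, Y x ω ∂ν ∂P = ∫ x, ∫ ω, Y x ω ∂P ∂ν :=
  integral_integral_swap (hY.integrable (by norm_num))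

lemma integral_integral_mul_integral (hY : MemLp (fun p : Ω × I ↦ Y p.2 p.1) 2 (P.prod ν))
    (hZ : MemLp (fun p : Ω × I ↦ Z p.2 p.1) 2 (P.prod ν)) (hZ2 : ∀ x, MemLp (Z x) 2 P) :
    ∫ ω, (∫ x, Y x ω ∂ν) * ∫ x, Z x ω ∂ν ∂P = ∫ x, ∫ y, ∫ ω, Y y ω * Z x ω ∂P ∂ν ∂ν := by
  rw [integral_mul_integral (memLp_integral hY) hZ]
  congr 1; funext x
  have := integral_mul_integral (hZ2 x) hY
  simpa only [mul_comm] using this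

/-- Tonelli: a second moment bounded uniformly in the parameter is integrable for a finite measure.
-/
lemma memLp_prod_of_bound (hm : StronglyMeasurable (fun p : Ω × I ↦ Y p.2 p.1))
    (hY : ∀ x, MemLp (Y x) 2 P) {C : ℝ} (hC : ∀ x, ∫ ω, Y x ω ^ 2 ∂P ≤ C) :
    MemLp (fun p : Ω × I ↦ Y p.2 p.1) 2 (P.prod ν) := by
  have hm2 : StronglyMeasurable (fun p : Ω × I ↦ Y p.2 p.1 ^ 2) := hm.pow 2
  rw [memLp_two_iff_integrable_sq hm.aestronglyMeasurable,
    integrable_prod_iff' hm2.aestronglyMeasurable]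
  refine ⟨Eventually.of_forall fun x ↦ (hY x).integrable_sq, ?_⟩
  refine Integrable.mono' (integrable_const C)
    hm2.norm.integral_prod_left'.aestronglyMeasurable (Eventually.of_forall fun x ↦ ?_)
  rw [Real.norm_of_nonneg (integral_nonneg fun _ ↦ norm_nonneg _)]
  simpa using hC x

end Functionals

/-! ### Composition of square integrable functions with a jointly measurable process. -/

section IncrementProcess

variable {Ω : Type*} [MeasurableSpace Ω] {P : Measure Ω} {X : ℝ → Ω → ℝ}

/-- A jointly measurable standard Gaussian process on the line with continuous covariance. -/
structure ContStdGaussian (X : ℝ → Ω → ℝ) (P : Measure Ω) : Prop extends StdGaussian X P where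
  jmeas : Measurable (fun p : Ω × ℝ ↦ X p.2 p.1)
  cont : Continuous (fun p : ℝ × ℝ ↦ cov2 X P p.1 p.2)

/-- Every time section has the standard normal law. Up to scaling, evaluation thus preserves
measure, so `f` may be composed with the process although it is only almost everywhere strongly
measurable. -/
lemma StdGaussian.map_prod_eq (hX : StdGaussian X P)
    (hm : Measurable (fun p : Ω × ℝ ↦ X p.2 p.1)) (ν : Measure ℝ) [IsFiniteMeasure ν] :
    (P.prod ν).map (fun p : Ω × ℝ ↦ X p.2 p.1) = ν Set.univ • gaussianReal 0 1 := by
  have := hX.isProb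
  ext s hs
  rw [Measure.map_apply hm hs, Measure.prod_apply_symm (hm hs), Measure.smul_apply, smul_eq_mul]
  have : ∀ x, P ((fun ω ↦ (ω, x)) ⁻¹' ((fun p : Ω × ℝ ↦ X p.2 p.1) ⁻¹' s)) =
      gaussianReal 0 1 s := fun x ↦ by
    rw [← hX.map_eq x, Measure.map_apply (hX.meas x) hs]
    rfl
  simp_rw [this]
  rw [lintegral_const, mul_comm]

lemma StdGaussian.memLp_prod (hX : StdGaussian X P)
    (hm : Measurable (fun p : Ω × ℝ ↦ X p.2 p.1)) (ν : Measure ℝ) [IsFiniteMeasure ν] {f : ℝ → ℝ}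
    (hf : MemLp f 2 (gaussianReal 0 1)) :
    MemLp (fun p : Ω × ℝ ↦ f (X p.2 p.1)) 2 (P.prod ν) :=
  MemLp.comp_measurePreserving (hf.smul_measure (measure_ne_top ν Set.univ))
    ⟨hm, hX.map_prod_eq hm ν⟩

end IncrementProcess

/-! ### Approximation of integral functionals by finite sums. -/

section Discretization

variable {Ω : Type*} [MeasurableSpace Ω] {P : Measure Ω} {ν : Measure ℝ} [IsFiniteMeasure ν]

lemma integral_comp_simpleFunc (π : SimpleFunc ℝ ℝ) (g : ℝ → ℝ) :
    ∫ y, g (π y) ∂ν = ∑ z ∈ π.range, ν.real (π ⁻¹' {z}) * g z := by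
  have h : ∀ y, g (π y) = ∑ z ∈ π.range, (π ⁻¹' {z}).indicator (fun _ ↦ g z) y := by
    intro y
    rw [Finset.sum_eq_single (π y)]
    · simp
    · intro z _ hz
      simp [Set.indicator, hz.symm]
    · intro hy
      exact absurd (π.mem_range_self y) hy
  simp_rw [h]
  rw [integral_finsetSum _ fun z _ ↦
    (integrable_const (g z)).indicator (π.measurableSet_preimage _)]
  refine Finset.sum_congr rfl fun z _ ↦ ?_
  rw [integral_indicator_const _ (π.measurableSet_preimage _), smul_eq_mul]

/-- Cauchy-Schwarz in `x` reduces the claim to the integral of E(Y(π x) - Y(x))², which vanishes by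
mean-square continuity and dominated convergence. -/
lemma tendsto_discretize [IsProbabilityMeasure P] {Y : ℝ → Ω → ℝ}
    (hm : StronglyMeasurable (fun p : Ω × ℝ ↦ Y p.2 p.1)) (hY : ∀ x, MemLp (Y x) 2 P) {C : ℝ}
    (hC : ∀ x, ∫ ω, Y x ω ^ 2 ∂P ≤ C)
    (hcont : ∀ x, Tendsto (fun z ↦ ∫ ω, (Y z ω - Y x ω) ^ 2 ∂P) (𝓝 x) (𝓝 0))
    {π : ℕ → SimpleFunc ℝ ℝ} (hπ : ∀ x, Tendsto (fun n ↦ π n x) atTop (𝓝 x)) :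
    Tendsto (fun n ↦ ∫ ω, (∫ x, Y (π n x) ω ∂ν - ∫ x, Y x ω ∂ν) ^ 2 ∂P) atTop (𝓝 0) := by
  have hmn : ∀ n, StronglyMeasurable (fun p : Ω × ℝ ↦ Y (π n p.2) p.1) := fun n ↦
    hm.comp_measurable (g := fun p : Ω × ℝ ↦ (p.1, π n p.2))
      (measurable_fst.prodMk ((π n).measurable.comp measurable_snd))
  have h1 : MemLp (fun p : Ω × ℝ ↦ Y p.2 p.1) 2 (P.prod ν) := memLp_prod_of_bound hm hY hC
  have hn : ∀ n, MemLp (fun p : Ω × ℝ ↦ Y (π n p.2) p.1) 2 (P.prod ν) := fun n ↦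
    memLp_prod_of_bound (Y := fun x ↦ Y (π n x)) (hmn n) (fun x ↦ hY _) (fun x ↦ hC _)
  have hsq : ∀ z x, ∫ ω, (Y z ω - Y x ω) ^ 2 ∂P ≤ 2 * C + 2 * C := by
    intro z x
    calc ∫ ω, (Y z ω - Y x ω) ^ 2 ∂P ≤ ∫ ω, (2 * Y z ω ^ 2 + 2 * Y x ω ^ 2) ∂P := by
          refine integral_mono ((hY z).sub (hY x)).integrable_sq
            (((hY z).integrable_sq.const_mul 2).add ((hY x).integrable_sq.const_mul 2)) fun ω ↦ ?_
          simp only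
          nlinarith [sq_nonneg (Y z ω + Y x ω)]
      _ ≤ _ := by
          rw [integral_add ((hY z).integrable_sq.const_mul 2) ((hY x).integrable_sq.const_mul 2),
            integral_const_mul, integral_const_mul]
          linarith [hC z, hC x]
  have hle : ∀ n, ∫ ω, (∫ x, Y (π n x) ω ∂ν - ∫ x, Y x ω ∂ν) ^ 2 ∂P ≤
      ν.real Set.univ * ∫ x, ∫ ω, (Y (π n x) ω - Y x ω) ^ 2 ∂P ∂ν := by
    intro n
    refine le_trans (le_of_eq ?_) (integral_sq_integral_le
      (Y := fun x ω ↦ Y (π n x) ω - Y x ω) ((hn n).sub h1))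
    refine integral_congr_ae ?_
    filter_upwards [ae_integrable_of_memLp_prod h1,
      ae_integrable_of_memLp_prod (Y := fun x ↦ Y (π n x)) (hn n)] with ω j1 j2
    rw [integral_sub j2 j1]
  have hlim : Tendsto (fun n ↦ ∫ x, ∫ ω, (Y (π n x) ω - Y x ω) ^ 2 ∂P ∂ν) atTop
      (𝓝 (∫ x : ℝ, (0 : ℝ) ∂ν)) := by
    refine tendsto_integral_of_dominated_convergence (fun _ ↦ 2 * C + 2 * C) (fun n ↦ ?_)
      (integrable_const _) (fun n ↦ Eventually.of_forall fun x ↦ ?_)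
      (Eventually.of_forall fun x ↦ (hcont x).comp (hπ x))
    · have h2 : StronglyMeasurable (fun p : Ω × ℝ ↦ (Y (π n p.2) p.1 - Y p.2 p.1) ^ 2) :=
        ((hmn n).sub hm).pow 2
      exact h2.integral_prod_left'.aestronglyMeasurable
    · rw [Real.norm_of_nonneg (integral_nonneg fun _ ↦ sq_nonneg _)]
      exact hsq _ _
  have hlim2 := hlim.const_mul (ν.real Set.univ)
  simp only [integral_zero, mul_zero] at hlim2
  exact squeeze_zero (fun n ↦ integral_nonneg fun _ ↦ sq_nonneg _) hle hlim2

lemma norm_cexp_sub_le (a b : ℝ) :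
    ‖Complex.exp (a * Complex.I) - Complex.exp (b * Complex.I)‖ ≤ |a - b| := by
  have h : Complex.exp (a * Complex.I) - Complex.exp (b * Complex.I) =
      Complex.exp (b * Complex.I) * (Complex.exp (Complex.I * ((a - b : ℝ) : ℂ)) - 1) := by
    rw [mul_sub, ← Complex.exp_add, mul_one]
    congr 2
    push_cast; ring
  rw [h, norm_mul, Complex.norm_exp_ofReal_mul_I, one_mul]
  exact Real.norm_exp_I_mul_ofReal_sub_one_le

lemma integrable_mul_cexp {u F : Ω → ℝ} (hu : Integrable u P) (hF : AEStronglyMeasurable F P)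
    (t : ℝ) : Integrable (fun ω ↦ (u ω : ℂ) * Complex.exp ((t * F ω : ℝ) * Complex.I)) P := by
  refine hu.ofReal.mul_bdd (c := 1) ?_ (Eventually.of_forall fun ω ↦ ?_)
  · have : AEStronglyMeasurable (fun ω ↦ t * F ω) P := hF.const_mul t
    exact (Complex.continuous_exp.comp
      (Complex.continuous_ofReal.mul continuous_const)).comp_aestronglyMeasurable this
  · rw [Complex.norm_exp_ofReal_mul_I]

/-- Change first the amplitude, then the phase: the phase factor has modulus one, and it is
Lipschitz in its argument. -/
lemma norm_integral_mul_cexp_sub_le {u v F H : Ω → ℝ} (hu : Integrable u P)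
    (hv : MemLp v 2 P) (hF : MemLp F 2 P) (hH : MemLp H 2 P) (hvi : Integrable v P) (t : ℝ) :
    ‖∫ ω, (u ω : ℂ) * Complex.exp ((t * F ω : ℝ) * Complex.I) ∂P -
      ∫ ω, (v ω : ℂ) * Complex.exp ((t * H ω : ℝ) * Complex.I) ∂P‖ ≤
    ∫ ω, |u ω - v ω| ∂P + |t| * (√(∫ ω, v ω ^ 2 ∂P) * √(∫ ω, (F ω - H ω) ^ 2 ∂P)) := by
  rw [← integral_sub (integrable_mul_cexp hu hF.aestronglyMeasurable t)
    (integrable_mul_cexp hvi hH.aestronglyMeasurable t)]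
  have h1 : Integrable (fun ω ↦ |v ω| * |F ω - H ω|) P := hv.abs.integrable_mul (hF.sub hH).abs
  have hb : ∀ ω, ‖(u ω : ℂ) * Complex.exp ((t * F ω : ℝ) * Complex.I) -
      (v ω : ℂ) * Complex.exp ((t * H ω : ℝ) * Complex.I)‖ ≤
      |u ω - v ω| + |t| * (|v ω| * |F ω - H ω|) := by
    intro ω
    have : (u ω : ℂ) * Complex.exp ((t * F ω : ℝ) * Complex.I) -
      (v ω : ℂ) * Complex.exp ((t * H ω : ℝ) * Complex.I) =
      ((u ω - v ω : ℝ) : ℂ) * Complex.exp ((t * F ω : ℝ) * Complex.I) +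
      (v ω : ℂ) * (Complex.exp ((t * F ω : ℝ) * Complex.I) -
        Complex.exp ((t * H ω : ℝ) * Complex.I)) := by push_cast; ring
    rw [this]
    refine (norm_add_le _ _).trans (add_le_add ?_ ?_)
    · rw [norm_mul, Complex.norm_exp_ofReal_mul_I, mul_one, Complex.norm_real, Real.norm_eq_abs]
    · rw [norm_mul, Complex.norm_real, Real.norm_eq_abs]
      refine (mul_le_mul_of_nonneg_left (norm_cexp_sub_le _ _) (abs_nonneg _)).trans (le_of_eq ?_)
      rw [← mul_sub, abs_mul]; ring
  have h2 : Integrable (fun ω ↦ |u ω - v ω|) P := (hu.sub hvi).abs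
  refine (norm_integral_le_integral_norm _).trans ?_
  refine (integral_mono_of_nonneg (Eventually.of_forall fun _ ↦ norm_nonneg _)
    (h2.add (h1.const_mul |t|)) (Eventually.of_forall hb)).trans (le_of_eq_of_le
      (integral_add h2 (h1.const_mul |t|)) ?_)
  rw [integral_const_mul]
  refine add_le_add le_rfl (mul_le_mul_of_nonneg_left ?_ (abs_nonneg t))
  have := (le_abs_self _).trans (abs_integral_mul_le hv.abs (hF.sub hH).abs)
  simpa using this

end Discretization

/-! ### Kernels that are polynomial in the process: measurability, integrability, continuity. -/

section Kernels

variable {Ω T I : Type*} [MeasurableSpace Ω] [MeasurableSpace I] {P : Measure Ω}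

open Polynomial

/-- Cauchy-Schwarz with fourth moments; the bound ignores the points `s`, `t`, which is what
integration over them requires. -/
lemma StdGaussian.integral_sq_mul_eval_le {X : T → Ω → ℝ} (hX : StdGaussian X P) (p q : ℝ[X])
    {k : ℝ} (hk : |k| ≤ 1) (s t : T) :
    ∫ ω, (k * (p.eval (X s ω) * q.eval (X t ω))) ^ 2 ∂P ≤
      √(∫ x, (p.eval x ^ 2) ^ 2 ∂gaussianReal 0 1) *
        √(∫ x, (q.eval x ^ 2) ^ 2 ∂gaussianReal 0 1) := by
  have := hX.isProb
  have hp := ((hX.allMoments s).polynomial p).pow 2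
  have hq := ((hX.allMoments t).polynomial q).pow 2
  rw [← hX.integral_comp_eq (g := fun x ↦ (p.eval x ^ 2) ^ 2)
      ((p.continuous.pow 2).pow 2).aestronglyMeasurable s,
    ← hX.integral_comp_eq (g := fun x ↦ (q.eval x ^ 2) ^ 2)
      ((q.continuous.pow 2).pow 2).aestronglyMeasurable t]
  refine le_trans ?_ ((le_abs_self _).trans (abs_integral_mul_le hp.memLp_two hq.memLp_two))
  refine integral_mono_of_nonneg (Eventually.of_forall fun _ ↦ sq_nonneg _)
    (hp.mul hq).integrable (Eventually.of_forall fun ω ↦ ?_)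
  simp only [mul_pow]
  have : k ^ 2 ≤ 1 := by rw [← sq_abs]; exact pow_le_one₀ (abs_nonneg _) hk
  exact mul_le_of_le_one_left (by positivity) this

lemma ContStdGaussian.stronglyMeasurable_kernel {X : ℝ → Ω → ℝ} (hX : ContStdGaussian X P)
    (p q : ℝ[X]) {k : I → ℝ} (hk : Measurable k) {s t : I → ℝ} (hs : Measurable s)
    (ht : Measurable t) :
    StronglyMeasurable (fun z : Ω × I ↦
      k z.2 * (p.eval (X (s z.2) z.1) * q.eval (X (t z.2) z.1))) := by
  have h1 : Measurable fun z : Ω × I ↦ X (s z.2) z.1 :=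
    hX.jmeas.comp (measurable_fst.prodMk (hs.comp measurable_snd))
  have h2 : Measurable fun z : Ω × I ↦ X (t z.2) z.1 :=
    hX.jmeas.comp (measurable_fst.prodMk (ht.comp measurable_snd))
  exact ((hk.comp measurable_snd).mul ((p.continuous.measurable.comp h1).mul
    (q.continuous.measurable.comp h2))).stronglyMeasurable

lemma StdGaussian.memLp_kernel {X : T → Ω → ℝ} (hX : StdGaussian X P) (p q : ℝ[X])
    (k : ℝ) (s t : T) : MemLp (fun ω ↦ k * (p.eval (X s ω) * q.eval (X t ω))) 2 P := by
  have := hX.isProb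
  exact ((((hX.allMoments s).polynomial p).mul
    ((hX.allMoments t).polynomial q)).const_mul k).memLp_two

lemma ContStdGaussian.memLp_kernel_prod {X : ℝ → Ω → ℝ} (hX : ContStdGaussian X P)
    (p q : ℝ[X]) {k : I → ℝ} (hk : Measurable k) (hk1 : ∀ i, |k i| ≤ 1) {s t : I → ℝ}
    (hs : Measurable s) (ht : Measurable t) (ν : Measure I) [IsFiniteMeasure ν] :
    MemLp (fun z : Ω × I ↦
      k z.2 * (p.eval (X (s z.2) z.1) * q.eval (X (t z.2) z.1))) 2 (P.prod ν) := by
  have := hX.isProb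
  exact memLp_prod_of_bound
    (Y := fun i ω ↦ k i * (p.eval (X (s i) ω) * q.eval (X (t i) ω)))
    (hX.stronglyMeasurable_kernel p q hk hs ht) (fun i ↦ hX.memLp_kernel p q _ _ _)
    (fun i ↦ hX.integral_sq_mul_eval_le p q (hk1 i) _ _)

/-- Both sides being bilinear in the polynomials, it suffices to treat Hermite polynomials, where
the integral is zero or a multiple of a power of the continuous covariance. -/
lemma ContStdGaussian.continuous_integral_eval_mul {X : ℝ → Ω → ℝ} (hX : ContStdGaussian X P)
    (p q : ℝ[X]) :
    Continuous fun z : ℝ × ℝ ↦ ∫ ω, p.eval (X z.1 ω) * q.eval (X z.2 ω) ∂P := by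
  have := hX.isProb
  have hint : ∀ (p q : ℝ[X]) (z : ℝ × ℝ),
      Integrable (fun ω ↦ p.eval (X z.1 ω) * q.eval (X z.2 ω)) P := fun p q z ↦
    (((hX.allMoments _).polynomial p).mul ((hX.allMoments _).polynomial q)).integrable
  have hp : p ∈ Submodule.span ℝ (Set.range hermiteR) := span_hermiteR ▸ Submodule.mem_top
  induction hp using Submodule.span_induction with
  | mem p hp =>
    obtain ⟨m, rfl⟩ := hp
    have hq : q ∈ Submodule.span ℝ (Set.range hermiteR) := span_hermiteR ▸ Submodule.mem_top
    induction hq using Submodule.span_induction with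
    | mem q hq =>
      obtain ⟨n, rfl⟩ := hq
      have h := fun z : ℝ × ℝ ↦ hX.integral_He_mul_He z.1 z.2 m n
      simp only [He] at h
      simp_rw [h]
      split_ifs
      · exact (hX.cont.pow m).const_mul _
      · exact continuous_const
    | zero => simpa using continuous_const
    | add q r _ _ hq hr =>
      simp only [Polynomial.eval_add, mul_add]
      simp_rw [integral_add (hint _ q _) (hint _ r _)]
      exact hq.add hr
    | smul c q _ hq =>
      simp only [Polynomial.eval_smul, smul_eq_mul, mul_left_comm _ c]
      simp_rw [integral_const_mul]
      exact hq.const_mul c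
  | zero => simpa using continuous_const
  | add r s _ _ hr hs =>
    simp only [Polynomial.eval_add, add_mul]
    simp_rw [integral_add (hint r q _) (hint s q _)]
    exact hr.add hs
  | smul c r _ hr =>
    simp only [Polynomial.eval_smul, smul_eq_mul, mul_assoc]
    simp_rw [integral_const_mul]
    exact hr.const_mul c

lemma ContStdGaussian.tendsto_discretize {X : ℝ → Ω → ℝ} (hX : ContStdGaussian X P)
    (q : ℝ[X]) {k : ℝ → ℝ} (hk : Continuous k) (hk1 : ∀ x, |k x| ≤ 1)
    (ν : Measure ℝ) [IsFiniteMeasure ν] {π : ℕ → SimpleFunc ℝ ℝ}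
    (hπ : ∀ x, Tendsto (fun n ↦ π n x) atTop (𝓝 x)) :
    Tendsto (fun n ↦ ∫ ω, (∫ x, k (π n x) * q.eval (X (π n x) ω) ∂ν -
      ∫ x, k x * q.eval (X x ω) ∂ν) ^ 2 ∂P) atTop (𝓝 0) := by
  have := hX.isProb
  have hm := hX.stronglyMeasurable_kernel 1 q hk.measurable measurable_id measurable_id
  have hL := fun x ↦ hX.memLp_kernel 1 q (k x) x x
  have hb := fun x ↦ hX.integral_sq_mul_eval_le 1 q (hk1 x) x x
  simp only [Polynomial.eval_one, one_mul] at hm hL hb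
  refine GaussModulus.tendsto_discretize (Y := fun x ω ↦ k x * q.eval (X x ω)) hm hL hb
    (fun x ↦ ?_) hπ
  let K : ℝ × ℝ → ℝ := fun z ↦ ∫ ω, q.eval (X z.1 ω) * q.eval (X z.2 ω) ∂P
  have hK : Continuous K := hX.continuous_integral_eval_mul q q
  have hint : ∀ y z, Integrable (fun ω ↦ q.eval (X y ω) * q.eval (X z ω)) P := fun y z ↦
    (((hX.allMoments _).polynomial q).mul ((hX.allMoments _).polynomial q)).integrable
  have heq : ∀ z, ∫ ω, (k z * q.eval (X z ω) - k x * q.eval (X x ω)) ^ 2 ∂P =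
      k z ^ 2 * K (z, z) - 2 * k z * k x * K (z, x) + k x ^ 2 * K (x, x) := by
    intro z
    have : ∀ ω, (k z * q.eval (X z ω) - k x * q.eval (X x ω)) ^ 2 =
        k z ^ 2 * (q.eval (X z ω) * q.eval (X z ω)) -
        2 * k z * k x * (q.eval (X z ω) * q.eval (X x ω)) +
        k x ^ 2 * (q.eval (X x ω) * q.eval (X x ω)) := fun ω ↦ by ring
    simp_rw [this]
    have hsub : Integrable (fun ω ↦ k z ^ 2 * (q.eval (X z ω) * q.eval (X z ω)) -
        2 * k z * k x * (q.eval (X z ω) * q.eval (X x ω))) P :=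
      ((hint _ _).const_mul _).sub ((hint _ _).const_mul _)
    rw [integral_add hsub ((hint _ _).const_mul _),
      integral_sub ((hint _ _).const_mul _) ((hint _ _).const_mul _), integral_const_mul, integral_const_mul, integral_const_mul]
  simp_rw [heq]
  have hc : Continuous fun z ↦ k z ^ 2 * K (z, z) - 2 * k z * k x * K (z, x) + k x ^ 2 * K (x, x) :=
    by fun_prop
  convert! hc.tendsto x using 2
  ring

end Kernels

/-! ### Integration by parts against the characteristic function of an additive functional. -/

section Stein

variable {Ω : Type*} [MeasurableSpace Ω] {P : Measure Ω} {X : ℝ → Ω → ℝ}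

open Polynomial

/-- Integration by parts against the characteristic function of a finite sum. -/
lemma StdGaussian.integral_He_succ_mul_cexp_sum (hX : StdGaussian X P) (Q : ℝ[X]) (x₀ : ℝ)
    (m : ℕ) (t : ℝ) (J : Finset ℝ) (w : ℝ → ℝ) :
    ∫ ω, (He (m + 1) (X x₀ ω) : ℂ) *
        Complex.exp ((t * ∑ z ∈ J, w z * Q.eval (X z ω) : ℝ) * Complex.I) ∂P =
      t * Complex.I * ∫ ω, ((He m (X x₀ ω) *
        ∑ z ∈ J, w z * (cov2 X P x₀ z * (derivative Q).eval (X z ω)) : ℝ) : ℂ) *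
        Complex.exp ((t * ∑ z ∈ J, w z * Q.eval (X z ω) : ℝ) * Complex.I) ∂P := by
  have := hX.isProb
  have hQm : ∀ (Q : ℝ[X]) (z : ℝ), Measurable fun x : ℝ → ℝ ↦ Q.eval (x z) := fun Q z ↦
    Q.continuous.measurable.comp (measurable_pi_apply z)
  have hSm : Measurable fun x : ℝ → ℝ ↦ ∑ z ∈ J, w z * Q.eval (x z) :=
    Finset.measurable_fun_sum _ fun z _ ↦ (hQm Q z).const_mul _
  have hDm : Measurable fun x : ℝ → ℝ ↦
      ∑ z ∈ J, w z * (cov2 X P x₀ z * (derivative Q).eval (x z)) :=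
    Finset.measurable_fun_sum _ fun z _ ↦ ((hQm _ z).const_mul _).const_mul _
  have hem : Measurable fun x : ℝ → ℝ ↦
      Complex.exp ((t * ∑ z ∈ J, w z * Q.eval (x z) : ℝ) * Complex.I) := by fun_prop
  have hS : AllMoments (fun ω ↦ ∑ z ∈ J, w z * Q.eval (X z ω)) P :=
    AllMoments.sum _ fun z _ ↦ ((hX.allMoments z).polynomial Q).const_mul _
  have hD : AllMoments (fun ω ↦ ∑ z ∈ J, w z * (cov2 X P x₀ z * (derivative Q).eval (X z ω))) P :=
    AllMoments.sum _ fun z _ ↦ (((hX.allMoments z).polynomial _).const_mul _).const_mul _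
  have hint : ∀ u : Ω → ℝ, AllMoments u P → Integrable (fun ω ↦ (u ω : ℂ) *
      Complex.exp ((t * ∑ z ∈ J, w z * Q.eval (X z ω) : ℝ) * Complex.I)) P := fun u hu ↦
    integrable_mul_cexp hu.integrable hS.memLp_two.aestronglyMeasurable t
  have hDe : ∀ ω, (He m (X x₀ ω) : ℂ) * ((t * Complex.I) *
        ((∑ z ∈ J, w z * (cov2 X P x₀ z * (derivative Q).eval (X z ω)) : ℝ) : ℂ) *
        Complex.exp ((t * ∑ z ∈ J, w z * Q.eval (X z ω) : ℝ) * Complex.I)) =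
      t * Complex.I * (((He m (X x₀ ω) *
        ∑ z ∈ J, w z * (cov2 X P x₀ z * (derivative Q).eval (X z ω)) : ℝ) : ℂ) *
        Complex.exp ((t * ∑ z ∈ J, w z * Q.eval (X z ω) : ℝ) * Complex.I)) := fun ω ↦ by
    push_cast; ring
  have key := hX.integral_He_succ_smul x₀ m
    (Ψ := fun x ↦ Complex.exp ((t * ∑ z ∈ J, w z * Q.eval (x z) : ℝ) * Complex.I))
    (Ψ' := fun x ↦ (t * Complex.I) *
      ((∑ z ∈ J, w z * (cov2 X P x₀ z * (derivative Q).eval (x z)) : ℝ) : ℂ) *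
      Complex.exp ((t * ∑ z ∈ J, w z * Q.eval (x z) : ℝ) * Complex.I))
    hem.stronglyMeasurable
    (((Complex.measurable_ofReal.comp hDm).const_mul _).mul hem).stronglyMeasurable
    (fun r u ↦ by
      have hl : ∀ z ∈ J, HasDerivAt (fun u ↦ w z * Q.eval (r z + u * cov2 X P x₀ z))
          (w z * (cov2 X P x₀ z * (derivative Q).eval (r z + u * cov2 X P x₀ z))) u := by
        intro z _
        have h1 : HasDerivAt (fun u ↦ r z + u * cov2 X P x₀ z) (cov2 X P x₀ z) u := by
          simpa using ((hasDerivAt_id u).mul_const (cov2 X P x₀ z)).const_add (r z)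
        have h2 := ((Q.hasDerivAt _).comp u h1).const_mul (w z)
        rwa [mul_comm ((derivative Q).eval _)] at h2
      have h3 := (((HasDerivAt.fun_sum hl).const_mul t).ofReal_comp.mul_const Complex.I).cexp
      convert! h3 using 1
      push_cast; ring)
    (by simpa only [Complex.real_smul] using hint _ ((hX.allMoments x₀).He (m + 1)))
    (by
      simp only [Complex.real_smul, hDe]
      exact (hint _ (((hX.allMoments x₀).He m).mul hD)).const_mul _)
    (by simpa only [Complex.real_smul] using hint _ ((hX.allMoments x₀).He m))
  simp only [Complex.real_smul, hDe] at key
  rw [key, integral_const_mul]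

lemma ContStdGaussian.memLp_integral_eval (hX : ContStdGaussian X P) (ν : Measure ℝ)
    [IsFiniteMeasure ν] (Q : ℝ[X]) {k : ℝ → ℝ} (hk : Measurable k) (hk1 : ∀ x, |k x| ≤ 1) :
    MemLp (fun ω ↦ ∫ y, k y * Q.eval (X y ω) ∂ν) 2 P := by
  have := hX.isProb
  have := hX.memLp_kernel_prod 1 Q hk hk1 measurable_id measurable_id ν
  simp only [Polynomial.eval_one, one_mul] at this
  exact memLp_integral (Y := fun y ω ↦ k y * Q.eval (X y ω)) this

/-- Integration by parts against the characteristic function of an additive functional. -/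
lemma ContStdGaussian.integral_He_succ_mul_cexp (hX : ContStdGaussian X P) (ν : Measure ℝ)
    [IsFiniteMeasure ν] (Q : ℝ[X]) (x₀ : ℝ) (m : ℕ) (t : ℝ) :
    ∫ ω, (He (m + 1) (X x₀ ω) : ℂ) *
        Complex.exp ((t * ∫ y, Q.eval (X y ω) ∂ν : ℝ) * Complex.I) ∂P =
      t * Complex.I * ∫ ω, ((He m (X x₀ ω) *
        ∫ y, cov2 X P x₀ y * (derivative Q).eval (X y ω) ∂ν : ℝ) : ℂ) *
        Complex.exp ((t * ∫ y, Q.eval (X y ω) ∂ν : ℝ) * Complex.I) ∂P := by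
  have := hX.isProb
  -- Replacing `y` by simple functions converging to it turns both integrals into sums over finitely
  -- many times, where the identity is known; it then passes to the limit in mean square.
  let π : ℕ → SimpleFunc ℝ ℝ := (stronglyMeasurable_id (α := ℝ)).approx
  have hπ : ∀ x, Tendsto (fun n ↦ π n x) atTop (𝓝 x) :=
    (stronglyMeasurable_id (α := ℝ)).tendsto_approx
  have hρ : Continuous fun y ↦ cov2 X P x₀ y := hX.cont.comp (Continuous.prodMk_right x₀)
  have hρ1 := hX.abs_cov2_le x₀
  let F : Ω → ℝ := fun ω ↦ ∫ y, Q.eval (X y ω) ∂ν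
  let D : Ω → ℝ := fun ω ↦ ∫ y, cov2 X P x₀ y * (derivative Q).eval (X y ω) ∂ν
  let Fn : ℕ → Ω → ℝ := fun n ω ↦ ∫ y, Q.eval (X (π n y) ω) ∂ν
  let Dn : ℕ → Ω → ℝ := fun n ω ↦
    ∫ y, cov2 X P x₀ (π n y) * (derivative Q).eval (X (π n y) ω) ∂ν
  have hFnlim : Tendsto (fun n ↦ ∫ ω, (Fn n ω - F ω) ^ 2 ∂P) atTop (𝓝 0) := by
    simpa using hX.tendsto_discretize Q (k := fun _ ↦ 1) continuous_const (by simp) ν hπ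
  have hDnlim : Tendsto (fun n ↦ ∫ ω, (Dn n ω - D ω) ^ 2 ∂P) atTop (𝓝 0) :=
    hX.tendsto_discretize (derivative Q) hρ hρ1 ν hπ
  have hFnsum : ∀ n ω, Fn n ω = ∑ z ∈ (π n).range, ν.real (π n ⁻¹' {z}) * Q.eval (X z ω) :=
    fun n ω ↦ integral_comp_simpleFunc (π n) fun z ↦ Q.eval (X z ω)
  have hDnsum : ∀ n ω, Dn n ω = ∑ z ∈ (π n).range, ν.real (π n ⁻¹' {z}) *
      (cov2 X P x₀ z * (derivative Q).eval (X z ω)) := fun n ω ↦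
    integral_comp_simpleFunc (π n) fun z ↦ cov2 X P x₀ z * (derivative Q).eval (X z ω)
  have hF : MemLp F 2 P := by
    simpa using hX.memLp_integral_eval ν Q (k := fun _ ↦ 1) measurable_const (by simp)
  have hD : MemLp D 2 P := hX.memLp_integral_eval ν _ hρ.measurable hρ1
  have hFn : ∀ n, MemLp (Fn n) 2 P := fun n ↦ by
    rw [show Fn n = _ from funext (hFnsum n)]
    exact (AllMoments.sum _ fun z _ ↦ ((hX.allMoments z).polynomial Q).const_mul _).memLp_two
  have hDn : ∀ n, AllMoments (Dn n) P := fun n ↦ by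
    rw [show Dn n = _ from funext (hDnsum n)]
    exact AllMoments.sum _ fun z _ ↦ (((hX.allMoments z).polynomial _).const_mul _).const_mul _
  have hHe := fun m ↦ (hX.allMoments x₀).He m
  have hHD : MemLp (fun ω ↦ He m (X x₀ ω) * D ω) 2 P := by
    have h := hX.memLp_kernel_prod (hermiteR m) (derivative Q) hρ.measurable hρ1
      (measurable_const (a := x₀)) measurable_id ν
    refine (memLp_integral (Y := fun y ω ↦ cov2 X P x₀ y *
      ((hermiteR m).eval (X x₀ ω) * (derivative Q).eval (X y ω))) h).ae_eq
        (Eventually.of_forall fun ω ↦ ?_)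
    simp only [D]
    rw [← integral_const_mul]
    congr 1; funext y; simp only [He]; ring
  have hid : ∀ n, ∫ ω, (He (m + 1) (X x₀ ω) : ℂ) * Complex.exp ((t * Fn n ω : ℝ) * Complex.I) ∂P =
      t * Complex.I * ∫ ω, ((He m (X x₀ ω) * Dn n ω : ℝ) : ℂ) *
        Complex.exp ((t * Fn n ω : ℝ) * Complex.I) ∂P := by
    intro n
    simp only [hFnsum, hDnsum]
    exact hX.integral_He_succ_mul_cexp_sum Q x₀ m t _ _
  have hL : Tendsto (fun n ↦ ∫ ω, (He (m + 1) (X x₀ ω) : ℂ) *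
      Complex.exp ((t * Fn n ω : ℝ) * Complex.I) ∂P) atTop
      (𝓝 (∫ ω, (He (m + 1) (X x₀ ω) : ℂ) * Complex.exp ((t * F ω : ℝ) * Complex.I) ∂P)) := by
    rw [tendsto_iff_norm_sub_tendsto_zero]
    refine squeeze_zero (fun _ ↦ norm_nonneg _) (fun n ↦ norm_integral_mul_cexp_sub_le
      (hHe (m + 1)).integrable (hHe (m + 1)).memLp_two (hFn n) hF (hHe (m + 1)).integrable t) ?_
    have := ((hFnlim.sqrt.const_mul (√(∫ ω, He (m + 1) (X x₀ ω) ^ 2 ∂P))).const_mul |t|)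
    simpa using this
  have hR : Tendsto (fun n ↦ ∫ ω, ((He m (X x₀ ω) * Dn n ω : ℝ) : ℂ) *
      Complex.exp ((t * Fn n ω : ℝ) * Complex.I) ∂P) atTop
      (𝓝 (∫ ω, ((He m (X x₀ ω) * D ω : ℝ) : ℂ) * Complex.exp ((t * F ω : ℝ) * Complex.I) ∂P)) := by
    rw [tendsto_iff_norm_sub_tendsto_zero]
    refine squeeze_zero (fun _ ↦ norm_nonneg _) (fun n ↦ (norm_integral_mul_cexp_sub_le
      ((hHe m).mul (hDn n)).integrable hHD (hFn n) hF (hHD.integrable (by norm_num)) t).trans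
      (add_le_add (b := √(∫ ω, He m (X x₀ ω) ^ 2 ∂P) * √(∫ ω, (Dn n ω - D ω) ^ 2 ∂P)) ?_ le_rfl)) ?_
    · have := (le_abs_self _).trans (abs_integral_mul_le (hHe m).memLp_two.abs
        ((hDn n).memLp_two.sub hD).abs)
      simp only [Pi.abs_apply, Pi.sub_apply, sq_abs, ← abs_mul] at this
      simpa only [mul_sub] using this
    · have := (hDnlim.sqrt.const_mul (√(∫ ω, He m (X x₀ ω) ^ 2 ∂P))).add
        ((hFnlim.sqrt.const_mul (√(∫ ω, (He m (X x₀ ω) * D ω) ^ 2 ∂P))).const_mul |t|)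
      simpa using this
  simp_rw [hid] at hL
  exact tendsto_nhds_unique hL (hR.const_mul _)

end Stein

/-! ### Stein's equation and the distance to a Gaussian characteristic function. -/

section SteinBound

open Polynomial

/-- A combination of Hermite polynomials of positive degree. -/
noncomputable def hermQ (c : ℕ → ℝ) (N : ℕ) : ℝ[X] := ∑ m ∈ Finset.range N, c m • hermiteR (m + 1)

/-- The combination of Hermite polynomials with all degrees lowered by one. -/
noncomputable def hermL (c : ℕ → ℝ) (N : ℕ) : ℝ[X] := ∑ m ∈ Finset.range N, c m • hermiteR m

lemma eval_hermQ (c : ℕ → ℝ) (N : ℕ) (x : ℝ) :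
    (hermQ c N).eval x = ∑ m ∈ Finset.range N, c m * He (m + 1) x := by
  simp [hermQ, Polynomial.eval_finsetSum, He]

lemma eval_hermL (c : ℕ → ℝ) (N : ℕ) (x : ℝ) :
    (hermL c N).eval x = ∑ m ∈ Finset.range N, c m * He m x := by
  simp [hermL, Polynomial.eval_finsetSum, He]

lemma eval_derivative_hermQ (c : ℕ → ℝ) (N : ℕ) (x : ℝ) :
    (derivative (hermQ c N)).eval x = ∑ m ∈ Finset.range N, c m * ((m + 1) * He m x) := by
  simp [hermQ, Polynomial.eval_finsetSum, He, derivative_hermiteR_succ]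

variable {Ω I : Type*} [MeasurableSpace Ω] [MeasurableSpace I] {P : Measure Ω} {X : ℝ → Ω → ℝ}

lemma integrable_prod_mul_cexp [IsProbabilityMeasure P] {ν : Measure I} [IsFiniteMeasure ν]
    {Y : I → Ω → ℝ} (hY : MemLp (fun p : Ω × I ↦ Y p.2 p.1) 2 (P.prod ν)) {F : Ω → ℝ}
    (hF : AEStronglyMeasurable F P) (t : ℝ) :
    Integrable (fun p : Ω × I ↦ (Y p.2 p.1 : ℂ) * Complex.exp ((t * F p.1 : ℝ) * Complex.I))
      (P.prod ν) :=
  integrable_mul_cexp (F := fun p : Ω × I ↦ F p.1) (hY.integrable (by norm_num)) hF.comp_fst t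

lemma integral_integral_mul_cexp [IsProbabilityMeasure P] {ν : Measure I} [IsFiniteMeasure ν]
    {Y : I → Ω → ℝ} (hY : MemLp (fun p : Ω × I ↦ Y p.2 p.1) 2 (P.prod ν)) {F : Ω → ℝ}
    (hF : AEStronglyMeasurable F P) (t : ℝ) :
    ∫ ω, ((∫ x, Y x ω ∂ν : ℝ) : ℂ) * Complex.exp ((t * F ω : ℝ) * Complex.I) ∂P =
      ∫ x, ∫ ω, (Y x ω : ℂ) * Complex.exp ((t * F ω : ℝ) * Complex.I) ∂P ∂ν := by
  rw [← integral_integral_swap (integrable_prod_mul_cexp hY hF t)]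
  congr 1; funext ω
  rw [integral_mul_const, integral_complex_ofReal]

lemma ContStdGaussian.memLp_eval_mul_integral (hX : ContStdGaussian X P) (ν : Measure ℝ)
    [IsFiniteMeasure ν] (p Q : ℝ[X]) (x₀ : ℝ) :
    MemLp (fun ω ↦ p.eval (X x₀ ω) * ∫ y, cov2 X P x₀ y * Q.eval (X y ω) ∂ν) 2 P := by
  have := hX.isProb
  have hρ : Continuous fun y ↦ cov2 X P x₀ y := hX.cont.comp (Continuous.prodMk_right x₀)
  have h := hX.memLp_kernel_prod p Q hρ.measurable (hX.abs_cov2_le x₀)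
    (measurable_const (a := x₀)) measurable_id ν
  refine (memLp_integral (Y := fun y ω ↦ cov2 X P x₀ y *
    (p.eval (X x₀ ω) * Q.eval (X y ω))) h).ae_eq (Eventually.of_forall fun ω ↦ ?_)
  simp only
  rw [← integral_const_mul]
  congr 1; funext y; ring

/-- The additive functional of `Q` along the process. -/
noncomputable def addFun (X : ℝ → Ω → ℝ) (ν : Measure ℝ) (Q : ℝ[X]) (ω : Ω) : ℝ :=
  ∫ y, Q.eval (X y ω) ∂ν

/-- The carré du champ of the additive functional of a Hermite combination. -/
noncomputable def carre (X : ℝ → Ω → ℝ) (P : Measure Ω) (ν : Measure ℝ) (p q : ℝ[X]) (ω : Ω) : ℝ :=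
  ∫ z : ℝ × ℝ, cov2 X P z.1 z.2 * (p.eval (X z.1 ω) * q.eval (X z.2 ω)) ∂(ν.prod ν)

namespace ContStdGaussian

variable (hX : ContStdGaussian X P) (ν : Measure ℝ) [IsFiniteMeasure ν]
include hX

lemma memLp_eval_prod (Q : ℝ[X]) :
    MemLp (fun p : Ω × ℝ ↦ Q.eval (X p.2 p.1)) 2 (P.prod ν) := by
  simpa using hX.memLp_kernel_prod 1 Q (k := fun _ ↦ 1) measurable_const (by simp)
    measurable_id measurable_id ν

lemma memLp_addFun (Q : ℝ[X]) : MemLp (addFun X ν Q) 2 P := by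
  have := hX.memLp_integral_eval ν Q (k := fun _ ↦ 1) measurable_const (by simp)
  simp only [one_mul] at this
  exact this

lemma memLp_carre_prod (p q : ℝ[X]) :
    MemLp (fun w : Ω × (ℝ × ℝ) ↦ cov2 X P w.2.1 w.2.2 *
      (p.eval (X w.2.1 w.1) * q.eval (X w.2.2 w.1))) 2 (P.prod (ν.prod ν)) :=
  hX.memLp_kernel_prod p q (k := fun z : ℝ × ℝ ↦ cov2 X P z.1 z.2) hX.cont.measurable
    (fun _ ↦ hX.abs_cov2_le _ _) measurable_fst measurable_snd (ν.prod ν)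

lemma memLp_carre (p q : ℝ[X]) : MemLp (carre X P ν p q) 2 P := by
  have := hX.isProb
  exact memLp_integral (Y := fun z : ℝ × ℝ ↦ fun ω ↦ cov2 X P z.1 z.2 *
    (p.eval (X z.1 ω) * q.eval (X z.2 ω))) (hX.memLp_carre_prod ν p q)

/-- Linearity in `c`. On each summand integration by parts lowers the Hermite degree by one, with no
numerical factor, while the derivative falls on the `Q` in the exponent. -/
lemma integral_hermQ_mul_cexp (c : ℕ → ℝ) (N : ℕ) (Q : ℝ[X]) (x₀ t : ℝ) :
    ∫ ω, (((hermQ c N).eval (X x₀ ω) : ℝ) : ℂ) *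
        Complex.exp ((t * addFun X ν Q ω : ℝ) * Complex.I) ∂P =
      t * Complex.I * ∫ ω, (((hermL c N).eval (X x₀ ω) *
        ∫ y, cov2 X P x₀ y * (derivative Q).eval (X y ω) ∂ν : ℝ) : ℂ) *
        Complex.exp ((t * addFun X ν Q ω : ℝ) * Complex.I) ∂P := by
  have := hX.isProb
  have hF := (hX.memLp_addFun ν Q).aestronglyMeasurable
  have h1 : ∀ m, Integrable (fun ω ↦ (He (m + 1) (X x₀ ω) : ℂ) *
      Complex.exp ((t * addFun X ν Q ω : ℝ) * Complex.I)) P := fun m ↦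
    integrable_mul_cexp ((hX.allMoments x₀).He (m + 1)).integrable hF t
  have h2 : ∀ m, Integrable (fun ω ↦ ((He m (X x₀ ω) *
        ∫ y, cov2 X P x₀ y * (derivative Q).eval (X y ω) ∂ν : ℝ) : ℂ) *
      Complex.exp ((t * addFun X ν Q ω : ℝ) * Complex.I)) P := fun m ↦
    integrable_mul_cexp ((hX.memLp_eval_mul_integral ν (hermiteR m) _ x₀).integrable
      (by norm_num)) hF t
  have e1 : ∀ ω, (((hermQ c N).eval (X x₀ ω) : ℝ) : ℂ) *
        Complex.exp ((t * addFun X ν Q ω : ℝ) * Complex.I) =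
      ∑ m ∈ Finset.range N, (c m : ℂ) * ((He (m + 1) (X x₀ ω) : ℂ) *
        Complex.exp ((t * addFun X ν Q ω : ℝ) * Complex.I)) := fun ω ↦ by
    rw [eval_hermQ]; push_cast; rw [Finset.sum_mul]
    exact Finset.sum_congr rfl fun m _ ↦ by ring
  have e2 : ∀ ω, (((hermL c N).eval (X x₀ ω) *
        ∫ y, cov2 X P x₀ y * (derivative Q).eval (X y ω) ∂ν : ℝ) : ℂ) *
        Complex.exp ((t * addFun X ν Q ω : ℝ) * Complex.I) =
      ∑ m ∈ Finset.range N, (c m : ℂ) * (((He m (X x₀ ω) *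
        ∫ y, cov2 X P x₀ y * (derivative Q).eval (X y ω) ∂ν : ℝ) : ℂ) *
      Complex.exp ((t * addFun X ν Q ω : ℝ) * Complex.I)) := fun ω ↦ by
    rw [eval_hermL]; push_cast; rw [Finset.sum_mul, Finset.sum_mul]
    exact Finset.sum_congr rfl fun m _ ↦ by ring
  simp_rw [e1, e2]
  rw [integral_finsetSum _ fun m _ ↦ (h1 m).const_mul _,
    integral_finsetSum _ fun m _ ↦ (h2 m).const_mul _, Finset.mul_sum]
  refine Finset.sum_congr rfl fun m _ ↦ ?_
  rw [integral_const_mul, integral_const_mul,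
    show ∫ ω, (He (m + 1) (X x₀ ω) : ℂ) * Complex.exp ((t * addFun X ν Q ω : ℝ) * Complex.I) ∂P = _
      from hX.integral_He_succ_mul_cexp ν Q x₀ m t]
  simp only [addFun]
  ring

/-- Stein's identity for the characteristic function of an additive functional. -/
lemma integral_addFun_mul_cexp (c : ℕ → ℝ) (N : ℕ) (t : ℝ) :
    ∫ ω, (addFun X ν (hermQ c N) ω : ℂ) *
        Complex.exp ((t * addFun X ν (hermQ c N) ω : ℝ) * Complex.I) ∂P =
      t * Complex.I * ∫ ω, (carre X P ν (hermL c N) (derivative (hermQ c N)) ω : ℂ) *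
        Complex.exp ((t * addFun X ν (hermQ c N) ω : ℝ) * Complex.I) ∂P := by
  have := hX.isProb
  set Q := hermQ c N
  have hF := (hX.memLp_addFun ν Q).aestronglyMeasurable
  have e1 := integral_integral_mul_cexp (Y := fun y ω ↦ Q.eval (X y ω)) (hX.memLp_eval_prod ν Q)
    hF t
  have hT := hX.memLp_carre_prod ν (hermL c N) (derivative Q)
  have e2 := integral_integral_mul_cexp (Y := fun z : ℝ × ℝ ↦ fun ω ↦ cov2 X P z.1 z.2 *
    ((hermL c N).eval (X z.1 ω) * (derivative Q).eval (X z.2 ω))) hT hF t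
  have hi : Integrable (fun z : ℝ × ℝ ↦ ∫ ω, ((cov2 X P z.1 z.2 *
      ((hermL c N).eval (X z.1 ω) * (derivative Q).eval (X z.2 ω)) : ℝ) : ℂ) *
      Complex.exp ((t * addFun X ν Q ω : ℝ) * Complex.I) ∂P) (ν.prod ν) :=
    (integrable_prod_mul_cexp (Y := fun z : ℝ × ℝ ↦ fun ω ↦ cov2 X P z.1 z.2 *
      ((hermL c N).eval (X z.1 ω) * (derivative Q).eval (X z.2 ω)))
      hT hF t).integral_prod_right
  refine e1.trans ((?_ : _ = _).trans (congrArg _ e2.symm))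
  rw [integral_prod _ hi, ← integral_const_mul]
  congr 1; funext x
  rw [hX.integral_hermQ_mul_cexp ν c N Q x t]
  congr 1
  have hρ : Continuous fun y ↦ cov2 X P x y := hX.cont.comp (Continuous.prodMk_right x)
  have e3 := integral_integral_mul_cexp (Y := fun y : ℝ ↦ fun ω ↦ cov2 X P x y *
    ((hermL c N).eval (X x ω) * (derivative Q).eval (X y ω)))
    (hX.memLp_kernel_prod (hermL c N) (derivative Q) hρ.measurable (hX.abs_cov2_le x)
    (measurable_const (a := x)) measurable_id ν) hF t
  rw [← e3]
  congr 1; funext ω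
  congr 2
  rw [← integral_const_mul]
  congr 1; funext y; ring

lemma hasDerivAt_charFun_addFun (Q : ℝ[X]) (t : ℝ) :
    HasDerivAt (fun t : ℝ ↦ ∫ ω, Complex.exp ((t * addFun X ν Q ω : ℝ) * Complex.I) ∂P)
      (Complex.I * ∫ ω, (addFun X ν Q ω : ℂ) *
        Complex.exp ((t * addFun X ν Q ω : ℝ) * Complex.I) ∂P) t := by
  have := hX.isProb
  have hF := hX.memLp_addFun ν Q
  have hm : ∀ t : ℝ, Integrable
      (fun ω ↦ Complex.exp ((t * addFun X ν Q ω : ℝ) * Complex.I)) P := fun t ↦ by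
    simpa using integrable_mul_cexp (integrable_const (μ := P) (1 : ℝ)) hF.aestronglyMeasurable t
  have hFi : Integrable (addFun X ν Q) P := hF.integrable (by norm_num)
  rw [← integral_const_mul]
  refine (hasDerivAt_integral_of_dominated_loc_of_deriv_le (s := Set.univ)
    (F := fun (t : ℝ) ω ↦ Complex.exp ((t * addFun X ν Q ω : ℝ) * Complex.I))
    (F' := fun (t : ℝ) ω ↦ Complex.I * ((addFun X ν Q ω : ℂ) *
        Complex.exp ((t * addFun X ν Q ω : ℝ) * Complex.I)))
    (bound := fun ω ↦ |addFun X ν Q ω|) univ_mem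
    (Eventually.of_forall fun t ↦ (hm t).aestronglyMeasurable) (hm t)
    ((integrable_mul_cexp hFi hF.aestronglyMeasurable t).const_mul _).aestronglyMeasurable
    (Eventually.of_forall fun ω t _ ↦ ?_) hFi.abs (Eventually.of_forall fun ω t _ ↦ ?_)).2
  · rw [norm_mul, norm_mul, Complex.norm_exp_ofReal_mul_I]
    simp
  · have h1 : HasDerivAt (fun t : ℝ ↦ t * addFun X ν Q ω) (addFun X ν Q ω) t := by
      simpa using (hasDerivAt_id t).mul_const (addFun X ν Q ω)
    convert! (h1.ofReal_comp.mul_const Complex.I).cexp using 1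
    ring

/-- Distance of the characteristic function of an additive functional to the Gaussian one. -/
theorem norm_charFun_addFun_sub_le (c : ℕ → ℝ) (N : ℕ) {s : ℝ} (hs : 0 ≤ s) (t : ℝ) :
    ‖∫ ω, Complex.exp ((t * addFun X ν (hermQ c N) ω : ℝ) * Complex.I) ∂P -
      Complex.exp (-(s * t ^ 2 / 2 : ℝ))‖ ≤
    t ^ 2 * ∫ ω, |carre X P ν (hermL c N) (derivative (hermQ c N)) ω - s| ∂P := by
  have := hX.isProb
  set F := addFun X ν (hermQ c N)
  set K := carre X P ν (hermL c N) (derivative (hermQ c N))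
  have hF : MemLp F 2 P := hX.memLp_addFun ν _
  have hK : Integrable K P := (hX.memLp_carre ν _ _).integrable (by norm_num)
  set δ := ∫ ω, |K ω - s| ∂P
  let φ : ℝ → ℂ := fun t ↦ ∫ ω, Complex.exp ((t * F ω : ℝ) * Complex.I) ∂P
  -- The integrating factor for φ' = -s t φ: `g` would be constant if the carré du champ were equal
  -- to `s`, and its derivative measures the defect.
  let g : ℝ → ℂ := fun t ↦ Complex.exp ((s * t ^ 2 / 2 : ℝ)) * φ t
  have hφ : ∀ t, HasDerivAt φ (-t * ∫ ω, (K ω : ℂ) * Complex.exp ((t * F ω : ℝ) * Complex.I) ∂P)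
      t := by
    intro t
    have h := hX.hasDerivAt_charFun_addFun ν (hermQ c N) t
    rw [hX.integral_addFun_mul_cexp ν c N t] at h
    convert! h using 1
    linear_combination (-(t : ℂ) *
      ∫ ω, (K ω : ℂ) * Complex.exp ((t * F ω : ℝ) * Complex.I) ∂P) * (Complex.I_mul_I)
  have hexp : ∀ t : ℝ, HasDerivAt (fun t : ℝ ↦ Complex.exp ((s * t ^ 2 / 2 : ℝ)))
      (Complex.exp ((s * t ^ 2 / 2 : ℝ)) * (s * t)) t := by
    intro t
    have h1 : HasDerivAt (fun t : ℝ ↦ s * t ^ 2 / 2) (s * t) t := by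
      convert! ((hasDerivAt_pow 2 t).const_mul s).div_const 2 using 1
      simp; ring
    have := h1.ofReal_comp.cexp
    simpa using this
  have hg : ∀ t, HasDerivAt g (-t * Complex.exp ((s * t ^ 2 / 2 : ℝ)) *
      ∫ ω, ((K ω - s : ℝ) : ℂ) * Complex.exp ((t * F ω : ℝ) * Complex.I) ∂P) t := by
    intro t
    convert! (hexp t).mul (hφ t) using 1
    have h1 := integrable_mul_cexp hK hF.aestronglyMeasurable t
    have h2 := integrable_mul_cexp (integrable_const (μ := P) s) hF.aestronglyMeasurable t
    have h3 : ∫ ω, ((K ω - s : ℝ) : ℂ) * Complex.exp ((t * F ω : ℝ) * Complex.I) ∂P =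
        ∫ ω, (K ω : ℂ) * Complex.exp ((t * F ω : ℝ) * Complex.I) ∂P - s * φ t := by
      simp only [φ]
      rw [← integral_const_mul, ← integral_sub h1 h2]
      congr 1; funext ω; push_cast; ring
    rw [h3]
    ring
  have hbound : ∀ τ ∈ Set.uIcc 0 t, ‖-τ * Complex.exp ((s * τ ^ 2 / 2 : ℝ)) *
      ∫ ω, ((K ω - s : ℝ) : ℂ) * Complex.exp ((τ * F ω : ℝ) * Complex.I) ∂P‖ ≤
      |t| * Real.exp (s * t ^ 2 / 2) * δ := by
    intro τ hτ
    have hτt : |τ| ≤ |t| := by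
      have := Set.abs_sub_left_of_mem_uIcc hτ
      simpa using this
    rw [norm_mul, norm_mul, norm_neg, Complex.norm_real, Real.norm_eq_abs,
      ← Complex.ofReal_exp, Complex.norm_real, Real.norm_of_nonneg (Real.exp_pos _).le]
    have hδ : ‖∫ ω, ((K ω - s : ℝ) : ℂ) * Complex.exp ((τ * F ω : ℝ) * Complex.I) ∂P‖ ≤ δ := by
      refine (norm_integral_le_integral_norm _).trans (le_of_eq ?_)
      congr 1; funext ω
      rw [norm_mul, Complex.norm_exp_ofReal_mul_I, mul_one, Complex.norm_real, Real.norm_eq_abs]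
    -- As `0 ≤ s`, the integrating factor is largest at the endpoint `t`, where it later cancels
    -- against the Gaussian factor.
    have hsq : τ ^ 2 ≤ t ^ 2 := sq_le_sq.2 hτt
    have he : Real.exp (s * τ ^ 2 / 2) ≤ Real.exp (s * t ^ 2 / 2) :=
      Real.exp_le_exp.2 (by have := mul_le_mul_of_nonneg_left hsq hs; linarith)
    gcongr
  have hmv := (convex_uIcc 0 t).norm_image_sub_le_of_norm_hasDerivWithin_le
    (fun τ _ ↦ (hg τ).hasDerivWithinAt) hbound Set.left_mem_uIcc Set.right_mem_uIcc
  have hg0 : g 0 = 1 := by simp [g, φ]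
  rw [hg0, sub_zero, Real.norm_eq_abs] at hmv
  have hfin : φ t - Complex.exp (-(s * t ^ 2 / 2 : ℝ)) =
      Complex.exp (-(s * t ^ 2 / 2 : ℝ)) * (g t - 1) := by
    simp only [g]
    rw [mul_sub, ← mul_assoc, ← Complex.exp_add, neg_add_cancel, Complex.exp_zero]
    ring
  change ‖φ t - _‖ ≤ _
  rw [hfin, norm_mul, ← Complex.ofReal_neg, ← Complex.ofReal_exp, Complex.norm_real,
    Real.norm_of_nonneg (Real.exp_pos _).le]
  calc Real.exp (-(s * t ^ 2 / 2)) * ‖g t - 1‖ ≤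
      Real.exp (-(s * t ^ 2 / 2)) * (|t| * Real.exp (s * t ^ 2 / 2) * δ * |t|) := by gcongr
    _ = (Real.exp (-(s * t ^ 2 / 2)) * Real.exp (s * t ^ 2 / 2)) * (|t| * |t|) * δ := by ring
    _ = t ^ 2 * δ := by
      rw [← Real.exp_add, neg_add_cancel, Real.exp_zero, abs_mul_abs_self]; ring

end ContStdGaussian

end SteinBound

/-! ### Integrals of multigraph weights over four points. -/

section GraphIntegrals

open scoped ENNReal

/-- Replace every base by the largest of the three; since it is at most 1, the exponent may be
lowered to `k`. -/
lemma pow_mul_pow_mul_pow_le {a b c : ℝ≥0∞} (ha : a ≤ 1) (hb : b ≤ 1) (hc : c ≤ 1)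
    {p s t k : ℕ} (h : k ≤ p + s + t) : a ^ p * b ^ s * c ^ t ≤ a ^ k + b ^ k + c ^ k := by
  have key : ∀ m : ℝ≥0∞, m ≤ 1 → a ≤ m → b ≤ m → c ≤ m → a ^ p * b ^ s * c ^ t ≤ m ^ k := by
    intro m hm h1 h2 h3
    calc a ^ p * b ^ s * c ^ t ≤ m ^ p * m ^ s * m ^ t := by gcongr
      _ = m ^ (p + s + t) := by rw [pow_add, pow_add]
      _ ≤ m ^ k := pow_le_pow_right_of_le_one' hm h
  rcases le_total a b with hab | hab
  · rcases le_total b c with hbc | hbc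
    · exact (key c hc (hab.trans hbc) hbc le_rfl).trans le_add_self
    · exact (key b hb hab le_rfl hbc).trans (le_add_self.trans le_self_add)
  · rcases le_total a c with hac | hac
    · exact (key c hc hac (hab.trans hac) le_rfl).trans le_add_self
    · exact (key a ha le_rfl hab hac).trans (le_self_add.trans le_self_add)

/-- The total exponent is kept, so replacing the smaller base by the larger needs no upper bound on
the bases. -/
lemma pow_mul_pow_le {a b : ℝ≥0∞} (q u : ℕ) : a ^ q * b ^ u ≤ a ^ (q + u) + b ^ (q + u) := by
  rcases le_total a b with h | h
  · calc a ^ q * b ^ u ≤ b ^ q * b ^ u := by gcongr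
      _ ≤ _ := by rw [← pow_add]; exact le_add_self
  · calc a ^ q * b ^ u ≤ a ^ q * a ^ u := by gcongr
      _ ≤ _ := by rw [← pow_add]; exact le_self_add

variable {α : Type*} [MeasurableSpace α]

/-- The weight of a multigraph on the four vertices `p.1.1, p.1.2, p.2.1, p.2.2`. -/
noncomputable def graphWeight (D : α → α → ℝ≥0∞) (n₀ n₁ n₂ n₃ n₄ n₅ : ℕ)
    (p : (α × α) × (α × α)) : ℝ≥0∞ :=
  D p.1.1 p.1.2 ^ n₀ * D p.2.1 p.2.2 ^ n₁ * D p.1.1 p.2.1 ^ n₂ * D p.1.1 p.2.2 ^ n₃ *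
    D p.1.2 p.2.1 ^ n₄ * D p.1.2 p.2.2 ^ n₅

/-- The integral of the weight of a multigraph over the positions of its four vertices. -/
noncomputable def graphInt (D : α → α → ℝ≥0∞) (ν : Measure α) (n₀ n₁ n₂ n₃ n₄ n₅ : ℕ) : ℝ≥0∞ :=
  ∫⁻ p, graphWeight D n₀ n₁ n₂ n₃ n₄ n₅ p ∂((ν.prod ν).prod (ν.prod ν))

variable {D : α → α → ℝ≥0∞} {ν : Measure α} [IsFiniteMeasure ν]

lemma measurable_graphWeight (hD : Measurable fun p : α × α ↦ D p.1 p.2) (n₀ n₁ n₂ n₃ n₄ n₅ : ℕ) :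
    Measurable (graphWeight D n₀ n₁ n₂ n₃ n₄ n₅) := by
  have h : ∀ {f g : (α × α) × (α × α) → α}, Measurable f → Measurable g → ∀ n : ℕ,
      Measurable fun p ↦ D (f p) (g p) ^ n := fun hf hg n ↦ (hD.comp (hf.prodMk hg)).pow_const n
  unfold graphWeight
  exact (((((h (by fun_prop) (by fun_prop) _).mul (h (by fun_prop) (by fun_prop) _)).mul
    (h (by fun_prop) (by fun_prop) _)).mul (h (by fun_prop) (by fun_prop) _)).mul
    (h (by fun_prop) (by fun_prop) _)).mul (h (by fun_prop) (by fun_prop) _)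

/-- Exchanging vertices 1 and 2 permutes the edges 13 with 23 and 14 with 24. Such relabellings will
bring any graph to a normal form. -/
lemma graphInt_swap_left (hD : Measurable fun p : α × α ↦ D p.1 p.2)
    (hs : ∀ x y, D x y = D y x) (n₀ n₁ n₂ n₃ n₄ n₅ : ℕ) :
    graphInt D ν n₀ n₁ n₂ n₃ n₄ n₅ = graphInt D ν n₀ n₁ n₄ n₅ n₂ n₃ := by
  have h : MeasurePreserving (Prod.map Prod.swap id) ((ν.prod ν).prod (ν.prod ν))
      ((ν.prod ν).prod (ν.prod ν)) :=
    Measure.measurePreserving_swap.prod (MeasurePreserving.id _)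
  rw [graphInt, graphInt, ← h.lintegral_comp (measurable_graphWeight hD _ _ _ _ _ _)]
  congr 1; funext p
  simp only [graphWeight, Prod.map_fst, Prod.map_snd, Prod.fst_swap, Prod.snd_swap, id]
  rw [hs p.1.2 p.1.1]
  ring

lemma graphInt_swap_right (hD : Measurable fun p : α × α ↦ D p.1 p.2)
    (hs : ∀ x y, D x y = D y x) (n₀ n₁ n₂ n₃ n₄ n₅ : ℕ) :
    graphInt D ν n₀ n₁ n₂ n₃ n₄ n₅ = graphInt D ν n₀ n₁ n₃ n₂ n₅ n₄ := by
  have h : MeasurePreserving (Prod.map id Prod.swap) ((ν.prod ν).prod (ν.prod ν))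
      ((ν.prod ν).prod (ν.prod ν)) :=
    (MeasurePreserving.id _).prod Measure.measurePreserving_swap
  rw [graphInt, graphInt, ← h.lintegral_comp (measurable_graphWeight hD _ _ _ _ _ _)]
  congr 1; funext p
  simp only [graphWeight, Prod.map_fst, Prod.map_snd, Prod.fst_swap, Prod.snd_swap, id]
  rw [hs p.2.2 p.2.1]
  ring

lemma graphInt_swap (hD : Measurable fun p : α × α ↦ D p.1 p.2)
    (hs : ∀ x y, D x y = D y x) (n₀ n₁ n₂ n₃ n₄ n₅ : ℕ) :
    graphInt D ν n₀ n₁ n₂ n₃ n₄ n₅ = graphInt D ν n₁ n₀ n₂ n₄ n₃ n₅ := by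
  have h : MeasurePreserving Prod.swap ((ν.prod ν).prod (ν.prod ν))
      ((ν.prod ν).prod (ν.prod ν)) := Measure.measurePreserving_swap
  rw [graphInt, graphInt, ← h.lintegral_comp (measurable_graphWeight hD _ _ _ _ _ _)]
  congr 1; funext p
  simp only [graphWeight, Prod.fst_swap, Prod.snd_swap]
  rw [hs p.2.1 p.1.1, hs p.2.2 p.1.1, hs p.2.1 p.1.2, hs p.2.2 p.1.2]
  ring

/-- Bound for a graph with an edge `23`, integrating out the vertex `1` first. -/
lemma graphInt_le_of_middle (hD : Measurable fun p : α × α ↦ D p.1 p.2)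
    (hs : ∀ x y, D x y = D y x) (h1 : ∀ x y, D x y ≤ 1) {M : ℕ → ℝ≥0∞}
    (hM : ∀ j, 1 ≤ j → ∀ᵐ x ∂ν, ∫⁻ y, D x y ^ j ∂ν ≤ M j) {k n₀ n₁ n₂ n₃ n₄ n₅ : ℕ} (hk : 1 ≤ k)
    (hn₁ : 1 ≤ n₁) (hn₄ : 1 ≤ n₄) (hd : k ≤ n₀ + n₂ + n₃) :
    graphInt D ν n₀ n₁ n₂ n₃ n₄ n₅ ≤ 6 * ν Set.univ * M k * (M n₁ * M (n₄ + n₅)) := by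
  have hDl : ∀ x, Measurable fun y ↦ D x y := fun x ↦ hD.comp measurable_prodMk_left
  have hDr : ∀ y, Measurable fun x ↦ D x y := fun y ↦ hD.comp measurable_prodMk_right
  have hMs : ∀ j, 1 ≤ j → ∀ᵐ x ∂ν, ∫⁻ y, D y x ^ j ∂ν ≤ M j := fun j hj ↦ by
    simpa only [hs] using hM j hj
  -- Vertex 1 has degree at least `k`, so its three edge factors are at most a sum of three `k`-th
  -- powers, each contributing `M k`.
  have step1 : ∀ᵐ y ∂ν, ∀ᵐ w ∂(ν.prod ν),
      ∫⁻ x, graphWeight D n₀ n₁ n₂ n₃ n₄ n₅ ((x, y), w) ∂ν ≤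
        3 * M k * (D w.1 w.2 ^ n₁ * (D y w.1 ^ (n₄ + n₅) + D y w.2 ^ (n₄ + n₅))) := by
    filter_upwards [hMs k hk] with y hy
    have e1 : ∀ᵐ w ∂(ν.prod ν), ∫⁻ x, D x w.1 ^ k ∂ν ≤ M k :=
      Measure.quasiMeasurePreserving_fst.ae (hMs k hk)
    have e2 : ∀ᵐ w ∂(ν.prod ν), ∫⁻ x, D x w.2 ^ k ∂ν ≤ M k :=
      Measure.quasiMeasurePreserving_snd.ae (hMs k hk)
    filter_upwards [e1, e2] with w hw1 hw2
    calc ∫⁻ x, graphWeight D n₀ n₁ n₂ n₃ n₄ n₅ ((x, y), w) ∂ν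
        ≤ ∫⁻ x, (D x y ^ k + D x w.1 ^ k + D x w.2 ^ k) *
          (D w.1 w.2 ^ n₁ * (D y w.1 ^ (n₄ + n₅) + D y w.2 ^ (n₄ + n₅))) ∂ν := by
          refine lintegral_mono fun x ↦ ?_
          calc graphWeight D n₀ n₁ n₂ n₃ n₄ n₅ ((x, y), w)
              = (D x y ^ n₀ * D x w.1 ^ n₂ * D x w.2 ^ n₃) *
                (D w.1 w.2 ^ n₁ * (D y w.1 ^ n₄ * D y w.2 ^ n₅)) := by
                simp only [graphWeight]; ring
            _ ≤ _ := by
                gcongr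
                · exact pow_mul_pow_mul_pow_le (h1 _ _) (h1 _ _) (h1 _ _) hd
                · exact pow_mul_pow_le _ _
      _ = (∫⁻ x, D x y ^ k ∂ν + ∫⁻ x, D x w.1 ^ k ∂ν + ∫⁻ x, D x w.2 ^ k ∂ν) *
          (D w.1 w.2 ^ n₁ * (D y w.1 ^ (n₄ + n₅) + D y w.2 ^ (n₄ + n₅))) := by
          have m1 : ∀ v, Measurable fun x ↦ D x v ^ k := fun v ↦ (hDr v).pow_const k
          have m2 : Measurable fun x ↦ D x y ^ k + D x w.1 ^ k := (m1 y).add (m1 w.1)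
          have m3 : Measurable fun x ↦ D x y ^ k + D x w.1 ^ k + D x w.2 ^ k := m2.add (m1 w.2)
          rw [lintegral_mul_const _ m3, lintegral_add_left m2, lintegral_add_left (m1 y)]
      _ ≤ (M k + M k + M k) *
          (D w.1 w.2 ^ n₁ * (D y w.1 ^ (n₄ + n₅) + D y w.2 ^ (n₄ + n₅))) := by gcongr
      _ = _ := by ring
  -- Vertex 2 is now tied to 3 and 4 only; its two factors split into two powers of exponent `n₄ +
  -- n₅`, positive thanks to the edge 23.
  have step2 : ∀ᵐ w ∂(ν.prod ν),
      ∫⁻ y, D w.1 w.2 ^ n₁ * (D y w.1 ^ (n₄ + n₅) + D y w.2 ^ (n₄ + n₅)) ∂ν ≤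
        2 * M (n₄ + n₅) * D w.1 w.2 ^ n₁ := by
    have e1 : ∀ᵐ w ∂(ν.prod ν), ∫⁻ x, D x w.1 ^ (n₄ + n₅) ∂ν ≤ M (n₄ + n₅) :=
      Measure.quasiMeasurePreserving_fst.ae (hMs (n₄ + n₅) (by omega))
    have e2 : ∀ᵐ w ∂(ν.prod ν), ∫⁻ x, D x w.2 ^ (n₄ + n₅) ∂ν ≤ M (n₄ + n₅) :=
      Measure.quasiMeasurePreserving_snd.ae (hMs (n₄ + n₅) (by omega))
    filter_upwards [e1, e2] with w hw1 hw2
    have m1 : ∀ v, Measurable fun x ↦ D x v ^ (n₄ + n₅) := fun v ↦ (hDr v).pow_const _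
    have m2 : Measurable fun x ↦ D x w.1 ^ (n₄ + n₅) + D x w.2 ^ (n₄ + n₅) :=
      (m1 w.1).add (m1 w.2)
    rw [lintegral_const_mul _ m2, lintegral_add_left (m1 w.1)]
    calc _ ≤ D w.1 w.2 ^ n₁ * (M (n₄ + n₅) + M (n₄ + n₅)) := by gcongr
      _ = _ := by ring
  -- Only the edge 34 is left; integrating over its two ends gives `M n₁` and the total mass.
  have step3 : ∫⁻ w, D w.1 w.2 ^ n₁ ∂(ν.prod ν) ≤ ν Set.univ * M n₁ := by
    rw [lintegral_prod _ (hD.pow_const _).aemeasurable]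
    calc _ ≤ ∫⁻ _, M n₁ ∂ν := lintegral_mono_ae (hM n₁ hn₁)
      _ = _ := by rw [lintegral_const, mul_comm]
  have hRm : Measurable fun p : α × (α × α) ↦
      D p.2.1 p.2.2 ^ n₁ * (D p.1 p.2.1 ^ (n₄ + n₅) + D p.1 p.2.2 ^ (n₄ + n₅)) := by
    have h : ∀ {f g : α × (α × α) → α}, Measurable f → Measurable g → ∀ n : ℕ,
      Measurable fun p ↦ D (f p) (g p) ^ n := fun hf hg n ↦ (hD.comp (hf.prodMk hg)).pow_const n
    exact (h (by fun_prop) (by fun_prop) _).mul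
      ((h (by fun_prop) (by fun_prop) _).add (h (by fun_prop) (by fun_prop) _))
  have hWm := measurable_graphWeight hD n₀ n₁ n₂ n₃ n₄ n₅
  calc graphInt D ν n₀ n₁ n₂ n₃ n₄ n₅
      = ∫⁻ w, ∫⁻ y, ∫⁻ x, graphWeight D n₀ n₁ n₂ n₃ n₄ n₅ ((x, y), w) ∂ν ∂ν ∂(ν.prod ν) := by
        rw [graphInt, lintegral_prod_symm _ hWm.aemeasurable]
        congr 1; funext w
        exact lintegral_prod_symm (fun v ↦ graphWeight D n₀ n₁ n₂ n₃ n₄ n₅ (v, w))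
          (hWm.comp measurable_prodMk_right).aemeasurable
    _ = ∫⁻ y, ∫⁻ w, ∫⁻ x, graphWeight D n₀ n₁ n₂ n₃ n₄ n₅ ((x, y), w) ∂ν ∂(ν.prod ν) ∂ν := by
        have hm : Measurable fun z : α × ((α × α) × α) ↦
            graphWeight D n₀ n₁ n₂ n₃ n₄ n₅ ((z.1, z.2.2), z.2.1) := hWm.comp (by fun_prop)
        exact lintegral_lintegral_swap hm.lintegral_prod_left'.aemeasurable
    _ ≤ ∫⁻ y, ∫⁻ w, 3 * M k *
          (D w.1 w.2 ^ n₁ * (D y w.1 ^ (n₄ + n₅) + D y w.2 ^ (n₄ + n₅))) ∂(ν.prod ν) ∂ν :=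
        lintegral_mono_ae (step1.mono fun y hy ↦ lintegral_mono_ae hy)
    _ = 3 * M k * ∫⁻ w, ∫⁻ y,
          (D w.1 w.2 ^ n₁ * (D y w.1 ^ (n₄ + n₅) + D y w.2 ^ (n₄ + n₅))) ∂ν ∂(ν.prod ν) := by
        rw [← lintegral_lintegral_swap (f := fun y (w : α × α) ↦
            D w.1 w.2 ^ n₁ * (D y w.1 ^ (n₄ + n₅) + D y w.2 ^ (n₄ + n₅))) hRm.aemeasurable,
          ← lintegral_const_mul _ hRm.lintegral_prod_right']
        congr 1; funext y
        exact lintegral_const_mul _ (hRm.comp measurable_prodMk_left)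
    _ ≤ 3 * M k * ∫⁻ w, 2 * M (n₄ + n₅) * D w.1 w.2 ^ n₁ ∂(ν.prod ν) := by
        exact mul_le_mul' le_rfl (lintegral_mono_ae step2)
    _ = 3 * M k * (2 * M (n₄ + n₅) * ∫⁻ w, D w.1 w.2 ^ n₁ ∂(ν.prod ν)) := by
        rw [lintegral_const_mul _ (hD.pow_const _)]
    _ ≤ 3 * M k * (2 * M (n₄ + n₅) * (ν Set.univ * M n₁)) := by gcongr
    _ = _ := by ring

/-- Integrating out vertex 1 leaves exponents `n₁` and `n₄ + n₅`, whose sum dominates the degree of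
vertex 2 when `n₀ ≤ n₁`. Otherwise the mirror image of the path 1-2-3-4 is used, and the degree of
vertex 3 plays that role. -/
lemma exists_graphInt_le_of_middle (hD : Measurable fun p : α × α ↦ D p.1 p.2)
    (hs : ∀ x y, D x y = D y x) (h1 : ∀ x y, D x y ≤ 1) {M : ℕ → ℝ≥0∞}
    (hM : ∀ j, 1 ≤ j → ∀ᵐ x ∂ν, ∫⁻ y, D x y ^ j ∂ν ≤ M j) {k n₀ n₁ n₂ n₃ n₄ n₅ : ℕ} (hk : 1 ≤ k)
    (hn₀ : 1 ≤ n₀) (hn₁ : 1 ≤ n₁) (hn₄ : 1 ≤ n₄) (hd₁ : k ≤ n₀ + n₂ + n₃)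
    (hd₂ : k ≤ n₀ + n₄ + n₅) (hd₃ : k ≤ n₁ + n₂ + n₄) (hd₄ : k ≤ n₁ + n₃ + n₅) :
    ∃ i j, 1 ≤ i ∧ 1 ≤ j ∧ k ≤ i + j ∧ i + j ≤ n₀ + n₁ + n₂ + n₃ + n₄ + n₅ ∧
      graphInt D ν n₀ n₁ n₂ n₃ n₄ n₅ ≤ 6 * ν Set.univ * M k * (M i * M j) := by
  rcases le_total n₀ n₁ with h | h
  · exact ⟨n₁, n₄ + n₅, hn₁, by omega, by omega, by omega,
      graphInt_le_of_middle hD hs h1 hM hk hn₁ hn₄ hd₁⟩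
  · refine ⟨n₀, n₄ + n₂, hn₀, by omega, by omega, by omega, ?_⟩
    rw [graphInt_swap hD hs, graphInt_swap_left hD hs, graphInt_swap_right hD hs]
    exact graphInt_le_of_middle hD hs h1 hM hk hn₀ hn₄ (by omega)

/-- Bound for the integral of a connected multigraph of minimal degree `k`. -/
theorem exists_graphInt_le (hD : Measurable fun p : α × α ↦ D p.1 p.2)
    (hs : ∀ x y, D x y = D y x) (h1 : ∀ x y, D x y ≤ 1) {M : ℕ → ℝ≥0∞}
    (hM : ∀ j, 1 ≤ j → ∀ᵐ x ∂ν, ∫⁻ y, D x y ^ j ∂ν ≤ M j) {k n₀ n₁ n₂ n₃ n₄ n₅ : ℕ} (hk : 1 ≤ k)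
    (hn₀ : 1 ≤ n₀) (hn₁ : 1 ≤ n₁) (hc : 1 ≤ n₂ + n₃ + n₄ + n₅) (hd₁ : k ≤ n₀ + n₂ + n₃)
    (hd₂ : k ≤ n₀ + n₄ + n₅) (hd₃ : k ≤ n₁ + n₂ + n₄) (hd₄ : k ≤ n₁ + n₃ + n₅) :
    ∃ i j, 1 ≤ i ∧ 1 ≤ j ∧ k ≤ i + j ∧ i + j ≤ n₀ + n₁ + n₂ + n₃ + n₄ + n₅ ∧
      graphInt D ν n₀ n₁ n₂ n₃ n₄ n₅ ≤ 6 * ν Set.univ * M k * (M i * M j) := by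
  have key : ∀ m₂ m₃ m₄ m₅, graphInt D ν n₀ n₁ n₂ n₃ n₄ n₅ = graphInt D ν n₀ n₁ m₂ m₃ m₄ m₅ →
      1 ≤ m₄ → m₂ + m₃ + m₄ + m₅ = n₂ + n₃ + n₄ + n₅ → k ≤ n₀ + m₂ + m₃ → k ≤ n₀ + m₄ + m₅ →
      k ≤ n₁ + m₂ + m₄ → k ≤ n₁ + m₃ + m₅ →
      ∃ i j, 1 ≤ i ∧ 1 ≤ j ∧ k ≤ i + j ∧ i + j ≤ n₀ + n₁ + n₂ + n₃ + n₄ + n₅ ∧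
      graphInt D ν n₀ n₁ n₂ n₃ n₄ n₅ ≤ 6 * ν Set.univ * M k * (M i * M j) := by
    intro m₂ m₃ m₄ m₅ he hm hsum a1 a2 a3 a4
    obtain ⟨i, j, b1, b2, b3, b4, b5⟩ :=
      exists_graphInt_le_of_middle hD hs h1 hM hk hn₀ hn₁ hm a1 a2 a3 a4
    exact ⟨i, j, b1, b2, b3, by omega, he ▸ b5⟩
  -- Any available cross edge can be moved to the position 23 by exchanging vertices within the
  -- pairs.
  have h4 : 1 ≤ n₄ ∨ 1 ≤ n₅ ∨ 1 ≤ n₂ ∨ 1 ≤ n₃ := by omega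
  rcases h4 with h | h | h | h
  · exact key n₂ n₃ n₄ n₅ rfl h rfl hd₁ hd₂ hd₃ hd₄
  · exact key n₃ n₂ n₅ n₄ (graphInt_swap_right hD hs _ _ _ _ _ _) h (by omega) (by omega)
      (by omega) (by omega) (by omega)
  · exact key n₄ n₅ n₂ n₃ (graphInt_swap_left hD hs _ _ _ _ _ _) h (by omega) (by omega)
      (by omega) (by omega) (by omega)
  · refine key n₅ n₄ n₃ n₂ ?_ h (by omega) (by omega) (by omega) (by omega) (by omega)
    rw [graphInt_swap_left hD hs, graphInt_swap_right hD hs]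

end GraphIntegrals

/-! ### Mean and variance of the carré du champ. -/

section CarreVariance

open Polynomial
open scoped ENNReal

variable {Ω : Type*} [MeasurableSpace Ω] {P : Measure Ω} {X : ℝ → Ω → ℝ}

/-- The absolute correlation as an extended nonnegative real. -/
noncomputable def absCorr (X : ℝ → Ω → ℝ) (P : Measure Ω) (x y : ℝ) : ℝ≥0∞ := ‖cov2 X P x y‖ₑ

lemma absCorr_comm (x y : ℝ) : absCorr X P x y = absCorr X P y x := by
  simp [absCorr, cov2_comm]

lemma StdGaussian.absCorr_le_one (hX : StdGaussian X P) (x y : ℝ) : absCorr X P x y ≤ 1 := by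
  rw [absCorr, Real.enorm_eq_ofReal_abs]
  exact ENNReal.ofReal_le_one.2 (hX.abs_cov2_le x y)

lemma ContStdGaussian.measurable_absCorr (hX : ContStdGaussian X P) :
    Measurable fun p : ℝ × ℝ ↦ absCorr X P p.1 p.2 :=
  hX.cont.measurable.enorm

/-- The two correlation prefactors of the kernels become one extra edge 12 and one extra edge 34;
together with a cross edge they make the graph connected. -/
lemma ofReal_abs_mul_edgeMono (n : Fin 6 → ℕ) (z w : ℝ × ℝ) :
    ENNReal.ofReal (|cov2 X P z.1 z.2| * |cov2 X P w.1 w.2| *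
      edgeMono n (edgeCov X P z.1 z.2 w.1 w.2)) =
    graphWeight (absCorr X P) (n 0 + 1) (n 1 + 1) (n 2) (n 3) (n 4) (n 5) (z, w) := by
  simp only [edgeMono, edgeCov, Fin.prod_univ_six, graphWeight, absCorr, Real.enorm_eq_ofReal_abs]
  simp only [← ENNReal.ofReal_pow (abs_nonneg _)]
  rw [← ENNReal.ofReal_mul (by positivity), ← ENNReal.ofReal_mul (by positivity),
    ← ENNReal.ofReal_mul (by positivity), ← ENNReal.ofReal_mul (by positivity),
    ← ENNReal.ofReal_mul (by positivity)]
  congr 1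
  simp
  ring

lemma lintegral_list_sum_le {α ι : Type*} [MeasurableSpace α] {μ : Measure α} {L : List ι}
    {W : ι → α → ℝ≥0∞} (hW : ∀ i, Measurable (W i)) {B : ℝ≥0∞}
    (hB : ∀ i ∈ L, ∫⁻ p, W i p ∂μ ≤ B) :
    ∫⁻ p, (L.map fun i ↦ W i p).sum ∂μ ≤ L.length * B := by
  induction L with
  | nil => simp
  | cons i L ih =>
    simp only [List.map_cons, List.sum_cons, List.length_cons]
    rw [lintegral_add_left (hW i)]
    calc _ ≤ B + L.length * B :=
          add_le_add (hB i (by simp)) (ih fun j hj ↦ hB j (by simp [hj]))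
      _ = _ := by push_cast; ring

lemma ofReal_list_sum {ι : Type*} (L : List ι) (u : ι → ℝ) (hu : ∀ i, 0 ≤ u i) :
    ENNReal.ofReal (L.map u).sum = (L.map fun i ↦ ENNReal.ofReal (u i)).sum := by
  induction L with
  | nil => simp
  | cons i L ih =>
    simp only [List.map_cons, List.sum_cons]
    rw [ENNReal.ofReal_add (hu i), ih]
    exact List.sum_nonneg (by simpa using fun j _ ↦ hu j)

/-- The value of the kernel of the carré du champ at a pair of points. -/
noncomputable def carreKer (X : ℝ → Ω → ℝ) (P : Measure Ω) (m l : ℕ) (z : ℝ × ℝ) (ω : Ω) : ℝ :=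
  cov2 X P z.1 z.2 * (He m (X z.1 ω) * He l (X z.2 ω))

lemma ContStdGaussian.memLp_carreKer (hX : ContStdGaussian X P) (m l : ℕ) (z : ℝ × ℝ) :
    MemLp (carreKer X P m l z) 2 P := by
  have := hX.isProb
  exact (((hX.allMoments z.1).He m).mul ((hX.allMoments z.2).He l)).memLp_two.const_mul _

lemma ContStdGaussian.integral_carreKer (hX : ContStdGaussian X P) (m l : ℕ) (z : ℝ × ℝ) :
    ∫ ω, carreKer X P m l z ω ∂P =
      if m = l then (m.factorial : ℝ) * cov2 X P z.1 z.2 ^ (m + 1) else 0 := by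
  unfold carreKer
  rw [integral_const_mul, hX.integral_He_mul_He]
  split_ifs <;> ring

lemma ContStdGaussian.cov_carreKer (hX : ContStdGaussian X P) (m l : ℕ) (z w : ℝ × ℝ) :
    ∫ ω, (carreKer X P m l z ω - ∫ ω', carreKer X P m l z ω' ∂P) *
        (carreKer X P m l w ω - ∫ ω', carreKer X P m l w ω' ∂P) ∂P =
      cov2 X P z.1 z.2 * cov2 X P w.1 w.2 * (mom4 X P z.1 z.2 w.1 w.2 m l m l -
        mom4 X P z.1 z.2 w.1 w.2 m l 0 0 * mom4 X P z.1 z.2 w.1 w.2 0 0 m l) := by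
  have := hX.isProb
  have hz := hX.memLp_carreKer m l z
  have hw := hX.memLp_carreKer m l w
  have h := covariance_eq_sub hz hw
  rw [covariance] at h
  rw [h]
  simp only [Pi.mul_apply, mom4, He_zero, one_mul, mul_one, carreKer]
  have e : ∀ ω, cov2 X P z.1 z.2 * (He m (X z.1 ω) * He l (X z.2 ω)) *
      (cov2 X P w.1 w.2 * (He m (X w.1 ω) * He l (X w.2 ω))) = cov2 X P z.1 z.2 *
      cov2 X P w.1 w.2 * (He m (X z.1 ω) * (He l (X z.2 ω) * He m (X w.1 ω) * He l (X w.2 ω))) :=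
    fun ω ↦ by ring
  simp_rw [e, integral_const_mul]
  ring

variable (ν : Measure ℝ) [IsFiniteMeasure ν]

lemma ContStdGaussian.memLp_carreKer_prod (hX : ContStdGaussian X P) (m l : ℕ) :
    MemLp (fun w : Ω × (ℝ × ℝ) ↦ carreKer X P m l w.2 w.1) 2 (P.prod (ν.prod ν)) :=
  hX.memLp_carre_prod ν (hermiteR m) (hermiteR l)

lemma ContStdGaussian.integral_carre (hX : ContStdGaussian X P) (m l : ℕ) :
    ∫ ω, carre X P ν (hermiteR m) (hermiteR l) ω ∂P =
      if m = l then (m.factorial : ℝ) * ∫ z : ℝ × ℝ, cov2 X P z.1 z.2 ^ (m + 1) ∂(ν.prod ν)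
        else 0 := by
  have := hX.isProb
  have h := integral_integral_eq (Y := carreKer X P m l) (hX.memLp_carreKer_prod ν m l)
  rw [show carre X P ν (hermiteR m) (hermiteR l) = fun ω ↦ ∫ z, carreKer X P m l z ω ∂(ν.prod ν)
    from rfl, h]
  simp_rw [hX.integral_carreKer]
  split_ifs
  · rw [integral_const_mul]
  · simp

lemma ContStdGaussian.integral_sq_carre_sub (hX : ContStdGaussian X P) (m l : ℕ) :
    ∫ ω, (carre X P ν (hermiteR m) (hermiteR l) ω -
        ∫ ω', carre X P ν (hermiteR m) (hermiteR l) ω' ∂P) ^ 2 ∂P =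
      ∫ w : ℝ × ℝ, ∫ z : ℝ × ℝ, cov2 X P z.1 z.2 * cov2 X P w.1 w.2 *
        (mom4 X P z.1 z.2 w.1 w.2 m l m l -
        mom4 X P z.1 z.2 w.1 w.2 m l 0 0 * mom4 X P z.1 z.2 w.1 w.2 0 0 m l)
        ∂(ν.prod ν) ∂(ν.prod ν) := by
  have := hX.isProb
  have hK := hX.memLp_carreKer_prod ν m l
  let g : ℝ × ℝ → ℝ := fun z ↦ ∫ ω, carreKer X P m l z ω ∂P
  have hgc : Continuous g := by
    simp only [g, hX.integral_carreKer]
    split_ifs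
    · exact (hX.cont.pow _).const_mul _
    · exact continuous_const
  have hg : MemLp (fun w : Ω × (ℝ × ℝ) ↦ g w.2) 2 (P.prod (ν.prod ν)) := by
    refine MemLp.of_bound (hgc.measurable.comp measurable_snd).aestronglyMeasurable m.factorial
      (Eventually.of_forall fun w ↦ ?_)
    simp only [g, hX.integral_carreKer]
    split_ifs
    · rw [Real.norm_eq_abs, abs_mul, abs_pow, Nat.abs_cast]
      exact mul_le_of_le_one_right (by positivity)
        (pow_le_one₀ (abs_nonneg _) (hX.abs_cov2_le _ _))
    · simp
  have hY : MemLp (fun w : Ω × (ℝ × ℝ) ↦ carreKer X P m l w.2 w.1 - g w.2) 2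
    (P.prod (ν.prod ν)) := hK.sub hg
  -- `g` does not depend on ω, so its integrability is read off from any one of the almost all
  -- integrable sections; the probability measure guarantees that one exists.
  have hgi : Integrable g (ν.prod ν) :=
    (memLp_two_iff_integrable_sq hgc.aestronglyMeasurable).2
      (by
        have := hg.integrable_sq
        exact (integrable_prod_iff (this.aestronglyMeasurable)).1 this |>.1.exists.choose_spec)
      |>.integrable (by norm_num)
  have e := integral_integral_mul_integral (Y := fun z ω ↦ carreKer X P m l z ω - g z)
    (Z := fun z ω ↦ carreKer X P m l z ω - g z) hY hY
    fun z ↦ (hX.memLp_carreKer m l z).sub (memLp_const _)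
  simp only [g, hX.cov_carreKer] at e
  rw [← e]
  refine integral_congr_ae ?_
  filter_upwards [ae_integrable_of_memLp_prod hK] with ω hω
  rw [← sq, integral_sub hω hgi, ← integral_integral_eq (Y := carreKer X P m l) hK]
  rfl

/-- The variance of the carré du champ of two Hermite polynomials, in terms of one-point bounds
for the integrals of powers of the correlation. -/
theorem exists_integral_sq_carre_sub_le (P : Measure Ω) {m l k : ℕ} (hk : 1 ≤ k) (hm : k ≤ m + 1)
    (hl : k ≤ l + 1) : ∃ C : ℝ, 0 ≤ C ∧ ∀ {X : ℝ → Ω → ℝ}, ContStdGaussian X P →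
      ∀ (ν : Measure ℝ) [IsFiniteMeasure ν] {M : ℕ → ℝ} {B : ℝ}, (∀ j, 0 ≤ M j) → 0 ≤ B →
      (∀ j, 1 ≤ j → j ≤ m + l + 2 → ∀ᵐ x ∂ν, ∫⁻ y, absCorr X P x y ^ j ∂ν ≤ ENNReal.ofReal (M j)) →
      (∀ i j, 1 ≤ i → 1 ≤ j → k ≤ i + j → i + j ≤ m + l + 2 → M i * M j ≤ B) →
      ∫ ω, (carre X P ν (hermiteR m) (hermiteR l) ω -
        ∫ ω', carre X P ν (hermiteR m) (hermiteR l) ω' ∂P) ^ 2 ∂P ≤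
      C * (ν.real Set.univ * M k * B) := by
  obtain ⟨C, L, hC, hL, hb⟩ := exists_cov_mom4_bound (T := ℝ) P m l m l
  refine ⟨C * (L.length * 6), by positivity, fun {X} hX ν _ {M B} hM0 hB0 hM hMB ↦ ?_⟩
  have := hX.isProb
  set V := ∫ ω, (carre X P ν (hermiteR m) (hermiteR l) ω -
        ∫ ω', carre X P ν (hermiteR m) (hermiteR l) ω' ∂P) ^ 2 ∂P with hV
  have hV0 : 0 ≤ V := integral_nonneg fun _ ↦ sq_nonneg _
  have hVe : ENNReal.ofReal V = ‖V‖ₑ := by rw [Real.enorm_eq_ofReal_abs, abs_of_nonneg hV0]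
  have hm1 := fun n : Fin 6 → ℕ ↦ measurable_graphWeight (D := absCorr X P) hX.measurable_absCorr
    (n 0 + 1) (n 1 + 1) (n 2) (n 3) (n 4) (n 5)
  have hgb : ∀ n ∈ L, graphInt (absCorr X P) ν (n 0 + 1) (n 1 + 1) (n 2) (n 3) (n 4) (n 5) ≤
      ENNReal.ofReal (6 * (ν.real Set.univ * M k * B)) := by
    intro n hn
    obtain ⟨⟨h1, h2, h3, h4⟩, h5⟩ := hL n hn
    -- With the two extra edges the degrees are `m + 1`, `l + 1`, `m + 1`, `l + 1`, all at least
    -- `k`, and there are `m + l + 2` edges in total. Larger exponents never occur, so the value ⊤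
    -- chosen for them makes the one-point bound vacuous there.
    obtain ⟨i, j, hi, hj, hij, hij2, hle⟩ := exists_graphInt_le (ν := ν) (D := absCorr X P)
      hX.measurable_absCorr absCorr_comm hX.absCorr_le_one
      (M := fun j ↦ if j ≤ m + l + 2 then ENNReal.ofReal (M j) else ⊤)
      (fun j hj ↦ by
        by_cases h : j ≤ m + l + 2
        · simpa only [h, if_true] using hM j hj h
        · simp [h]) (n₀ := n 0 + 1) (n₁ := n 1 + 1) (n₂ := n 2) (n₃ := n 3) (n₄ := n 4)
        (n₅ := n 5) hk (by omega) (by omega) h5 (by omega) (by omega) (by omega) (by omega)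
    refine hle.trans ?_
    rw [if_pos (by omega), if_pos (by omega), if_pos (by omega), ← ofReal_measureReal,
      show (6 : ℝ≥0∞) = ENNReal.ofReal 6 by simp,
      ← ENNReal.ofReal_mul (by positivity), ← ENNReal.ofReal_mul (by positivity),
      ← ENNReal.ofReal_mul (hM0 _), ← ENNReal.ofReal_mul (by have := hM0 k; positivity)]
    refine ENNReal.ofReal_le_ofReal ?_
    have h6 := hMB i j hi hj hij (by omega)
    have h7 : 0 ≤ 6 * ν.real Set.univ * M k := by have := hM0 k; positivity
    nlinarith [mul_le_mul_of_nonneg_left h6 h7]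
  have hb' : ∀ z w : ℝ × ℝ, ‖cov2 X P z.1 z.2 * cov2 X P w.1 w.2 *
        (mom4 X P z.1 z.2 w.1 w.2 m l m l -
        mom4 X P z.1 z.2 w.1 w.2 m l 0 0 * mom4 X P z.1 z.2 w.1 w.2 0 0 m l)‖ₑ ≤
      ENNReal.ofReal C * (L.map fun n ↦ graphWeight (absCorr X P) (n 0 + 1) (n 1 + 1) (n 2) (n 3)
        (n 4) (n 5) (z, w)).sum := by
    intro z w
    simp_rw [← ofReal_abs_mul_edgeMono]
    rw [← ofReal_list_sum _ _ fun n ↦ mul_nonneg (by positivity) (edgeMono_nonneg _ _),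
      ← ENNReal.ofReal_mul hC, Real.enorm_eq_ofReal_abs, abs_mul, abs_mul, List.sum_map_mul_left]
    refine ENNReal.ofReal_le_ofReal ?_
    calc _ ≤ |cov2 X P z.1 z.2| * |cov2 X P w.1 w.2| *
          (C * (L.map fun n ↦ edgeMono n (edgeCov X P z.1 z.2 w.1 w.2)).sum) := by
          gcongr
          exact hb X hX.toStdGaussian _ _ _ _
      _ = _ := by ring
  have key : ENNReal.ofReal V ≤
      ENNReal.ofReal (C * (L.length * 6) * (ν.real Set.univ * M k * B)) := by
    calc ENNReal.ofReal V ≤ ∫⁻ w : ℝ × ℝ, ∫⁻ z : ℝ × ℝ, ENNReal.ofReal C *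
          (L.map fun n ↦ graphWeight (absCorr X P) (n 0 + 1) (n 1 + 1) (n 2) (n 3)
            (n 4) (n 5) (z, w)).sum ∂(ν.prod ν) ∂(ν.prod ν) := by
          rw [hVe, hV, hX.integral_sq_carre_sub ν]
          refine (enorm_integral_le_lintegral_enorm _).trans (lintegral_mono fun w ↦ ?_)
          exact (enorm_integral_le_lintegral_enorm _).trans (lintegral_mono fun z ↦ hb' z w)
      _ = ENNReal.ofReal C * ∫⁻ p, (L.map fun n ↦ graphWeight (absCorr X P) (n 0 + 1) (n 1 + 1)
            (n 2) (n 3) (n 4) (n 5) p).sum ∂((ν.prod ν).prod (ν.prod ν)) := by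
          have hmS : Measurable fun p ↦ (L.map fun n ↦ graphWeight (absCorr X P) (n 0 + 1) (n 1 + 1)
            (n 2) (n 3) (n 4) (n 5) p).sum := by
            clear hL hb hgb hb'
            induction L with
            | nil => simp
            | cons n L ih =>
              simp only [List.map_cons, List.sum_cons]
              exact (hm1 n).add ih
          rw [← lintegral_const_mul _ hmS, lintegral_prod_symm _ (hmS.const_mul _).aemeasurable]
      _ ≤ ENNReal.ofReal C * (L.length * ENNReal.ofReal (6 * (ν.real Set.univ * M k * B))) := by
          gcongr
          exact lintegral_list_sum_le hm1 hgb
      _ = _ := by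
          rw [← ENNReal.ofReal_natCast, ← ENNReal.ofReal_mul (by positivity),
            ← ENNReal.ofReal_mul hC]
          congr 1; ring
  have h8 : 0 ≤ C * (L.length * 6) * (ν.real Set.univ * M k * B) := by
    have := hM0 k; positivity
  exact (ENNReal.ofReal_le_ofReal_iff h8).1 key

lemma ContStdGaussian.carre_ae_eq (hX : ContStdGaussian X P) (c : ℕ → ℝ) (N : ℕ) :
    ∀ᵐ ω ∂P, carre X P ν (hermL c N) (derivative (hermQ c N)) ω =
      ∑ m ∈ Finset.range N, ∑ l ∈ Finset.range N,
        c m * (c l * (l + 1)) * carre X P ν (hermiteR m) (hermiteR l) ω := by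
  have := hX.isProb
  have h : ∀ᵐ ω ∂P, ∀ m l, Integrable (fun z ↦ carreKer X P m l z ω) (ν.prod ν) := by
    rw [ae_all_iff]; intro m
    rw [ae_all_iff]; intro l
    exact ae_integrable_of_memLp_prod (hX.memLp_carreKer_prod ν m l)
  filter_upwards [h] with ω hω
  have e : ∀ m l, c m * (c l * (l + 1)) * carre X P ν (hermiteR m) (hermiteR l) ω =
      ∫ z, c m * (c l * (l + 1)) * carreKer X P m l z ω ∂(ν.prod ν) := fun m l ↦ by
    rw [integral_const_mul]; rfl
  simp_rw [e]
  rw [carre]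
  have e2 : ∀ m, ∑ l ∈ Finset.range N, ∫ z, c m * (c l * (l + 1)) * carreKer X P m l z ω ∂(ν.prod ν)
      = ∫ z, ∑ l ∈ Finset.range N, c m * (c l * (l + 1)) * carreKer X P m l z ω ∂(ν.prod ν) :=
    fun m ↦ (integral_finsetSum _ fun l _ ↦ (hω m l).const_mul _).symm
  simp_rw [e2]
  rw [← integral_finsetSum _ fun m _ ↦ integrable_finsetSum _ fun l _ ↦ (hω m l).const_mul _]
  congr 1; funext z
  rw [eval_hermL, eval_derivative_hermQ, Finset.sum_mul_sum, Finset.mul_sum]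
  refine Finset.sum_congr rfl fun m _ ↦ ?_
  rw [Finset.mul_sum]
  refine Finset.sum_congr rfl fun l _ ↦ ?_
  rw [carreKer]; ring

/-- Orthogonality keeps only `m = l`, and the factor `m + 1` of the derivative completes the
factorial: the mean is the variance of the additive functional term by term. -/
lemma ContStdGaussian.integral_carre_herm (hX : ContStdGaussian X P) (c : ℕ → ℝ) (N : ℕ) :
    ∫ ω, carre X P ν (hermL c N) (derivative (hermQ c N)) ω ∂P =
      ∑ m ∈ Finset.range N, c m ^ 2 * (m + 1).factorial *
        ∫ z : ℝ × ℝ, cov2 X P z.1 z.2 ^ (m + 1) ∂(ν.prod ν) := by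
  have := hX.isProb
  have hi : ∀ m l, Integrable (carre X P ν (hermiteR m) (hermiteR l)) P := fun m l ↦
    (hX.memLp_carre ν _ _).integrable (by norm_num)
  rw [integral_congr_ae (hX.carre_ae_eq ν c N),
    integral_finsetSum _ fun m _ ↦ integrable_finsetSum _ fun l _ ↦ (hi m l).const_mul _]
  refine Finset.sum_congr rfl fun m hm ↦ ?_
  rw [integral_finsetSum _ fun l _ ↦ (hi m l).const_mul _]
  simp_rw [integral_const_mul, hX.integral_carre ν]
  rw [Finset.sum_eq_single m (fun l _ hl ↦ by rw [if_neg (Ne.symm hl), mul_zero])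
    (fun h ↦ absurd hm h), if_pos rfl, Nat.factorial_succ]
  push_cast; ring

/-- Bilinear expansion, the triangle inequality, and L¹ ≤ L² on a probability space reduce the Stein
error to pairs of single Hermite degrees. -/
lemma ContStdGaussian.integral_abs_carre_sub_le (hX : ContStdGaussian X P) (c : ℕ → ℝ) (N : ℕ) :
    ∫ ω, |carre X P ν (hermL c N) (derivative (hermQ c N)) ω -
        ∫ ω', carre X P ν (hermL c N) (derivative (hermQ c N)) ω' ∂P| ∂P ≤
      ∑ m ∈ Finset.range N, ∑ l ∈ Finset.range N, |c m * (c l * (l + 1))| *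
        √(∫ ω, (carre X P ν (hermiteR m) (hermiteR l) ω -
        ∫ ω', carre X P ν (hermiteR m) (hermiteR l) ω' ∂P) ^ 2 ∂P) := by
  have := hX.isProb
  have hi : ∀ m l, Integrable (carre X P ν (hermiteR m) (hermiteR l)) P := fun m l ↦
    (hX.memLp_carre ν _ _).integrable (by norm_num)
  let T : ℕ → ℕ → Ω → ℝ := fun m l ω ↦ carre X P ν (hermiteR m) (hermiteR l) ω -
    ∫ ω', carre X P ν (hermiteR m) (hermiteR l) ω' ∂P
  have hT : ∀ m l, MemLp (T m l) 2 P := fun m l ↦ (hX.memLp_carre ν _ _).sub (memLp_const _)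
  have hTi : ∀ m l, Integrable (fun ω ↦ |T m l ω|) P := fun m l ↦
    ((hT m l).integrable (by norm_num)).abs
  have hmean : ∫ ω', carre X P ν (hermL c N) (derivative (hermQ c N)) ω' ∂P =
      ∑ m ∈ Finset.range N, ∑ l ∈ Finset.range N,
        c m * (c l * (l + 1)) * ∫ ω, carre X P ν (hermiteR m) (hermiteR l) ω ∂P := by
    rw [integral_congr_ae (hX.carre_ae_eq ν c N),
      integral_finsetSum _ fun m _ ↦ integrable_finsetSum _ fun l _ ↦ (hi m l).const_mul _]
    refine Finset.sum_congr rfl fun m hm ↦ ?_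
    rw [integral_finsetSum _ fun l _ ↦ (hi m l).const_mul _]
    simp_rw [integral_const_mul]
  have hsi : ∀ m, Integrable (fun ω ↦ ∑ l ∈ Finset.range N, |c m * (c l * (l + 1))| * |T m l ω|) P :=
    fun m ↦ integrable_finsetSum _ fun l _ ↦ (hTi m l).const_mul _
  calc _ ≤ ∫ ω, ∑ m ∈ Finset.range N, ∑ l ∈ Finset.range N,
        |c m * (c l * (l + 1))| * |T m l ω| ∂P := by
        refine integral_mono_ae ?_ (integrable_finsetSum _ fun m _ ↦ hsi m) ?_
        · exact (((hX.memLp_carre ν _ _).sub (memLp_const _)).integrable (by norm_num)).abs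
        · filter_upwards [hX.carre_ae_eq ν c N] with ω hω
          rw [hω, hmean, ← Finset.sum_sub_distrib]
          refine (Finset.abs_sum_le_sum_abs _ _).trans (Finset.sum_le_sum fun m _ ↦ ?_)
          rw [← Finset.sum_sub_distrib]
          refine (Finset.abs_sum_le_sum_abs _ _).trans (Finset.sum_le_sum fun l _ ↦ ?_)
          rw [← mul_sub, abs_mul]
    _ = ∑ m ∈ Finset.range N, ∑ l ∈ Finset.range N,
        |c m * (c l * (l + 1))| * ∫ ω, |T m l ω| ∂P := by
        rw [integral_finsetSum _ fun m _ ↦ hsi m]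
        refine Finset.sum_congr rfl fun m _ ↦ ?_
        rw [integral_finsetSum _ fun l _ ↦ (hTi m l).const_mul _]
        simp_rw [integral_const_mul]
    _ ≤ _ := by
        refine Finset.sum_le_sum fun m _ ↦ Finset.sum_le_sum fun l _ ↦ ?_
        gcongr
        exact integral_abs_le_sqrt (hT m l)

end CarreVariance

/-! ### Consequences of the gap condition for sequences of power integrals. -/

section PowerAsymptotics

variable {ι : Type*} {l : Filter ι} {A : ℕ → ι → ℝ}

lemma isLittleO_rpow_of_lt
    (hA : ∀ j : ℕ, 1 ≤ j → (fun h ↦ A j h ^ (1 / (j : ℝ))) =o[l]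
      fun h ↦ A (j + 1) h ^ (1 / ((j : ℝ) + 1))) {j k : ℕ} (hj : 1 ≤ j) (hjk : j < k) :
    (fun h ↦ A j h ^ (1 / (j : ℝ))) =o[l] fun h ↦ A k h ^ (1 / (k : ℝ)) := by
  induction k, hjk using Nat.le_induction with
  | base => exact_mod_cast hA j hj
  | succ k hk ih => exact ih.trans (by exact_mod_cast hA k (by omega))

variable (h0 : ∀ j h, 0 ≤ A j h)
include h0

lemma isLittleO_pow_of_lt
    (hA : ∀ j : ℕ, 1 ≤ j → (fun h ↦ A j h ^ (1 / (j : ℝ))) =o[l]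
      fun h ↦ A (j + 1) h ^ (1 / ((j : ℝ) + 1))) {j k : ℕ} (hj : 1 ≤ j) (hjk : j < k) :
    A j =o[l] fun h ↦ (A k h ^ (1 / (k : ℝ))) ^ j := by
  refine ((isLittleO_rpow_of_lt hA hj hjk).pow hj).congr_left fun h ↦ ?_
  rw [one_div, Real.rpow_inv_natCast_pow (h0 j h) (by omega)]

variable {K : ℝ} (hb : ∀ j, ∀ᶠ h in l, A j h ≤ K)
include hb

lemma isBigO_rpow_one (k : ℕ) : (fun h ↦ A k h ^ (1 / (k : ℝ))) =O[l] fun _ ↦ (1 : ℝ) := by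
  refine IsBigO.of_bound (K ^ (1 / (k : ℝ))) ((hb k).mono fun h hh ↦ ?_)
  rw [Real.norm_of_nonneg (Real.rpow_nonneg (h0 k h) _), norm_one, mul_one]
  exact Real.rpow_le_rpow (h0 k h) hh (by positivity)

variable (hA : ∀ j : ℕ, 1 ≤ j → (fun h ↦ A j h ^ (1 / (j : ℝ))) =o[l]
      fun h ↦ A (j + 1) h ^ (1 / ((j : ℝ) + 1)))
include hA

/-- `A j` is negligible against the power j/(j+1) of `A (j + 1)`, which is bounded. -/
lemma isLittleO_one {j : ℕ} (hj : 1 ≤ j) : A j =o[l] fun _ ↦ (1 : ℝ) := by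
  refine (isLittleO_pow_of_lt h0 hA hj (Nat.lt_succ_self j)).trans_isBigO ?_
  simpa using (isBigO_rpow_one h0 hb (j + 1)).pow j

/-- If `k ≤ i`, then `A i` is dominated by `A k` and `A j` tends to 0; likewise with the roles
exchanged. If both indices are below `k`, the gap gives a bound by the power (i+j)/k ≥ 1 of the
bounded quantity `A k`. -/
lemma isLittleO_mul (hanti : ∀ i j, i ≤ j → ∀ᶠ h in l, A j h ≤ A i h) {i j k : ℕ} (hi : 1 ≤ i)
    (hj : 1 ≤ j) (hk : 1 ≤ k) (hij : k ≤ i + j) : (fun h ↦ A i h * A j h) =o[l] A k := by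
  have key : ∀ i j, 1 ≤ j → k ≤ i → (fun h ↦ A i h * A j h) =o[l] A k := by
    intro i j hj hki
    have h1 : A i =O[l] A k := IsBigO.of_bound 1 ((hanti k i hki).mono fun h hh ↦ by
      rw [Real.norm_of_nonneg (h0 _ _), Real.norm_of_nonneg (h0 _ _), one_mul]; exact hh)
    simpa using h1.mul_isLittleO (isLittleO_one h0 hb hA hj)
  rcases le_or_gt k i with h | h
  · exact key i j hj h
  rcases le_or_gt k j with h' | h'
  · simpa only [mul_comm] using key j i hi h'
  have h1 := (isLittleO_pow_of_lt h0 hA hi h).mul (isLittleO_pow_of_lt h0 hA hj h')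
  refine h1.trans_isBigO ?_
  have h2 : (fun h ↦ (A k h ^ (1 / (k : ℝ))) ^ k * (A k h ^ (1 / (k : ℝ))) ^ (i + j - k)) =O[l]
      A k := by
    have h3 := (isBigO_refl (A k) l).mul ((isBigO_rpow_one h0 hb k).pow (i + j - k))
    simp only [one_pow, mul_one] at h3
    refine h3.congr_left fun h ↦ ?_
    rw [one_div, Real.rpow_inv_natCast_pow (h0 k h) (by omega)]
  refine h2.congr_left fun h ↦ ?_
  rw [← pow_add, ← pow_add]
  congr 1; omega

end PowerAsymptotics

/-! ### Vanishing of the normalized variance of the carré du champ. -/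

section CarreAsymptotics

open Polynomial
open scoped ENNReal

variable {Ω : Type*} [MeasurableSpace Ω] {P : Measure Ω}

/-- The double integral of a power of the absolute correlation. -/
noncomputable def corrInt (X : ℝ → Ω → ℝ) (P : Measure Ω) (ν : Measure ℝ) (j : ℕ) : ℝ :=
  ∫ z : ℝ × ℝ, |cov2 X P z.1 z.2| ^ j ∂(ν.prod ν)

variable {ν : Measure ℝ}

lemma corrInt_nonneg (X : ℝ → Ω → ℝ) (P : Measure Ω) (ν : Measure ℝ) (j : ℕ) :
    0 ≤ corrInt X P ν j :=
  integral_nonneg fun _ ↦ by positivity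

variable [IsFiniteMeasure ν]

lemma ContStdGaussian.integrable_abs_cov2_pow {X : ℝ → Ω → ℝ} (hX : ContStdGaussian X P) (j : ℕ) :
    Integrable (fun z : ℝ × ℝ ↦ |cov2 X P z.1 z.2| ^ j) (ν.prod ν) := by
  refine Integrable.of_bound (hX.cont.abs.pow j).aestronglyMeasurable 1
    (Eventually.of_forall fun z ↦ ?_)
  rw [Real.norm_of_nonneg (by positivity)]
  exact pow_le_one₀ (abs_nonneg _) (hX.abs_cov2_le _ _)

lemma ContStdGaussian.corrInt_anti {X : ℝ → Ω → ℝ} (hX : ContStdGaussian X P) {i j : ℕ}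
    (hij : i ≤ j) : corrInt X P ν j ≤ corrInt X P ν i :=
  integral_mono (hX.integrable_abs_cov2_pow j) (hX.integrable_abs_cov2_pow i) fun _ ↦
    pow_le_pow_of_le_one (abs_nonneg _) (hX.abs_cov2_le _ _) hij

lemma ContStdGaussian.corrInt_le {X : ℝ → Ω → ℝ} (hX : ContStdGaussian X P) (j : ℕ) :
    corrInt X P ν j ≤ (ν.prod ν).real Set.univ := by
  refine (hX.corrInt_anti (Nat.zero_le j)).trans ?_
  simp [corrInt]

/-- A family of standard Gaussian processes whose correlations satisfy the regularity condition
and the gap condition of the central limit theorem. -/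
structure CorrelationGap {ι : Type*} (l : Filter ι) (X : ι → ℝ → Ω → ℝ) (P : Measure Ω)
    (ν : Measure ℝ) : Prop where
  std : ∀ᶠ h in l, ContStdGaussian (X h) P
  pos : ∀ j, ∀ᶠ h in l, 0 < corrInt (X h) P ν j
  sup : ∀ j, 1 ≤ j → ∃ C : ℝ, ∀ᶠ h in l, ∀ᵐ x ∂ν,
    ∫⁻ y, absCorr (X h) P x y ^ j ∂ν ≤ ENNReal.ofReal (C * corrInt (X h) P ν j)
  gap : ∀ j : ℕ, 1 ≤ j → (fun h ↦ corrInt (X h) P ν j ^ (1 / (j : ℝ))) =o[l]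
      fun h ↦ corrInt (X h) P ν (j + 1) ^ (1 / ((j : ℝ) + 1))

variable {ι : Type*} {l : Filter ι} {X : ι → ℝ → Ω → ℝ} (hX : CorrelationGap l X P ν)
include hX

lemma CorrelationGap.isLittleO_mul {i j k : ℕ} (hi : 1 ≤ i)
    (hj : 1 ≤ j) (hk : 1 ≤ k) (hij : k ≤ i + j) :
    (fun h ↦ corrInt (X h) P ν i * corrInt (X h) P ν j) =o[l] fun h ↦ corrInt (X h) P ν k :=
  GaussModulus.isLittleO_mul (A := fun j h ↦ corrInt (X h) P ν j)
    (fun _ _ ↦ corrInt_nonneg _ _ _ _) (fun j ↦ hX.std.mono fun _ hh ↦ hh.corrInt_le j) hX.gap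
    (fun _ _ hij ↦ hX.std.mono fun _ hh ↦ hh.corrInt_anti hij) hi hj hk hij

/-- In the graph bound one vertex contributes `corrInt k` up to a constant, and the remaining
product of two such integrals is negligible against `corrInt k`. -/
lemma CorrelationGap.isLittleO_integral_sq_carre_sub {m n k : ℕ} (hk : 1 ≤ k) (hm : k ≤ m + 1)
    (hn : k ≤ n + 1) :
    (fun h ↦ ∫ ω, (carre (X h) P ν (hermiteR m) (hermiteR n) ω -
        ∫ ω', carre (X h) P ν (hermiteR m) (hermiteR n) ω' ∂P) ^ 2 ∂P) =o[l]
      fun h ↦ corrInt (X h) P ν k ^ 2 := by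
  obtain ⟨C, hC, hbound⟩ := exists_integral_sq_carre_sub_le P hk hm hn
  choose! c hc using hX.sup
  -- The constants of the supremum condition carry no sign, so they are replaced by their positive
  -- parts.
  let D : ℕ → ℝ := fun j ↦ max (c j) 0
  have hD0 : ∀ j, 0 ≤ D j := fun j ↦ le_max_right _ _
  have hD : ∀ᶠ h in l, ∀ j ∈ Finset.range (m + n + 3), 1 ≤ j → ∀ᵐ x ∂ν,
      ∫⁻ y, absCorr (X h) P x y ^ j ∂ν ≤ ENNReal.ofReal (D j * corrInt (X h) P ν j) := by
    rw [Filter.eventually_all_finset]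
    intro j _
    by_cases hj : 1 ≤ j
    · filter_upwards [hc j hj] with h hh _
      filter_upwards [hh] with x hx
      refine hx.trans (ENNReal.ofReal_le_ofReal ?_)
      exact mul_le_mul_of_nonneg_right (le_max_left _ _) (corrInt_nonneg _ _ _ _)
    · simp [hj]
  let S : ℝ := C * (ν.real Set.univ * D k)
  have hS : 0 ≤ S := mul_nonneg hC (mul_nonneg measureReal_nonneg (hD0 k))
  rw [isLittleO_iff]
  intro ε hε
  -- `S + 1` instead of `S` since the overall constant may be zero.
  have hδ : 0 < ε / (S + 1) := by positivity
  have hprod : ∀ᶠ h in l, ∀ i ∈ Finset.range (m + n + 3), ∀ j ∈ Finset.range (m + n + 3),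
      1 ≤ i → 1 ≤ j → k ≤ i + j → (D i * corrInt (X h) P ν i) * (D j * corrInt (X h) P ν j) ≤
        ε / (S + 1) * corrInt (X h) P ν k := by
    rw [Filter.eventually_all_finset]; intro i _
    rw [Filter.eventually_all_finset]; intro j _
    by_cases hi : 1 ≤ i; swap
    · simp [hi]
    by_cases hj : 1 ≤ j; swap
    · simp [hj]
    by_cases hij : k ≤ i + j; swap
    · simp [hij]
    have h1 := (hX.isLittleO_mul hi hj hk hij).const_mul_left (D i * D j)
    filter_upwards [h1.def hδ] with h hh _ _ _
    rw [Real.norm_of_nonneg (corrInt_nonneg _ _ _ _)] at hh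
    refine le_trans (le_of_eq ?_) ((le_abs_self _).trans hh)
    ring
  filter_upwards [hX.std, hD, hprod] with h h1 h2 h3
  have h4 := hbound h1 ν (M := fun j ↦ D j * corrInt (X h) P ν j)
    (B := ε / (S + 1) * corrInt (X h) P ν k)
    (fun j ↦ mul_nonneg (hD0 j) (corrInt_nonneg _ _ _ _))
    (mul_nonneg hδ.le (corrInt_nonneg _ _ _ _))
    (fun j hj hj2 ↦ h2 j (Finset.mem_range.2 (by omega)) hj)
    (fun i j hi hj hij hij2 ↦ h3 i (Finset.mem_range.2 (by omega)) j
      (Finset.mem_range.2 (by omega)) hi hj hij)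
  rw [Real.norm_of_nonneg (integral_nonneg fun _ ↦ sq_nonneg _),
    Real.norm_of_nonneg (sq_nonneg _)]
  refine h4.trans ?_
  have h5 : C * (ν.real Set.univ * (D k * corrInt (X h) P ν k) *
      (ε / (S + 1) * corrInt (X h) P ν k)) =
      S / (S + 1) * (ε * corrInt (X h) P ν k ^ 2) := by
    simp only [S]; field_simp
  rw [h5]
  refine mul_le_of_le_one_left (by positivity) ?_
  rw [div_le_one (by positivity)]; linarith

/-- Convergence in mean of the carré du champ for normalized coefficients. -/
lemma CorrelationGap.tendsto_integral_abs_carre_sub {k : ℕ} (hk : 1 ≤ k) (q : ℕ → ℝ)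
    (hq : ∀ m, m + 1 < k → q m = 0) (N : ℕ) {V : ι → ℝ} {e : ℝ} (he : 0 < e)
    (hV : ∀ᶠ h in l, e * corrInt (X h) P ν k ≤ V h) :
    Tendsto (fun h ↦ ∫ ω, |carre (X h) P ν (hermL (fun m ↦ q m / √(V h)) N)
        (derivative (hermQ (fun m ↦ q m / √(V h)) N)) ω -
        ∫ ω', carre (X h) P ν (hermL (fun m ↦ q m / √(V h)) N)
        (derivative (hermQ (fun m ↦ q m / √(V h)) N)) ω' ∂P| ∂P) l (𝓝 0) := by
  have hmain : Tendsto (fun h ↦ ∑ m ∈ Finset.range N, ∑ n ∈ Finset.range N,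
      |q m / √(V h) * (q n / √(V h) * (n + 1))| *
        √(∫ ω, (carre (X h) P ν (hermiteR m) (hermiteR n) ω -
        ∫ ω', carre (X h) P ν (hermiteR m) (hermiteR n) ω' ∂P) ^ 2 ∂P)) l (𝓝 0) := by
    rw [← Finset.sum_const_zero (s := Finset.range N)]
    refine tendsto_finsetSum _ fun m _ ↦ ?_
    rw [← Finset.sum_const_zero (s := Finset.range N)]
    refine tendsto_finsetSum _ fun n _ ↦ ?_
    -- Coefficients below the Hermite rank vanish, so only pairs of degrees at least `k` have to be
    -- estimated.
    rcases lt_or_ge (m + 1) k with h1 | h1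
    · simpa [hq m h1] using tendsto_const_nhds
    rcases lt_or_ge (n + 1) k with h2 | h2
    · simpa [hq n h2] using tendsto_const_nhds
    set W := fun h ↦ ∫ ω, (carre (X h) P ν (hermiteR m) (hermiteR n) ω -
        ∫ ω', carre (X h) P ν (hermiteR m) (hermiteR n) ω' ∂P) ^ 2 ∂P with hW
    have h3 : W =o[l] fun h ↦ corrInt (X h) P ν k ^ 2 :=
      hX.isLittleO_integral_sq_carre_sub hk h1 h2
    have h4 : Tendsto (fun h ↦ √(W h / corrInt (X h) P ν k ^ 2)) l (𝓝 0) := by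
      simpa using (h3.tendsto_div_nhds_zero).sqrt
    have h5 : Tendsto (fun h ↦ |q m * (q n * (n + 1))| / e *
        √(W h / corrInt (X h) P ν k ^ 2)) l (𝓝 0) := by
      simpa using h4.const_mul (|q m * (q n * (n + 1))| / e)
    refine squeeze_zero' (Eventually.of_forall fun h ↦ by positivity) ?_ h5
    filter_upwards [hV, hX.pos k] with h hVh hA
    have hVp : 0 < V h := lt_of_lt_of_le (by positivity) hVh
    rw [Real.sqrt_div' _ (sq_nonneg _), Real.sqrt_sq hA.le]
    -- The two normalizations by √V combine to 1/V, which is at most 1/(e A_k), matching the root of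
    -- the o(A_k²) variance.
    have e1 : q m / √(V h) * (q n / √(V h) * (n + 1)) = q m * (q n * (n + 1)) / V h := by
      have := Real.mul_self_sqrt hVp.le
      rw [div_mul_eq_mul_div, div_mul_eq_mul_div, ← mul_div_assoc, div_div, this]
    rw [e1, abs_div, abs_of_pos hVp]
    calc |q m * (q n * (n + 1))| / V h * √(W h)
        ≤ |q m * (q n * (n + 1))| / (e * corrInt (X h) P ν k) * √(W h) := by gcongr
      _ = _ := by field_simp
  refine squeeze_zero' (Eventually.of_forall fun h ↦ integral_nonneg fun _ ↦ abs_nonneg _) ?_ hmain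
  filter_upwards [hX.std] with h hh
  exact hh.integral_abs_carre_sub_le ν _ N

end CarreAsymptotics

/-! ### Mean, variance and Hermite remainder of the functional. -/

section Functional

open Polynomial

variable {Ω : Type*} [MeasurableSpace Ω] {P : Measure Ω} {f : ℝ → ℝ}

/-- The functional `∫ f (X x) dν(x)`. -/
noncomputable def funInt (X : ℝ → Ω → ℝ) (ν : Measure ℝ) (f : ℝ → ℝ) (ω : Ω) : ℝ :=
  ∫ x, f (X x ω) ∂ν

namespace ContStdGaussian

variable {X : ℝ → Ω → ℝ} (hX : ContStdGaussian X P) (ν : Measure ℝ) [IsFiniteMeasure ν]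
include hX

lemma memLp_comp_prod (hf : MemLp f 2 (gaussianReal 0 1)) :
    MemLp (fun p : Ω × ℝ ↦ f (X p.2 p.1)) 2 (P.prod ν) :=
  hX.toStdGaussian.memLp_prod hX.jmeas ν hf

lemma memLp_funInt (hf : MemLp f 2 (gaussianReal 0 1)) : MemLp (funInt X ν f) 2 P := by
  have := hX.isProb
  exact memLp_integral (Y := fun x ω ↦ f (X x ω)) (hX.memLp_comp_prod ν hf)

lemma ae_integrable_comp (hf : MemLp f 2 (gaussianReal 0 1)) :
    ∀ᵐ ω ∂P, Integrable (fun x ↦ f (X x ω)) ν := by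
  have := hX.isProb
  exact ae_integrable_of_memLp_prod (Y := fun x ω ↦ f (X x ω)) (hX.memLp_comp_prod ν hf)

/-- The second moment of the functional in terms of the Hermite coefficients. -/
lemma hasSum_integral_sq_funInt (hf : MemLp f 2 (gaussianReal 0 1)) :
    HasSum (fun n ↦ hCoef f n ^ 2 * n.factorial * ∫ z : ℝ × ℝ, cov2 X P z.1 z.2 ^ n ∂(ν.prod ν))
      (∫ ω, funInt X ν f ω ^ 2 ∂P) := by
  have := hX.isProb
  have hY := hX.memLp_comp_prod ν hf
  let g : ℝ × ℝ → ℝ := fun z ↦ ∫ ω, f (X z.1 ω) * f (X z.2 ω) ∂P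
  let F : ℕ → ℝ × ℝ → ℝ := fun n z ↦ hCoef f n ^ 2 * n.factorial * cov2 X P z.1 z.2 ^ n
  have hs : ∀ z, HasSum (fun n ↦ F n z) (g z) := fun z ↦ hX.hasSum_integral_mul hf z.1 z.2
  have hFc : ∀ n, Continuous (F n) := fun n ↦ (hX.cont.pow n).const_mul _
  have hFb : ∀ n z, ‖F n z‖ ≤ hCoef f n ^ 2 * n.factorial := fun n z ↦ by
    simp only [F]
    rw [norm_mul, Real.norm_of_nonneg (by positivity), norm_pow, Real.norm_eq_abs]
    exact mul_le_of_le_one_right (by positivity) (pow_le_one₀ (abs_nonneg _) (hX.abs_cov2_le _ _))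
  have hsum := (hasSum_sq_hCoef hf).summable
  have hgi : Integrable g (ν.prod ν) := by
    refine Integrable.of_bound (C := ∑' n, hCoef f n ^ 2 * n.factorial)
      (aestronglyMeasurable_of_tendsto_ae atTop
      (f := fun N z ↦ ∑ n ∈ Finset.range N, F n z)
      (fun N ↦ (continuous_finsetSum _ fun n _ ↦ hFc n).aestronglyMeasurable)
      (Eventually.of_forall fun z ↦ (hs z).tendsto_sum_nat)) (Eventually.of_forall fun z ↦ ?_)
    rw [← (hs z).tsum_eq]
    exact tsum_of_norm_bounded hsum.hasSum fun n ↦ hFb n z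
  have h1 : ∫ ω, funInt X ν f ω ^ 2 ∂P = ∫ z, g z ∂(ν.prod ν) := by
    rw [integral_prod_symm _ hgi]
    simp only [g, funInt, sq]
    exact integral_integral_mul_integral (Y := fun x ω ↦ f (X x ω)) (Z := fun x ω ↦ f (X x ω))
      hY hY (hX.memLp_comp hf)
  rw [h1]
  simp_rw [← integral_const_mul]
  exact hasSum_integral_of_dominated_convergence (fun n _ ↦ hCoef f n ^ 2 * n.factorial)
    (fun n ↦ (hFc n).aestronglyMeasurable) (fun n ↦ Eventually.of_forall (hFb n))
    (Eventually.of_forall fun _ ↦ hsum) (integrable_const _) (Eventually.of_forall hs)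

lemma integral_funInt (hf : MemLp f 2 (gaussianReal 0 1)) :
    ∫ ω, funInt X ν f ω ∂P = ν.real Set.univ * hCoef f 0 := by
  have := hX.isProb
  have h := integral_integral_eq (Y := fun x ω ↦ f (X x ω)) (hX.memLp_comp_prod ν hf)
  simp only [funInt]
  rw [h]
  simp_rw [hX.integral_comp_eq hf.aestronglyMeasurable]
  simp [hCoef_zero]

/-- The functional of the remainder of the Hermite expansion. -/
lemma funInt_sub_hSum_succ (hf : MemLp f 2 (gaussianReal 0 1)) (N : ℕ) :
    ∀ᵐ ω ∂P, funInt X ν (fun x ↦ f x - hSum f (N + 1) x) ω =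
      funInt X ν f ω - ν.real Set.univ * hCoef f 0 -
        addFun X ν (hermQ (fun m ↦ hCoef f (m + 1)) N) ω := by
  have := hX.isProb
  filter_upwards [hX.ae_integrable_comp ν hf,
    hX.ae_integrable_comp ν (allMoments_hSum f (N + 1)).memLp_two] with ω h1 h2
  rw [funInt, integral_sub h1 h2, sub_sub]
  congr 1
  have h3 : ∀ x, hSum f (N + 1) x =
      hCoef f 0 + (hermQ (fun m ↦ hCoef f (m + 1)) N).eval x := fun x ↦ by
    rw [hSum, Finset.sum_range_succ', eval_hermQ, He_zero, mul_one, add_comm]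
  simp_rw [h3] at h2 ⊢
  have h4 : Integrable (fun x ↦ (hermQ (fun m ↦ hCoef f (m + 1)) N).eval (X x ω)) ν := by
    refine (h2.sub (integrable_const (hCoef f 0))).congr (Eventually.of_forall fun x ↦ ?_)
    simp
  rw [integral_add (integrable_const _) h4]
  simp [addFun]

/-- The second moment of the remainder of the Hermite expansion. -/
lemma variance_funInt (hf : MemLp f 2 (gaussianReal 0 1)) :
    variance (funInt X ν f) P = ∫ ω, funInt X ν (fun x ↦ f x - hSum f 1 x) ω ^ 2 ∂P := by
  have := hX.isProb
  rw [variance_eq_integral (hX.memLp_funInt ν hf).aestronglyMeasurable.aemeasurable,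
    hX.integral_funInt ν hf]
  refine integral_congr_ae ?_
  filter_upwards [hX.funInt_sub_hSum_succ ν hf 0] with ω h
  have h0 : addFun X ν (hermQ (fun m ↦ hCoef f (m + 1)) 0) ω = 0 := by simp [addFun, hermQ]
  rw [h, h0, sub_zero]

end ContStdGaussian

/-- Even powers do not see the sign of the correlation, and odd degrees have coefficient zero. -/
lemma hCoef_mul_integral_cov2_pow (X : ℝ → Ω → ℝ) (P : Measure Ω) (ν : Measure ℝ)
    (hodd : ∀ n, Odd n → hCoef f n = 0) (n : ℕ) :
    hCoef f n ^ 2 * n.factorial * ∫ z : ℝ × ℝ, cov2 X P z.1 z.2 ^ n ∂(ν.prod ν) =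
      hCoef f n ^ 2 * n.factorial * corrInt X P ν n := by
  rcases Nat.even_or_odd n with h | h
  · simp only [corrInt, h.pow_abs]
  · simp [hodd n h]

namespace ContStdGaussian

variable {X : ℝ → Ω → ℝ} (hX : ContStdGaussian X P) (ν : Measure ℝ) [IsFiniteMeasure ν]
  (hf : MemLp f 2 (gaussianReal 0 1)) (hodd : ∀ n, Odd n → hCoef f n = 0)
include hX hf hodd

lemma hasSum_remainder (N : ℕ) :
    HasSum (fun n ↦ if n < N then 0 else hCoef f n ^ 2 * n.factorial * corrInt X P ν n)
      (∫ ω, funInt X ν (fun x ↦ f x - hSum f N x) ω ^ 2 ∂P) := by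
  refine (hX.hasSum_integral_sq_funInt ν (hf.sub (allMoments_hSum f N).memLp_two)).congr_fun
    fun n ↦ ?_
  have e : hCoef (f - hSum f N) n = if n < N then 0 else hCoef f n := hCoef_sub_hSum hf N n
  rw [e]
  split_ifs
  · simp
  · exact (hCoef_mul_integral_cov2_pow X P ν hodd n).symm

/-- Every surviving degree is at least `k`, and `|cov2| ≤ 1` makes the power integrals decreasing in
the degree; Parseval sums the coefficients. The first factor does not involve the process, which
makes truncation uniform in h. -/
lemma remainder_le {k N : ℕ} (hkN : k ≤ N) :
    ∫ ω, funInt X ν (fun x ↦ f x - hSum f N x) ω ^ 2 ∂P ≤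
      (∫ x, (f x - hSum f N x) ^ 2 ∂gaussianReal 0 1) * corrInt X P ν k := by
  have h1 := (hasSum_sq_hCoef (hf.sub (allMoments_hSum f N).memLp_two)).mul_right
    (corrInt X P ν k)
  refine hasSum_le (fun n ↦ ?_) (hX.hasSum_remainder ν hf hodd N) h1
  have e : hCoef (f - hSum f N) n = if n < N then 0 else hCoef f n := hCoef_sub_hSum hf N n
  rw [e]
  split_ifs with h
  · simp
  · exact mul_le_mul_of_nonneg_left (hX.corrInt_anti (by omega)) (by positivity)

/-- All terms of the variance series are nonnegative, so a single one is a lower bound. -/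
lemma le_variance {k : ℕ} (hk : 1 ≤ k) :
    hCoef f k ^ 2 * k.factorial * corrInt X P ν k ≤
      ∫ ω, funInt X ν (fun x ↦ f x - hSum f 1 x) ω ^ 2 ∂P := by
  have h0 : ∀ n, n ≠ k → (0 : ℝ) ≤
      if n < 1 then 0 else hCoef f n ^ 2 * n.factorial * corrInt X P ν n := fun n _ ↦ by
    split_ifs
    · exact le_rfl
    · exact mul_nonneg (by positivity) (corrInt_nonneg _ _ _ _)
  have hS := hX.hasSum_remainder ν hf hodd 1
  have h := le_hasSum hS k h0
  rwa [if_neg (by omega)] at h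

lemma variance_eq_sum_add (N : ℕ) :
    ∫ ω, funInt X ν (fun x ↦ f x - hSum f 1 x) ω ^ 2 ∂P =
      ∑ m ∈ Finset.range N, hCoef f (m + 1) ^ 2 * (m + 1).factorial * corrInt X P ν (m + 1) +
        ∫ ω, funInt X ν (fun x ↦ f x - hSum f (N + 1) x) ω ^ 2 ∂P := by
  have h1 := (hX.hasSum_remainder ν hf hodd 1).sub (hX.hasSum_remainder ν hf hodd (N + 1))
  have h2 := hasSum_sum_of_ne_finset_zero (L := .unconditional ℕ) (s := Finset.range (N + 1))
    (f := fun n ↦ (if n < 1 then 0 else hCoef f n ^ 2 * n.factorial * corrInt X P ν n) -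
      (if n < N + 1 then 0 else hCoef f n ^ 2 * n.factorial * corrInt X P ν n)) fun n hn ↦ by
    rw [Finset.mem_range, not_lt] at hn
    rw [if_neg (by omega), if_neg (by omega), sub_self]
  rw [← sub_eq_iff_eq_add, h1.unique h2, Finset.sum_range_succ']
  simp only [Nat.lt_one_iff, Nat.add_eq_zero_iff, one_ne_zero, and_false, if_false, if_true,
    Nat.zero_lt_succ, sub_self, add_zero]
  refine Finset.sum_congr rfl fun m hm ↦ ?_
  rw [Finset.mem_range] at hm
  rw [if_pos (by omega), sub_zero]

end ContStdGaussian

end Functional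

/-! ### Convergence of characteristic functions. -/

section CentralLimit

open Polynomial

variable {Ω : Type*} [MeasurableSpace Ω] {P : Measure Ω} {f : ℝ → ℝ} {ν : Measure ℝ}
  [IsFiniteMeasure ν]

lemma abs_exp_neg_sub_le {x y : ℝ} (hx : 0 ≤ x) (hxy : x ≤ y) :
    |Real.exp (-x) - Real.exp (-y)| ≤ y - x := by
  have h1 : Real.exp (-y) = Real.exp (-x) * Real.exp (-(y - x)) := by
    rw [← Real.exp_add]; congr 1; ring
  have h2 : 1 - (y - x) ≤ Real.exp (-(y - x)) := by
    have := Real.add_one_le_exp (-(y - x)); linarith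
  have h3 : Real.exp (-(y - x)) ≤ 1 := Real.exp_le_one_iff.2 (by linarith)
  have h4 : Real.exp (-x) ≤ 1 := Real.exp_le_one_iff.2 (by linarith)
  have h5 := Real.exp_pos (-x)
  rw [h1, abs_of_nonneg (by nlinarith)]
  nlinarith

/-- The distance of the characteristic function of the normalized functional to the standard normal
one, in terms of a truncation of the Hermite expansion. -/
lemma ContStdGaussian.norm_charFun_funInt_sub_le {X : ℝ → Ω → ℝ} (hX : ContStdGaussian X P)
    (hf : MemLp f 2 (gaussianReal 0 1)) (hodd : ∀ n, Odd n → hCoef f n = 0) {N : ℕ} {V δ : ℝ}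
    (hV : V = ∫ ω, funInt X ν (fun x ↦ f x - hSum f 1 x) ω ^ 2 ∂P) (hV0 : 0 < V)
    (hδ : ∫ ω, funInt X ν (fun x ↦ f x - hSum f (N + 1) x) ω ^ 2 ∂P ≤ δ * V) (t : ℝ) :
    ‖∫ ω, Complex.exp ((t * ((funInt X ν f ω - ν.real Set.univ * hCoef f 0) / √V) : ℝ) *
        Complex.I) ∂P - Complex.exp (-(t ^ 2 / 2 : ℝ))‖ ≤
      |t| * √δ + t ^ 2 / 2 * δ + t ^ 2 *
      ∫ ω, |carre X P ν (hermL (fun m ↦ hCoef f (m + 1) / √V) N)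
        (derivative (hermQ (fun m ↦ hCoef f (m + 1) / √V) N)) ω -
        ∫ ω', carre X P ν (hermL (fun m ↦ hCoef f (m + 1) / √V) N)
        (derivative (hermQ (fun m ↦ hCoef f (m + 1) / √V) N)) ω' ∂P| ∂P := by
  have := hX.isProb
  set c : ℕ → ℝ := fun m ↦ hCoef f (m + 1) / √V with hc
  set s := ∫ ω', carre X P ν (hermL c N) (derivative (hermQ c N)) ω' ∂P with hs
  set T := ∫ ω, funInt X ν (fun x ↦ f x - hSum f (N + 1) x) ω ^ 2 ∂P with hT
  have hT0 : 0 ≤ T := integral_nonneg fun _ ↦ sq_nonneg _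
  have hsq : √V ≠ 0 := (Real.sqrt_pos.2 hV0).ne'
  -- The mean carré du champ is the retained share of the variance; the deficit from 1 is the
  -- truncated share.
  have hs1 : s = 1 - T / V := by
    have h1 : s = (∑ m ∈ Finset.range N, hCoef f (m + 1) ^ 2 * (m + 1).factorial *
        corrInt X P ν (m + 1)) / V := by
      rw [hs, hX.integral_carre_herm ν, Finset.sum_div]
      refine Finset.sum_congr rfl fun m _ ↦ ?_
      rw [← hCoef_mul_integral_cov2_pow X P ν hodd, hc, div_pow, Real.sq_sqrt hV0.le]
      ring
    have h2 := hX.variance_eq_sum_add ν hf hodd N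
    rw [← hV] at h2
    rw [h1, eq_sub_iff_add_eq, ← add_div, ← h2, div_self hV0.ne']
  have hTV : T / V ≤ δ := (div_le_iff₀ hV0).2 hδ
  have hTV0 : 0 ≤ T / V := by positivity
  have hs0 : 0 ≤ s := by
    rw [hs, hX.integral_carre_herm ν]
    refine Finset.sum_nonneg fun m _ ↦ ?_
    have h1 := hCoef_mul_integral_cov2_pow X P ν hodd (m + 1)
    have h2 : c m ^ 2 * (m + 1).factorial * ∫ z : ℝ × ℝ, cov2 X P z.1 z.2 ^ (m + 1) ∂(ν.prod ν) =
        hCoef f (m + 1) ^ 2 * (m + 1).factorial * corrInt X P ν (m + 1) / V := by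
      rw [← h1, hc, div_pow, Real.sq_sqrt hV0.le]; ring
    rw [h2]
    have := corrInt_nonneg X P ν (m + 1)
    positivity
  let Z : Ω → ℝ := fun ω ↦ (funInt X ν f ω - ν.real Set.univ * hCoef f 0) / √V
  let Y : Ω → ℝ := addFun X ν (hermQ c N)
  have hZm : MemLp Z 2 P := by
    have := ((hX.memLp_funInt ν hf).sub (memLp_const (ν.real Set.univ * hCoef f 0))).const_mul
      (√V)⁻¹
    refine this.ae_eq (Eventually.of_forall fun ω ↦ ?_)
    simp [Z, div_eq_inv_mul]
  have hYm : MemLp Y 2 P := hX.memLp_addFun ν _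
  have hYe : ∀ ω, Y ω = (√V)⁻¹ * addFun X ν (hermQ (fun m ↦ hCoef f (m + 1)) N) ω := fun ω ↦ by
    simp only [Y, addFun, ← integral_const_mul, eval_hermQ, Finset.mul_sum, hc]
    congr 1; funext x
    exact Finset.sum_congr rfl fun m _ ↦ by ring
  have hZY : ∫ ω, |Z ω - Y ω| ∂P ≤ √δ := by
    refine (integral_abs_le_sqrt (hZm.sub hYm)).trans (Real.sqrt_le_sqrt (le_trans ?_ hTV))
    have h1 : T / V = ∫ ω, V⁻¹ * funInt X ν (fun x ↦ f x - hSum f (N + 1) x) ω ^ 2 ∂P := by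
      rw [integral_const_mul, hT, div_eq_inv_mul]
    rw [h1]
    refine le_of_eq (integral_congr_ae ?_)
    filter_upwards [hX.funInt_sub_hSum_succ ν hf N] with ω h
    simp only [Pi.sub_apply]
    rw [h, hYe]
    simp only [Z]
    rw [div_eq_inv_mul, ← mul_sub, mul_pow, inv_pow, Real.sq_sqrt hV0.le]
  have hme : ∀ {W : Ω → ℝ}, MemLp W 2 P →
      Integrable (fun ω ↦ Complex.exp ((t * W ω : ℝ) * Complex.I)) P := fun {W} hW ↦ by
    refine Integrable.of_bound (C := 1) ?_ (Eventually.of_forall fun ω ↦ ?_)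
    · exact (Complex.continuous_exp.comp (by fun_prop :
        Continuous fun x : ℝ ↦ ((t * x : ℝ) : ℂ) * Complex.I)).comp_aestronglyMeasurable
        hW.aestronglyMeasurable
    · rw [Complex.norm_exp_ofReal_mul_I]
  have hφ : ‖∫ ω, Complex.exp ((t * Z ω : ℝ) * Complex.I) ∂P -
      ∫ ω, Complex.exp ((t * Y ω : ℝ) * Complex.I) ∂P‖ ≤ |t| * √δ := by
    rw [← integral_sub (hme hZm) (hme hYm)]
    refine (norm_integral_le_integral_norm _).trans ?_
    have h2 : Integrable (fun ω ↦ |t| * |Z ω - Y ω|) P :=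
      (((hZm.sub hYm).integrable (by norm_num)).abs).const_mul _
    refine (integral_mono_of_nonneg (Eventually.of_forall fun _ ↦ norm_nonneg _) h2
      (Eventually.of_forall fun ω ↦ ?_)).trans ?_
    · refine (norm_cexp_sub_le _ _).trans (le_of_eq ?_)
      rw [← mul_sub, abs_mul]
    · rw [integral_const_mul]
      exact mul_le_mul_of_nonneg_left hZY (abs_nonneg _)
  have hst := hX.norm_charFun_addFun_sub_le ν c N hs0 t
  have he : ‖Complex.exp (-(s * t ^ 2 / 2 : ℝ)) - Complex.exp (-(t ^ 2 / 2 : ℝ))‖ ≤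
      t ^ 2 / 2 * δ := by
    rw [← Complex.ofReal_neg, ← Complex.ofReal_neg, ← Complex.ofReal_exp, ← Complex.ofReal_exp,
      ← Complex.ofReal_sub, Complex.norm_real, Real.norm_eq_abs]
    refine (abs_exp_neg_sub_le (by positivity) ?_).trans ?_
    · rw [hs1]; nlinarith [sq_nonneg t]
    · rw [hs1]; nlinarith [sq_nonneg t]
  -- Three errors: truncating the Hermite series, Stein's bound for the truncated sum, and replacing
  -- its variance `s` by 1.
  calc _ = ‖(∫ ω, Complex.exp ((t * Z ω : ℝ) * Complex.I) ∂P -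
      ∫ ω, Complex.exp ((t * Y ω : ℝ) * Complex.I) ∂P) +
      (∫ ω, Complex.exp ((t * Y ω : ℝ) * Complex.I) ∂P - Complex.exp (-(s * t ^ 2 / 2 : ℝ))) +
      (Complex.exp (-(s * t ^ 2 / 2 : ℝ)) - Complex.exp (-(t ^ 2 / 2 : ℝ)))‖ := by
        congr 1; ring
    _ ≤ _ := by
        refine (norm_add₃_le).trans ?_
        linarith

/-- Convergence of the characteristic functions of the normalized functionals. -/
theorem CorrelationGap.tendsto_charFun_funInt {ι : Type*} {l : Filter ι} {X : ι → ℝ → Ω → ℝ}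
    (hX : CorrelationGap l X P ν) (hf : MemLp f 2 (gaussianReal 0 1))
    (hodd : ∀ n, Odd n → hCoef f n = 0) (hne : ∃ n, 1 ≤ n ∧ hCoef f n ≠ 0) (t : ℝ) :
    Tendsto (fun h ↦ ∫ ω, Complex.exp ((t * ((funInt (X h) ν f ω - ν.real Set.univ * hCoef f 0) /
        √(variance (funInt (X h) ν f) P)) : ℝ) * Complex.I) ∂P) l
      (𝓝 (Complex.exp (-(t ^ 2 / 2 : ℝ)))) := by
  classical
  -- The Hermite rank of `f`, not counting degree zero.
  set k := Nat.find hne with hkdef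
  obtain ⟨hk, hck⟩ : 1 ≤ k ∧ hCoef f k ≠ 0 := Nat.find_spec hne
  have hlt : ∀ m, m + 1 < k → hCoef f (m + 1) = 0 := fun m hm ↦ by
    have := Nat.find_min hne hm
    simpa using this
  set e := hCoef f k ^ 2 * k.factorial with he_def
  have he : 0 < e := by positivity
  let V : ι → ℝ := fun h ↦ variance (funInt (X h) ν f) P
  have hV : ∀ᶠ h in l, V h = ∫ ω, funInt (X h) ν (fun x ↦ f x - hSum f 1 x) ω ^ 2 ∂P :=
    hX.std.mono fun h hh ↦ hh.variance_funInt ν hf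
  have hVe : ∀ᶠ h in l, e * corrInt (X h) P ν k ≤ V h := by
    filter_upwards [hX.std, hV] with h hh hVh
    rw [hVh]; exact hh.le_variance ν hf hodd hk
  rw [Metric.tendsto_nhds]
  intro ε hε
  let τ : ℕ → ℝ := fun N ↦ ∫ x, (f x - hSum f N x) ^ 2 ∂gaussianReal 0 1
  have hτ : Tendsto τ atTop (𝓝 0) := by
    refine (tendsto_hSum hf).congr fun N ↦ ?_
    congr 1; funext x; ring
  have hτ2 : Tendsto (fun N ↦ |t| * √(τ N / e) + t ^ 2 / 2 * (τ N / e)) atTop (𝓝 0) := by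
    have h1 : Tendsto (fun N ↦ τ N / e) atTop (𝓝 0) := by simpa using hτ.div_const e
    simpa using (h1.sqrt.const_mul |t|).add (h1.const_mul (t ^ 2 / 2))
  -- The truncation level is fixed before h: the truncation errors are below ε/2 for all small h,
  -- and the Stein error for this fixed `N` then drops below ε/2. The shift matches `hSum f (N + 1)`
  -- with the sum of `N` terms in positive degree.
  obtain ⟨N, hN, hkN⟩ := (((tendsto_add_atTop_nat 1).eventually
    (hτ2.eventually (gt_mem_nhds (half_pos hε)))).and (eventually_ge_atTop k)).exists
  have hδ := (hX.tendsto_integral_abs_carre_sub hk (fun m ↦ hCoef f (m + 1)) hlt N he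
    hVe).const_mul (t ^ 2)
  rw [mul_zero] at hδ
  filter_upwards [hX.std, hV, hVe, hX.pos k, hδ.eventually (gt_mem_nhds (half_pos hε))]
    with h h1 h2 h3 h4 h5
  have hV0 : 0 < V h := lt_of_lt_of_le (by positivity) h3
  have h6 : ∫ ω, funInt (X h) ν (fun x ↦ f x - hSum f (N + 1) x) ω ^ 2 ∂P ≤
      τ (N + 1) / e * V h := by
    have hτ0 : 0 ≤ τ (N + 1) := integral_nonneg fun _ ↦ sq_nonneg _
    calc _ ≤ τ (N + 1) * corrInt (X h) P ν k := h1.remainder_le ν hf hodd (by omega)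
      _ = τ (N + 1) / e * (e * corrInt (X h) P ν k) := by field_simp
      _ ≤ _ := by gcongr
  have h7 := h1.norm_charFun_funInt_sub_le (N := N) hf hodd h2 hV0 h6 t
  rw [dist_eq_norm]
  refine h7.trans_lt ?_
  linarith

end CentralLimit

/-! ### Continuity of translations in L¹. -/

section Translation

open DomAddAct

/-- Continuity of translations for bounded measurable functions, in mean over a bounded interval. -/
lemma tendsto_integral_norm_translate_sub {g : ℝ → ℂ} (hg : Measurable g) {C : ℝ}
    (hC : ∀ x, ‖g x‖ ≤ C) :
    Tendsto (fun h ↦ ∫ x in Set.Icc (0 : ℝ) 1, ‖g (x + h) - g x‖) (𝓝 0) (𝓝 0) := by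
  have : Fact ((1 : ENNReal) ≠ ⊤) := ⟨ENNReal.one_ne_top⟩
  -- The window contains every translate of [0, 1] by at most 1, so cutting off changes nothing
  -- there and puts the function in L¹.
  let u : ℝ → ℂ := (Set.Icc (-1 : ℝ) 2).indicator g
  have hu : MemLp u 1 := by
    rw [memLp_indicator_iff_restrict measurableSet_Icc]
    exact MemLp.of_bound hg.aestronglyMeasurable C (Eventually.of_forall hC)
  have hc : Continuous fun h : ℝ ↦ ‖(DomAddAct.mk h +ᵥ hu.toLp u) - hu.toLp u‖ := by
    have h1 : Continuous fun h : ℝ ↦ (DomAddAct.mk h +ᵥ hu.toLp u) :=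
      (continuous_vadd.comp (Continuous.prodMk DomAddAct.continuous_mk continuous_const))
    exact (h1.sub continuous_const).norm
  have h0 := hc.tendsto 0
  have hz : ‖(DomAddAct.mk (0 : ℝ) +ᵥ hu.toLp u) - hu.toLp u‖ = 0 := by
    rw [show (DomAddAct.mk (0 : ℝ) +ᵥ hu.toLp u) = hu.toLp u by simp, sub_self, norm_zero]
  rw [hz] at h0
  refine squeeze_zero' (Eventually.of_forall fun h ↦ integral_nonneg fun _ ↦ norm_nonneg _) ?_ h0
  filter_upwards [Icc_mem_nhds (show (-1 : ℝ) < 0 by norm_num) (show (0 : ℝ) < 1 by norm_num)]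
    with h hh
  have hu2 : MemLp (fun x ↦ u (h + x)) 1 :=
    hu.comp_measurePreserving (measurePreserving_add_left volume h)
  have e : ‖(DomAddAct.mk h +ᵥ hu.toLp u) - hu.toLp u‖ = ∫ x, ‖u (h + x) - u x‖ := by
    rw [mk_vadd_toLp, ← MemLp.toLp_sub, Lp.norm_toLp, eLpNorm_one_eq_lintegral_enorm]
    exact (integral_norm_eq_lintegral_enorm (hu2.sub hu).aestronglyMeasurable).symm
  rw [e]
  have hi : Integrable fun x ↦ ‖u (h + x) - u x‖ :=
    (memLp_one_iff_integrable.1 (hu2.sub hu)).norm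
  refine le_trans (le_of_eq ?_)
    (setIntegral_le_integral (s := Set.Icc (0 : ℝ) 1) hi (Eventually.of_forall fun _ ↦ norm_nonneg _))
  refine setIntegral_congr_fun measurableSet_Icc fun x hx ↦ ?_
  have m1 : x ∈ Set.Icc (-1 : ℝ) 2 := ⟨by linarith [hx.1], by linarith [hx.2]⟩
  have m2 : h + x ∈ Set.Icc (-1 : ℝ) 2 :=
    ⟨by linarith [hx.1, hh.1], by linarith [hx.2, hh.2]⟩
  simp only [u, Set.indicator_of_mem m1, Set.indicator_of_mem m2]
  rw [add_comm]

end Translation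

/-! ### Mean-square continuity and the normalized increment process. -/

section IncrementProcess

variable {Ω : Type*} [MeasurableSpace Ω] {P : Measure Ω} {G : ℝ → Ω → ℝ}

lemma cov2_normInc (h x y : ℝ) (hpos : 0 ≤ incVar G P h) :
    cov2 (normInc G P h) P x y = rho G P h x y := by
  simp only [cov2, normInc, rho]
  rw [← integral_div]
  congr 1; funext ω
  rw [div_mul_div_comm, Real.mul_self_sqrt hpos]

/-- A jointly measurable centred Gaussian process with stationary increments. -/
structure StationaryGaussian (G : ℝ → Ω → ℝ) (P : Measure Ω) : Prop where
  meas : Measurable (Function.uncurry G)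
  gauss : IsGaussianProcess G P
  mean : ∀ x, ∫ ω, G x ω ∂P = 0
  stat : HasStationaryIncrements G P

namespace StationaryGaussian

variable (hG : StationaryGaussian G P)
include hG

lemma isProb : IsProbabilityMeasure P := hG.gauss.isProbabilityMeasure

lemma measurable_apply (x : ℝ) : Measurable (G x) :=
  hG.meas.comp (measurable_const.prodMk measurable_id)

lemma memLp (x : ℝ) : MemLp (G x) 2 P := (hG.gauss.hasGaussianLaw_eval x).memLp_two

lemma integral_sq_sub (x y : ℝ) : ∫ ω, (G x ω - G y ω) ^ 2 ∂P = incVar G P (x - y) := by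
  have h := hG.stat y {x - y}
  have h2 := h.comp (u := fun v : ({x - y} : Finset ℝ) → ℝ ↦ v ⟨x - y, by simp⟩ ^ 2)
    ((measurable_pi_apply _).pow_const 2)
  have h3 := h2.integral_eq
  simp only [Function.comp_def, add_sub_cancel] at h3
  exact h3

/-- The value of the process in `L²`. -/
noncomputable def toL2 (x : ℝ) : Lp ℝ 2 P := (hG.memLp x).toLp (G x)

lemma norm_toL2_sub_sq (x y : ℝ) : ‖hG.toL2 x - hG.toL2 y‖ ^ 2 = incVar G P (x - y) := by
  rw [toL2, toL2, ← MemLp.toLp_sub, norm_toLp_sq, ← hG.integral_sq_sub]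
  rfl

lemma integral_cexp (x y : ℝ) : ∫ ω, Complex.exp ((G x ω - G y ω : ℝ) * Complex.I) ∂P =
    (Real.exp (-(incVar G P (x - y) / 2)) : ℝ) := by
  have := hG.isProb
  have h1 : HasGaussianLaw (fun ω ↦ G x ω - G y ω) P := hG.gauss.hasGaussianLaw_fun_sub
  have hi : ∀ z, Integrable (G z) P := fun z ↦ (hG.memLp z).integrable (by norm_num)
  have hm : ∫ ω, (G x ω - G y ω) ∂P = 0 := by
    rw [integral_sub (hi x) (hi y), hG.mean, hG.mean, sub_zero]
  have hv : variance (fun ω ↦ G x ω - G y ω) P = incVar G P (x - y) := by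
    rw [variance_of_integral_eq_zero h1.aemeasurable hm, ← hG.integral_sq_sub]
  have h2 := h1.charFun_map_eq 1
  rw [charFun_apply_real, integral_map h1.aemeasurable
    (by fun_prop : Continuous fun x : ℝ ↦ Complex.exp (((1 : ℝ) : ℂ) * x *
      Complex.I)).aestronglyMeasurable] at h2
  have h3 : ∀ ω, inner ℝ (1 : ℝ) (G x ω - G y ω) = G x ω - G y ω := fun ω ↦ by simp
  simp only [h3, hm, hv] at h2
  simp only [Complex.ofReal_one, one_mul] at h2
  rw [h2]
  simp

/-- A jointly measurable Gaussian process with stationary increments is continuous in mean square. -/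
theorem tendsto_incVar : Tendsto (incVar G P) (𝓝 0) (𝓝 0) := by
  have := hG.isProb
  -- Paths are only measurable; passing to exp(iG) makes them bounded, so translation continuity
  -- applies path by path.
  let g : Ω → ℝ → ℂ := fun ω x ↦ Complex.exp ((G x ω : ℝ) * Complex.I)
  have hgm : Measurable fun p : ℝ × Ω ↦ g p.2 p.1 :=
    Complex.measurable_exp.comp ((Complex.measurable_ofReal.comp hG.meas).mul_const _)
  have hg1 : ∀ ω x, ‖g ω x‖ = 1 := fun ω x ↦ Complex.norm_exp_ofReal_mul_I _
  let Φ : ℝ → Ω → ℝ := fun h ω ↦ ∫ x in Set.Icc (0 : ℝ) 1, ‖g ω (x + h) - g ω x‖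
  have hdm : ∀ h, StronglyMeasurable fun p : Ω × ℝ ↦ ‖g p.1 (p.2 + h) - g p.1 p.2‖ := fun h ↦
    (((hgm.comp ((measurable_snd.add_const h).prodMk measurable_fst)).sub
      (hgm.comp (measurable_snd.prodMk measurable_fst))).norm).stronglyMeasurable
  have hd2 : ∀ h ω x, ‖g ω (x + h) - g ω x‖ ≤ 2 := fun h ω x ↦ by
    refine (norm_sub_le _ _).trans ?_
    rw [hg1, hg1]; norm_num
  have hΦ : Tendsto (fun h ↦ ∫ ω, Φ h ω ∂P) (𝓝 0) (𝓝 0) := by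
    suffices h : Tendsto (fun h ↦ ∫ ω, Φ h ω ∂P) (𝓝 0) (𝓝 (∫ _, (0 : ℝ) ∂P)) by
      rwa [integral_zero] at h
    refine tendsto_integral_filter_of_dominated_convergence (fun _ ↦ 2) ?_ ?_
      (integrable_const _) ?_
    · exact Eventually.of_forall fun h ↦ (hdm h).integral_prod_right'.aestronglyMeasurable
    · refine Eventually.of_forall fun h ↦ Eventually.of_forall fun ω ↦ ?_
      have := norm_setIntegral_le_of_norm_le_const (μ := volume) (s := Set.Icc (0 : ℝ) 1) (C := 2)
        (f := fun x ↦ ‖g ω (x + h) - g ω x‖) (by simp) fun x _ ↦ by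
          rw [norm_norm]; exact hd2 h ω x
      simpa using this
    · exact Eventually.of_forall fun ω ↦ tendsto_integral_norm_translate_sub
        (hgm.comp (measurable_id.prodMk measurable_const)) fun x ↦ (hg1 ω x).le
  -- By stationarity the mean of exp(i(G(x+h) - G(x))) is exp(-σ²(h)/2) for every `x`, and the mean
  -- modulus of the difference dominates the modulus of its mean.
  have hlow : ∀ h, 1 - Real.exp (-(incVar G P h / 2)) ≤ ∫ ω, Φ h ω ∂P := by
    intro h
    have hint : Integrable (fun p : Ω × ℝ ↦ ‖g p.1 (p.2 + h) - g p.1 p.2‖)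
        (P.prod (volume.restrict (Set.Icc (0 : ℝ) 1))) :=
      Integrable.of_bound (hdm h).aestronglyMeasurable 2 (Eventually.of_forall fun p ↦ by
        rw [norm_norm]; exact hd2 h p.1 p.2)
    have e1 : ∫ ω, Φ h ω ∂P =
        ∫ x in Set.Icc (0 : ℝ) 1, ∫ ω, ‖g ω (x + h) - g ω x‖ ∂P :=
      integral_integral_swap (f := fun ω x ↦ ‖g ω (x + h) - g ω x‖) hint
    have e2 : ∀ x, 1 - Real.exp (-(incVar G P h / 2)) ≤ ∫ ω, ‖g ω (x + h) - g ω x‖ ∂P := by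
      intro x
      have hb : ∀ ω, ‖1 - Complex.exp ((G (x + h) ω - G x ω : ℝ) * Complex.I)‖ =
          ‖g ω (x + h) - g ω x‖ := fun ω ↦ by
        have : g ω (x + h) - g ω x =
            -(g ω x * (1 - Complex.exp ((G (x + h) ω - G x ω : ℝ) * Complex.I))) := by
          simp only [g]
          rw [mul_sub, ← Complex.exp_add, mul_one]
          push_cast
          ring_nf
        rw [this, norm_neg, norm_mul, hg1, one_mul]
      have hci : Integrable (fun ω ↦ Complex.exp ((G (x + h) ω - G x ω : ℝ) * Complex.I)) P := by
        refine Integrable.of_bound (C := 1) ?_ (Eventually.of_forall fun ω ↦ ?_)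
        · have := ((hG.measurable_apply (x + h)).sub (hG.measurable_apply x)).complex_ofReal
          exact (Complex.measurable_exp.comp (this.mul_const _)).aestronglyMeasurable
        · rw [Complex.norm_exp_ofReal_mul_I]
      have e3 : ∫ ω, (1 - Complex.exp ((G (x + h) ω - G x ω : ℝ) * Complex.I)) ∂P =
          ((1 - Real.exp (-(incVar G P h / 2)) : ℝ) : ℂ) := by
        rw [integral_sub (integrable_const _) hci, hG.integral_cexp]
        simp
      have e4 := norm_integral_le_integral_norm
        (fun ω ↦ 1 - Complex.exp ((G (x + h) ω - G x ω : ℝ) * Complex.I)) (μ := P)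
      rw [e3, Complex.norm_real] at e4
      simp only [hb] at e4
      exact (le_abs_self _).trans e4
    rw [e1]
    have e5 := setIntegral_mono_on (μ := volume) (s := Set.Icc (0 : ℝ) 1)
      (f := fun _ ↦ 1 - Real.exp (-(incVar G P h / 2)))
      (g := fun x ↦ ∫ ω, ‖g ω (x + h) - g ω x‖ ∂P) (by simp) hint.integral_prod_right
      measurableSet_Icc fun x _ ↦ e2 x
    simpa using e5
  have hexp : Tendsto (fun h ↦ Real.exp (-(incVar G P h / 2))) (𝓝 0) (𝓝 1) := by
    refine tendsto_of_tendsto_of_tendsto_of_le_of_le (g := fun h ↦ 1 - ∫ ω, Φ h ω ∂P)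
      (h := fun _ ↦ 1) (by simpa using hΦ.const_sub 1) tendsto_const_nhds
      (fun h ↦ by linarith [hlow h]) fun h ↦ Real.exp_le_one_iff.2 ?_
    have : 0 ≤ incVar G P h := integral_nonneg fun _ ↦ sq_nonneg _
    linarith
  have hlog := (hexp.log one_ne_zero).const_mul (-2)
  simp only [Real.log_exp, Real.log_one, mul_zero] at hlog
  refine hlog.congr fun h ↦ by ring

lemma continuous_toL2 : Continuous hG.toL2 := by
  rw [continuous_iff_continuousAt]
  intro x
  rw [ContinuousAt, tendsto_iff_norm_sub_tendsto_zero]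
  have h1 : Tendsto (fun y ↦ incVar G P (y - x)) (𝓝 x) (𝓝 0) := by
    refine hG.tendsto_incVar.comp ?_
    have : Tendsto (fun y : ℝ ↦ y - x) (𝓝 x) (𝓝 (x - x)) := tendsto_id.sub_const x
    rwa [sub_self] at this
  have h2 := h1.sqrt
  rw [Real.sqrt_zero] at h2
  refine h2.congr fun y ↦ ?_
  rw [← hG.norm_toL2_sub_sq, Real.sqrt_sq (norm_nonneg _)]

/-- If σ²(h) = 0, the L²-valued process has period `h`, so its value at `h₀` is attained in [0, h).
For small `h`, continuity at 0 keeps it strictly closer to the value at 0 than it is, a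
contradiction. -/
lemma eventually_incVar_pos (hne : ∃ h, incVar G P h ≠ 0) :
    ∀ᶠ h in 𝓝[>] (0 : ℝ), 0 < incVar G P h := by
  obtain ⟨h₀, hh₀⟩ := hne
  have hpos : 0 < ‖hG.toL2 h₀ - hG.toL2 0‖ := by
    refine (norm_nonneg _).lt_of_ne fun h ↦ hh₀ ?_
    have := hG.norm_toL2_sub_sq h₀ 0
    rw [sub_zero] at this
    rw [← this, ← h]; simp
  have hc := hG.continuous_toL2.tendsto 0
  rw [tendsto_iff_norm_sub_tendsto_zero] at hc
  obtain ⟨δ, hδ, hball⟩ := Metric.eventually_nhds_iff.1 (hc.eventually (gt_mem_nhds hpos))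
  filter_upwards [Ioo_mem_nhdsGT hδ] with h hh
  have h0 : 0 ≤ incVar G P h := integral_nonneg fun _ ↦ sq_nonneg _
  refine h0.lt_of_ne fun hz ↦ ?_
  have hper : Function.Periodic hG.toL2 h := fun x ↦ by
    have := hG.norm_toL2_sub_sq (x + h) x
    rw [add_sub_cancel_left, ← hz] at this
    exact sub_eq_zero.1 (norm_eq_zero.1 (pow_eq_zero_iff (two_ne_zero) |>.1 this))
  obtain ⟨r, hr, hr2⟩ := hper.exists_mem_Ico₀ hh.1 h₀
  have h3 : dist r 0 < δ := by
    rw [Real.dist_0_eq_abs, abs_of_nonneg hr.1]; exact hr.2.trans hh.2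
  have h4 := hball h3
  rw [← hr2] at h4
  exact lt_irrefl _ h4

lemma integral_mul_increments (x y x' y' : ℝ) :
    ∫ ω, (G x ω - G y ω) * (G x' ω - G y' ω) ∂P =
      inner ℝ (hG.toL2 x - hG.toL2 y) (hG.toL2 x' - hG.toL2 y') := by
  rw [toL2, toL2, toL2, toL2, ← MemLp.toLp_sub, ← MemLp.toLp_sub, inner_toLp_eq]
  rfl

lemma continuous_rho (h : ℝ) : Continuous fun p : ℝ × ℝ ↦ rho G P h p.1 p.2 := by
  have hc := hG.continuous_toL2
  simp only [rho, hG.integral_mul_increments]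
  fun_prop

lemma rho_self (h x : ℝ) (hpos : 0 < incVar G P h) : rho G P h x x = 1 := by
  simp only [rho, ← sq]
  rw [hG.integral_sq_sub, add_sub_cancel_left, div_self hpos.ne']

/-- The normalized increments form a standard Gaussian process. -/
theorem contStdGaussian_normInc {h : ℝ} (hpos : 0 < incVar G P h) :
    ContStdGaussian (normInc G P h) P where
  gauss := by
    classical
    refine hG.gauss.of_isGaussianProcess fun x ↦ ⟨{x, x + h},
      (√(incVar G P h))⁻¹ • (ContinuousLinearMap.proj ⟨x + h, by simp⟩ -
        ContinuousLinearMap.proj ⟨x, by simp⟩), fun ω ↦ ?_⟩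
    simp [normInc, div_eq_inv_mul]
  meas x := ((hG.measurable_apply _).sub (hG.measurable_apply _)).div_const _
  mean x := by
    have := hG.isProb
    have hi : ∀ z, Integrable (G z) P := fun z ↦ (hG.memLp z).integrable (by norm_num)
    simp only [normInc]
    rw [integral_div, integral_sub (hi _) (hi _), hG.mean, hG.mean, sub_zero, zero_div]
  sq x := by
    have := hG.rho_self h x hpos
    rw [← cov2_normInc h x x hpos.le] at this
    simpa [cov2, sq] using this
  jmeas := ((hG.meas.comp ((measurable_snd.add_const h).prodMk measurable_fst)).sub
    (hG.meas.comp (measurable_snd.prodMk measurable_fst))).div_const _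
  cont := by
    simp only [cov2_normInc h _ _ hpos.le]
    exact hG.continuous_rho h

end StationaryGaussian

end IncrementProcess

/-! ### Transfer of the hypotheses and Lévy's continuity theorem. -/

section Increments

variable {Ω : Type*} [MeasurableSpace Ω] {P : Measure Ω} {G : ℝ → Ω → ℝ}

lemma modulus_eq_funInt (G : ℝ → Ω → ℝ) (P : Measure Ω) (f : ℝ → ℝ) {a b : ℝ} (hab : a ≤ b)
    (h : ℝ) : modulus G P f a b h = funInt (normInc G P h) (volume.restrict (Set.Ioc a b)) f := by
  funext ω
  rw [modulus, funInt, intervalIntegral.integral_of_le hab]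

lemma incVar_nonneg (G : ℝ → Ω → ℝ) (P : Measure Ω) (h : ℝ) : 0 ≤ incVar G P h :=
  integral_nonneg fun _ ↦ sq_nonneg _

namespace StationaryGaussian

variable (hG : StationaryGaussian G P)
include hG

lemma corrInt_eq_rhoInt {a b : ℝ} (hab : a ≤ b) {h : ℝ} (hpos : 0 < incVar G P h) (j : ℕ) :
    corrInt (normInc G P h) P (volume.restrict (Set.Ioc a b)) j = rhoInt G P a b j h := by
  rw [corrInt, integral_prod _ ((hG.contStdGaussian_normInc hpos).integrable_abs_cov2_pow j),
    rhoInt, intervalIntegral.integral_of_le hab]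
  simp only [intervalIntegral.integral_of_le hab, cov2_normInc h _ _ hpos.le]

/-- The integrand is continuous and equals 1 on the diagonal. -/
lemma rhoInt_pos {a b : ℝ} (hab : a < b) {h : ℝ} (hpos : 0 < incVar G P h) (j : ℕ) :
    0 < rhoInt G P a b j h := by
  have hc : Continuous fun p : ℝ × ℝ ↦ |rho G P h p.1 p.2| ^ j := (hG.continuous_rho h).abs.pow j
  have hin : ∀ x ∈ Set.Icc a b, 0 < ∫ y in a..b, |rho G P h x y| ^ j := fun x hx ↦ by
    refine intervalIntegral.integral_pos hab
      (hc.comp (Continuous.prodMk_right x)).continuousOn (fun y _ ↦ by positivity) ⟨x, hx, ?_⟩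
    rw [hG.rho_self h x hpos]; simp
  exact intervalIntegral.integral_pos hab
    (intervalIntegral.continuous_parametric_intervalIntegral_of_continuous' hc a b).continuousOn
    (fun x hx ↦ (hin x ⟨hx.1.le, hx.2⟩).le) ⟨a, ⟨le_rfl, hab.le⟩, hin a ⟨le_rfl, hab.le⟩⟩

/-- The normalized increments satisfy the conditions of the central limit theorem. -/
theorem correlationGap_normInc (hne : ∃ h, incVar G P h ≠ 0) {a b : ℝ} (hab : a < b)
    (hsup : ∀ j : ℕ, 1 ≤ j → ∃ C : ℝ, ∀ᶠ h in 𝓝[>] (0 : ℝ), ∀ x ∈ Set.Icc a b,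
      ∫ y in a..b, |rho G P h x y| ^ j ≤ C * rhoInt G P a b j h)
    (hlittle : ∀ j : ℕ, 1 ≤ j → (fun h ↦ rhoInt G P a b j h ^ (1 / (j : ℝ))) =o[𝓝[>] (0 : ℝ)]
      (fun h ↦ rhoInt G P a b (j + 1) h ^ (1 / ((j : ℝ) + 1)))) :
    CorrelationGap (𝓝[>] (0 : ℝ)) (fun h ↦ normInc G P h) P (volume.restrict (Set.Ioc a b)) := by
  have hpos := hG.eventually_incVar_pos hne
  refine ⟨hpos.mono fun h hh ↦ hG.contStdGaussian_normInc hh, fun j ↦ ?_, fun j hj ↦ ?_,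
    fun j hj ↦ ?_⟩
  · filter_upwards [hpos] with h hh
    rw [hG.corrInt_eq_rhoInt hab.le hh]
    exact hG.rhoInt_pos hab hh j
  · obtain ⟨C, hC⟩ := hsup j hj
    refine ⟨C, ?_⟩
    filter_upwards [hpos, hC] with h hh hCh
    filter_upwards [ae_restrict_mem measurableSet_Ioc] with x hx
    have hX := hG.contStdGaussian_normInc hh
    have h1 := hCh x ⟨hx.1.le, hx.2⟩
    have hi : Integrable (fun y ↦ |cov2 (normInc G P h) P x y| ^ j)
        (volume.restrict (Set.Ioc a b)) := by
      refine Integrable.of_bound ((hX.cont.comp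
        (Continuous.prodMk_right x)).abs.pow j).aestronglyMeasurable 1
        (Eventually.of_forall fun y ↦ ?_)
      rw [Real.norm_of_nonneg (by positivity)]
      exact pow_le_one₀ (abs_nonneg _) (hX.abs_cov2_le _ _)
    rw [hG.corrInt_eq_rhoInt hab.le hh]
    refine le_trans (le_of_eq ?_) (ENNReal.ofReal_le_ofReal h1)
    rw [intervalIntegral.integral_of_le hab.le]
    simp only [← cov2_normInc h _ _ hh.le]
    rw [ofReal_integral_eq_lintegral_ofReal hi (Eventually.of_forall fun _ ↦ by positivity)]
    refine lintegral_congr fun y ↦ ?_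
    rw [absCorr, Real.enorm_eq_ofReal_abs, ENNReal.ofReal_pow (abs_nonneg _)]
  · refine (hlittle j hj).congr' ?_ ?_
    · filter_upwards [hpos] with h hh
      rw [hG.corrInt_eq_rhoInt hab.le hh]
    · filter_upwards [hpos] with h hh
      rw [hG.corrInt_eq_rhoInt hab.le hh]

/-- Convergence in distribution requires measurability for every `h`, including those with σ²(h) =
0, where division by zero makes the normalized increment 0 and the functional constant. -/
lemma aemeasurable_modulus {f : ℝ → ℝ} (hf : MemLp f 2 (gaussianReal 0 1)) {a b : ℝ}
    (hab : a ≤ b) (h : ℝ) : AEMeasurable (modulus G P f a b h) P := by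
  rcases (incVar_nonneg G P h).eq_or_lt with h0 | h0
  · have : modulus G P f a b h = fun _ ↦ ∫ _ in a..b, f 0 := by
      funext ω
      simp [modulus, normInc, ← h0]
    rw [this]
    exact aemeasurable_const
  · rw [modulus_eq_funInt G P f hab]
    exact ((hG.contStdGaussian_normInc h0).memLp_funInt _ hf).aestronglyMeasurable.aemeasurable

end StationaryGaussian

/-- Lévy's continuity theorem along sequences, extended to the filter by countable generation. -/
lemma tendstoInDistribution_of_tendsto_integral_cexp [IsProbabilityMeasure P] {ι : Type*}
    {l : Filter ι} [l.IsCountablyGenerated] {Z : ι → Ω → ℝ} (hZ : ∀ i, AEMeasurable (Z i) P)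
    (h : ∀ t : ℝ, Tendsto (fun i ↦ ∫ ω, Complex.exp ((t * Z i ω : ℝ) * Complex.I) ∂P) l
      (𝓝 (Complex.exp (-(t ^ 2 / 2 : ℝ))))) :
    TendstoInDistribution Z l (id : ℝ → ℝ) (fun _ ↦ P) (gaussianReal 0 1) where
  forall_aemeasurable := hZ
  aemeasurable_limit := aemeasurable_id
  tendsto := by
    refine tendsto_of_seq_tendsto fun u hu ↦ ?_
    refine ProbabilityMeasure.tendsto_iff_tendsto_charFun.2 fun t ↦ ?_
    have h1 := (h t).comp hu
    have e : charFun ((gaussianReal 0 1).map (id : ℝ → ℝ)) t =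
        Complex.exp (-(t ^ 2 / 2 : ℝ)) := by
      rw [Measure.map_id, charFun_gaussianReal]
      congr 1
      simp
    change Tendsto _ _ (𝓝 (charFun ((gaussianReal 0 1).map (id : ℝ → ℝ)) t))
    rw [e]
    refine h1.congr fun n ↦ ?_
    change _ = charFun (P.map (Z (u n))) t
    rw [charFun_apply_real, integral_map (hZ _)
      (by fun_prop : Continuous fun x : ℝ ↦ Complex.exp ((t : ℂ) * x *
        Complex.I)).aestronglyMeasurable]
    simp

end Increments

end GaussModulus

/-! ### The central limit theorem. -/

theorem theorem1p3 {Ω : Type*} [MeasurableSpace Ω] (P : Measure Ω) [IsProbabilityMeasure P]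
    (G : ℝ → Ω → ℝ)
    (hGmeas : Measurable (Function.uncurry G))
    (hGauss : IsGaussianProcess G P)
    (hmean : ∀ x, ∫ ω, G x ω ∂P = 0)
    (hstat : GaussModulus.HasStationaryIncrements G P)
    (hnontriv : ∃ h, GaussModulus.incVar G P h ≠ 0)
    (a b : ℝ) (hab : a < b)
    (hsup : ∀ j : ℕ, 1 ≤ j → ∃ C : ℝ, ∀ᶠ h in 𝓝[>] (0 : ℝ), ∀ x ∈ Set.Icc a b,
      ∫ y in a..b, |GaussModulus.rho G P h x y| ^ j ≤ C * GaussModulus.rhoInt G P a b j h)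
    (hlittle : ∀ j : ℕ, 1 ≤ j →
      (fun h ↦ GaussModulus.rhoInt G P a b j h ^ (1 / (j : ℝ)))
        =o[𝓝[>] (0 : ℝ)]
      (fun h ↦ GaussModulus.rhoInt G P a b (j + 1) h ^ (1 / ((j : ℝ) + 1))))
    (f : ℝ → ℝ)
    (hf : MemLp f 2 (gaussianReal 0 1))
    (hsymm : ∀ᵐ x ∂(gaussianReal 0 1), f (-x) = f x)
    (hnonconst : ¬ ∃ c : ℝ, ∀ᵐ x ∂(gaussianReal 0 1), f x = c) :
    -- for small `h` the normalization, the functional and its variance are meaningful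
    (∀ᶠ h in 𝓝[>] (0 : ℝ),
      0 < GaussModulus.incVar G P h ∧
      (∀ᵐ ω ∂P, IntervalIntegrable (fun x ↦ f (GaussModulus.normInc G P h x ω)) volume a b) ∧
      MemLp (GaussModulus.modulus G P f a b h) 2 P ∧
      0 < variance (GaussModulus.modulus G P f a b h) P) ∧
    TendstoInDistribution
      (fun (h : ℝ) ω ↦
        (GaussModulus.modulus G P f a b h ω - (b - a) * ∫ x, f x ∂(gaussianReal 0 1)) /
          √(variance (GaussModulus.modulus G P f a b h) P))
      (𝓝[>] (0 : ℝ)) (id : ℝ → ℝ) (fun _ ↦ P) (gaussianReal 0 1) := by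
  have hG : GaussModulus.StationaryGaussian G P := ⟨hGmeas, hGauss, hmean, hstat⟩
  have hgap := hG.correlationGap_normInc hnontriv hab hsup hlittle
  have hne := GaussModulus.exists_hCoef_ne_zero hf hnonconst
  have hodd : ∀ n, Odd n → GaussModulus.hCoef f n = 0 := fun n hn ↦
    GaussModulus.hCoef_eq_zero_of_odd hsymm hn
  constructor
  · obtain ⟨k, hk, hck⟩ := hne
    filter_upwards [hG.eventually_incVar_pos hnontriv] with h hh
    have hX := hG.contStdGaussian_normInc hh
    rw [GaussModulus.modulus_eq_funInt G P f hab.le]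
    refine ⟨hh, ?_, hX.memLp_funInt _ hf, ?_⟩
    · filter_upwards [hX.ae_integrable_comp (volume.restrict (Set.Ioc a b)) hf] with ω hω
      rwa [intervalIntegrable_iff_integrableOn_Ioc_of_le hab.le]
    · rw [hX.variance_funInt _ hf]
      refine lt_of_lt_of_le ?_ (hX.le_variance _ hf hodd hk)
      rw [hG.corrInt_eq_rhoInt hab.le hh]
      have := hG.rhoInt_pos hab hh k
      positivity
  · refine GaussModulus.tendstoInDistribution_of_tendsto_integral_cexp
      (fun h ↦ ((hG.aemeasurable_modulus hf hab.le h).sub_const _).div_const _) fun t ↦ ?_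
    have h1 := hgap.tendsto_charFun_funInt hf hodd hne t
    simp only [← GaussModulus.modulus_eq_funInt G P f hab.le, GaussModulus.hCoef_zero,
      measureReal_restrict_apply_univ, Real.volume_real_Ioc_of_le hab.le] at h1
    exact h1
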